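/- **Proposition (Isomorphism with change of connections).** Let $M$ be a smooth (Hausdorff, second countable, finite-dimensional) manifold and let $Q\to M$ and $B^*\to M$ be smooth real vector bundles of finite rank. Let $\mathcal M=Q[1]\oplus B^*[2]$ be the corresponding split $[2]$-manifold: its graded algebra of functions is $C(\mathcal M)=\Gamma(\bigwedge Q^*\otimes S B)$, where $C^\infty(M)$ has degree $0$, $\Gamma(Q^*)$ degree $1$ and $\Gamma(B)$ degree $2$. A vector field of degree $j$ on $\mathcal M$ is an $\mathbb R$-linear map $\mathcal X\colon C(\mathcal M)\to C(\mathcal M)$ that raises degrees by $j$ and satisfies $\mathcal X(\xi\zeta)=\mathcal X(\xi)\zeta+(-1)^{j|\xi|}\xi\,\mathcal X(\zeta)$; $\mathfrak X(\mathcal M)$ is the direct sum over $j$ of these spaces, a left $C(\mathcal M)$-module by $(\xi\mathcal X)(\zeta)=\xi\,\mathcal X(\zeta)$. Let $\mathcal Q$ be a vector field of degree $1$ with $\mathcal Q\circ\mathcal Q=0$, so that $(\mathcal M,\mathcal Q)$ is a split Lie 2-algebroid, and let $[\mathcal Q,\cdot]$ be the graded commutator, $[\mathcal Q,\mathcal X]=\mathcal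 Q\mathcal X-(-1)^{j}\mathcal X\mathcal Q$ for $\mathcal X$ of degree $j$. A left 3-term representation up to homotopy of $(\mathcal M,\mathcal Q)$ on $E_0[0]\oplus E_1[1]\oplus E_2[2]$ (elements of $\Gamma(E_i)$ have degree $-i$) is an $\mathbb R$-linear operator $\mathcal D$ of degree $1$ on $C(\mathcal M)\otimes_{C^\infty(M)}\Gamma(E_0\oplus E_1\oplus E_2)$ with $\mathcal D^2=0$ and $\mathcal D(\xi\eta)=\mathcal Q(\xi)\eta+(-1)^{|\xi|}\xi\,\mathcal D(\eta)$. An isomorphism of such representations is a bijective $C(\mathcal M)$-linear map that preserves degrees, as does its inverse, and that commutes with the differentials. For $q\in\Gamma(Q)$ and $\beta\in\Gamma(B^*)$ let $\hat q$ and $\hat\beta$ be the vector fields of degree $-1$ and $-2$ that vanish on $C^\infty(M)$ and satisfy $\hat q(\tau)=\langle\tau,q\rangle$, $\hat q(b)=0$, $\hat\beta(\tau)=0$, $\hat\beta(b)=\langle b,\beta\rangle$ for $\tau\in\Gamma(Q^*)$, $b\in\Gamma(B)$. For $TM$-connections $\nabla$ on $Q$ and on $B^*$ and $X\in\mathfrak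 X(M)$ let $\nabla^{B^*}_X\oplus\nabla^{Q}_X$ be the vector field of degree $0$ given by $f\mapsto X(f)$ on $C^\infty(M)$ and by the dual connections on $\Gamma(Q^*)$ and $\Gamma(B)$. Let $$\mu_\nabla\colon C(\mathcal M)\otimes_{C^\infty(M)}\Gamma(TM[0]\oplus Q[1]\oplus B^*[2])\to\mathfrak X(\mathcal M),\qquad X\mapsto\nabla^{B^*}_X\oplus\nabla^Q_X,\quad q\mapsto\hat q,\quad\beta\mapsto\hat\beta,$$ extended $C(\mathcal M)$-linearly. Let $\nabla$ and $\nabla'$ be two choices of a pair of $TM$-connections on $Q$ and $B^*$. Then: 1. $\mu_\nabla$ and $\mu_{\nabla'}$ are degree-preserving isomorphisms of $C(\mathcal M)$-modules onto $\mathfrak X(\mathcal M)$, and the operators $\mathcal D_{\mathrm{ad}_\nabla}=\mu_\nabla^{-1}\circ[\mathcal Q,\cdot]\circ\mu_\nabla$ and $\mathcal D_{\mathrm{ad}_{\nabla'}}=\mu_{\nabla'}^{-1}\circ[\mathcal Q,\cdot]\circ\mu_{\nabla'}$ are representations up to homotopy of $(\mathcal M,\mathcal Q)$ on $TM[0]\oplus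 Q[1]\oplus B^*[2]$: the adjoint representations $\mathrm{ad}_\nabla$ and $\mathrm{ad}_{\nabla'}$. 2. The difference of the connections induces an isomorphism of representations up to homotopy $\mu=\mathrm{id}\oplus(\nabla'-\nabla)\colon\mathrm{ad}_\nabla\to\mathrm{ad}_{\nabla'}$. Explicitly, $\mu$ is the $C(\mathcal M)$-linear map with $\mu(\beta)=\beta$ for $\beta\in\Gamma(B^*)$, $\mu(q)=q$ for $q\in\Gamma(Q)$, and $\mu(X)=X+\mu_1(\cdot)X+\mu_0^b(\cdot)X$ for $X\in\mathfrak X(M)$, where $\mu_1(\cdot)X\in\Gamma(Q^*)\otimes\Gamma(Q)$ and $\mu_0^b(\cdot)X\in\Gamma(B)\otimes\Gamma(B^*)$ are given by $\mu_1(q)X=\nabla'_Xq-\nabla_Xq$ and $\mu_0^b(\beta)X=\nabla'_X\beta-\nabla_X\beta$. In particular, the adjoint representation is independent, up to isomorphism, of the chosen connections. -/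

import Mathlib

namespace LieTwoAlgebroid

open scoped TensorProduct
noncomputable section

/-! ### Extending derivations -/

/-- The dual numbers `U[ε]` over an `A`-algebra `U`, with `f ∈ A` acting by `f + ε X(f)`. Algebra
maps `u ↦ u + ε δ(u)` into it are the derivations `δ` of `U` that restrict to `X` on `A`. -/
def DualNum {A : Type*} [CommRing A] [Algebra ℝ A] (_X : Derivation ℝ A A) (U : Type*) : Type _ :=
  TrivSqZeroExt U U

namespace DualNum

instance {A : Type*} [CommRing A] [Algebra ℝ A] (X : Derivation ℝ A A) (U : Type*) [Ring U] :
    Ring (DualNum X U) := inferInstanceAs (Ring (TrivSqZeroExt U U))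

instance {A : Type*} [CommRing A] [Algebra ℝ A] (X : Derivation ℝ A A) (U : Type*) [CommRing U] :
    CommRing (DualNum X U) := inferInstanceAs (CommRing (TrivSqZeroExt U U))

section
variable {A : Type*} [CommRing A] [Algebra ℝ A] (X : Derivation ℝ A A) {U : Type*}

/-- The dual number `u + ε v`. -/
def mk (u v : U) : DualNum X U := ((u, v) : U × U)

/-- The coefficient of 1. -/
def re (z : DualNum X U) : U := TrivSqZeroExt.fst z

/-- The coefficient of `ε`. -/
def im (z : DualNum X U) : U := TrivSqZeroExt.snd z

variable {X}

theorem ext' {z w : DualNum X U} (h : re X z = re X w) (h' : im X z = im X w) : z = w :=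
  TrivSqZeroExt.ext h h'
@[simp] theorem re_mk (u v : U) : re X (mk X u v) = u := rfl
@[simp] theorem im_mk (u v : U) : im X (mk X u v) = v := rfl

variable [Ring U]

@[simp] theorem re_mul (z w : DualNum X U) : re X (z * w) = re X z * re X w := rfl
@[simp] theorem im_mul (z w : DualNum X U) :
    im X (z * w) = re X z * im X w + im X z * re X w := rfl
@[simp] theorem re_add (z w : DualNum X U) : re X (z + w) = re X z + re X w := rfl
@[simp] theorem im_add (z w : DualNum X U) : im X (z + w) = im X z + im X w := rfl
@[simp] theorem re_zero : re X (0 : DualNum X U) = 0 := rfl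
@[simp] theorem im_zero : im X (0 : DualNum X U) = 0 := rfl
@[simp] theorem re_one : re X (1 : DualNum X U) = 1 := rfl
@[simp] theorem im_one : im X (1 : DualNum X U) = 0 := rfl

variable (X U) in
/-- The algebra structure `f ↦ f + ε X(f)`. -/
def structHom [Algebra A U] : A →+* DualNum X U where
  toFun f := mk X (algebraMap A U f) (algebraMap A U (X f))
  map_one' := by apply ext' <;> simp
  map_zero' := by apply ext' <;> simp
  map_add' f g := by apply ext' <;> simp
  map_mul' f g := by
    apply ext'
    · simp
    · simp [← map_mul, ← map_add, mul_comm]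

instance [Algebra A U] : Algebra A (DualNum X U) :=
  RingHom.toAlgebra' (structHom X U) (fun f u => by
    apply ext'
    · simp [structHom, Algebra.commutes]
    · simp [structHom, Algebra.commutes, add_comm])

theorem algebraMap_eq [Algebra A U] (f : A) :
    algebraMap A (DualNum X U) f = mk X (algebraMap A U f) (algebraMap A U (X f)) := rfl

theorem re_smul [Algebra A U] (f : A) (z : DualNum X U) : re X (f • z) = f • re X z := by
  rw [Algebra.smul_def, Algebra.smul_def]; rfl

theorem im_smul [Algebra A U] (f : A) (z : DualNum X U) :
    im X (f • z) = f • im X z + X f • re X z := by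
  rw [Algebra.smul_def, Algebra.smul_def, Algebra.smul_def, algebraMap_eq]; simp
end
end DualNum

section Extend
variable {A : Type*} [CommRing A] [Algebra ℝ A] {P : Type*} [AddCommGroup P] [Module A P]

/-- The algebra map `u ↦ u + ε δ(u)` for the derivation `δ` of `⋀ P` extending `X` and `D`. -/
def extDerHom (X : Derivation ℝ A A) (D : P →+ P)
    (hD : ∀ (f : A) (p : P), D (f • p) = f • D p + X f • p) :
    ExteriorAlgebra A P →ₐ[A] DualNum X (ExteriorAlgebra A P) :=
  ExteriorAlgebra.lift A
    ⟨{ toFun := fun p => DualNum.mk X (ExteriorAlgebra.ι A p) (ExteriorAlgebra.ι A (D p))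
       map_add' := fun p q => by apply DualNum.ext' <;> simp
       map_smul' := fun f p => by
        apply DualNum.ext'
        · simp [DualNum.re_smul]
        · simp [DualNum.im_smul, hD] },
     fun p => by
      apply DualNum.ext'
      · simp
      · simp [ExteriorAlgebra.ι_add_mul_swap]⟩

theorem extDerHom_re (X : Derivation ℝ A A) (D : P →+ P)
    (hD : ∀ (f : A) (p : P), D (f • p) = f • D p + X f • p) (u : ExteriorAlgebra A P) :
    DualNum.re X (extDerHom X D hD u) = u := by
  induction u using ExteriorAlgebra.induction with
  | algebraMap r => rw [AlgHom.commutes]; rfl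
  | ι x => simp [extDerHom]
  | mul a b ha hb => rw [map_mul, DualNum.re_mul, ha, hb]
  | add a b ha hb => rw [map_add, DualNum.re_add, ha, hb]

/-- The derivation of `⋀ P` that is `X` on `A` and `D` on `P`. -/
def extDer (X : Derivation ℝ A A) (D : P →+ P)
    (hD : ∀ (f : A) (p : P), D (f • p) = f • D p + X f • p) :
    ExteriorAlgebra A P →+ ExteriorAlgebra A P where
  toFun u := DualNum.im X (extDerHom X D hD u)
  map_zero' := by simp
  map_add' u v := by simp

/-- The algebra map `u ↦ u + ε δ(u)` for the derivation `δ` of `S P` extending `X` and `D`. -/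
def symDerHom (X : Derivation ℝ A A) (D : P →+ SymmetricAlgebra A P)
    (hD : ∀ (f : A) (p : P), D (f • p) = f • D p + X f • SymmetricAlgebra.ι A P p) :
    SymmetricAlgebra A P →ₐ[A] DualNum X (SymmetricAlgebra A P) :=
  SymmetricAlgebra.lift
     { toFun := fun p => DualNum.mk X (SymmetricAlgebra.ι A P p) (D p)
       map_add' := fun p q => by apply DualNum.ext' <;> simp
       map_smul' := fun f p => by
        apply DualNum.ext'
        · simp [DualNum.re_smul]
        · simp [DualNum.im_smul, hD] }


theorem symDerHom_re (X : Derivation ℝ A A) (D : P →+ SymmetricAlgebra A P)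
    (hD : ∀ (f : A) (p : P), D (f • p) = f • D p + X f • SymmetricAlgebra.ι A P p)
    (u : SymmetricAlgebra A P) : DualNum.re X (symDerHom X D hD u) = u := by
  induction u using SymmetricAlgebra.induction with
  | algebraMap r => rw [AlgHom.commutes]; rfl
  | ι x => simp [symDerHom]
  | mul a b ha hb => rw [map_mul, DualNum.re_mul, ha, hb]
  | add a b ha hb => rw [map_add, DualNum.re_add, ha, hb]

/-- The derivation of `S P` that is `X` on `A` and `D` on `P`. -/
def symDer (X : Derivation ℝ A A) (D : P →+ SymmetricAlgebra A P)
    (hD : ∀ (f : A) (p : P), D (f • p) = f • D p + X f • SymmetricAlgebra.ι A P p) :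
    SymmetricAlgebra A P →+ SymmetricAlgebra A P where
  toFun u := DualNum.im X (symDerHom X D hD u)
  map_zero' := by simp
  map_add' u v := by simp

section
variable (X : Derivation ℝ A A) (D : P →+ P)
    (hD : ∀ (f : A) (p : P), D (f • p) = f • D p + X f • p)

theorem extDer_mul (u v : ExteriorAlgebra A P) :
    extDer X D hD (u * v) = u * extDer X D hD v + extDer X D hD u * v := by
  simp [extDer, extDerHom_re]

theorem extDer_algebraMap (f : A) :
    extDer X D hD (algebraMap A _ f) = algebraMap A _ (X f) := by
  simp [extDer, DualNum.algebraMap_eq]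

theorem extDer_ι (p : P) : extDer X D hD (ExteriorAlgebra.ι A p) = ExteriorAlgebra.ι A (D p) := by
  simp [extDer, extDerHom]

theorem extDer_smul (f : A) (u : ExteriorAlgebra A P) :
    extDer X D hD (f • u) = f • extDer X D hD u + X f • u := by
  simp [extDer, DualNum.im_smul, extDerHom_re]

/-- Extensions depend linearly on the data. -/
theorem extDer_lin (X' X'' : Derivation ℝ A A) (D' D'' : P →+ P)
    (hD' : ∀ (f : A) (p : P), D' (f • p) = f • D' p + X' f • p)
    (hD'' : ∀ (f : A) (p : P), D'' (f • p) = f • D'' p + X'' f • p) (a b : A)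
    (h : ∀ f, X'' f = a * X f + b * X' f) (h' : ∀ p, D'' p = a • D p + b • D' p)
    (u : ExteriorAlgebra A P) :
    extDer X'' D'' hD'' u = a • extDer X D hD u + b • extDer X' D' hD' u := by
  induction u using ExteriorAlgebra.induction with
  | algebraMap r => simp [extDer_algebraMap, h, Algebra.smul_def]
  | ι x => simp [extDer_ι, h']
  | mul u v hu hv =>
    simp only [extDer_mul, hu, hv, mul_add, add_mul, smul_add, mul_smul_comm, smul_mul_assoc]
    abel
  | add u v hu hv => simp only [map_add, hu, hv, smul_add]; abel
end

section
variable (X : Derivation ℝ A A) (D : P →+ SymmetricAlgebra A P)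
    (hD : ∀ (f : A) (p : P), D (f • p) = f • D p + X f • SymmetricAlgebra.ι A P p)

theorem symDer_mul (u v : SymmetricAlgebra A P) :
    symDer X D hD (u * v) = u * symDer X D hD v + symDer X D hD u * v := by
  simp [symDer, symDerHom_re]

theorem symDer_algebraMap (f : A) :
    symDer X D hD (algebraMap A _ f) = algebraMap A _ (X f) := by
  simp [symDer, DualNum.algebraMap_eq]

theorem symDer_ι (p : P) : symDer X D hD (SymmetricAlgebra.ι A P p) = D p := by
  simp [symDer, symDerHom]

theorem symDer_smul (f : A) (u : SymmetricAlgebra A P) :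
    symDer X D hD (f • u) = f • symDer X D hD u + X f • u := by
  simp [symDer, DualNum.im_smul, symDerHom_re]

/-- Extensions depend linearly on the data. -/
theorem symDer_lin (X' X'' : Derivation ℝ A A) (D' D'' : P →+ SymmetricAlgebra A P)
    (hD' : ∀ (f : A) (p : P), D' (f • p) = f • D' p + X' f • SymmetricAlgebra.ι A P p)
    (hD'' : ∀ (f : A) (p : P), D'' (f • p) = f • D'' p + X'' f • SymmetricAlgebra.ι A P p) (a b : A)
    (h : ∀ f, X'' f = a * X f + b * X' f) (h' : ∀ p, D'' p = a • D p + b • D' p)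
    (u : SymmetricAlgebra A P) :
    symDer X'' D'' hD'' u = a • symDer X D hD u + b • symDer X' D' hD' u := by
  induction u using SymmetricAlgebra.induction with
  | algebraMap r => simp [symDer_algebraMap, h, Algebra.smul_def]
  | ι x => simp [symDer_ι, h']
  | mul u v hu hv =>
    simp only [symDer_mul, hu, hv, mul_add, add_mul, smul_add, mul_smul_comm, smul_mul_assoc]
    abel
  | add u v hu hv => simp only [map_add, hu, hv, smul_add]; abel
end

end Extend

/-! ### Functions and vector fields on `Q[1] ⊕ B*[2]` -/

/-- The algebra of functions on the split `[2]`-manifold `Q[1] ⊕ B*[2]`, where `A = C^∞(M)`,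
`V = Γ(Q)` and `W = Γ(B*)`: the algebra `Γ(⋀ Q* ⊗ S B) = ⋀ Γ(Q*) ⊗_A S Γ(B)`.
Sections of a dual bundle are given as `A`-linear functionals on sections. -/
abbrev Fn (A V W : Type*) [CommRing A] [AddCommGroup V] [Module A V] [AddCommGroup W]
    [Module A W] : Type _ :=
  ExteriorAlgebra A (Module.Dual A V) ⊗[A] SymmetricAlgebra A (Module.Dual A W)

section Fn
variable (A : Type*) [CommRing A] (V W : Type*) [AddCommGroup V] [Module A V] [AddCommGroup W]
  [Module A W]

/-- The generator of degree 1 given by a section `τ` of `Q*`. -/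
def ιV : Module.Dual A V →ₗ[A] Fn A V W :=
  (TensorProduct.mk A _ _).flip 1 ∘ₗ ExteriorAlgebra.ι A

/-- The generator of degree 2 given by a section `b` of `B`. -/
def ιW : Module.Dual A W →ₗ[A] Fn A V W :=
  TensorProduct.mk A _ _ 1 ∘ₗ SymmetricAlgebra.ι A _

/-- The functions of degree `k`: the sum of all `⋀^p Γ(Q*) ⊗ S^r Γ(B)` with `p + 2 r = k`. -/
def deg (k : ℤ) : Submodule A (Fn A V W) :=
  ⨆ (p : ℕ) (r : ℕ) (_ : (p : ℤ) + 2 * r = k),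
    Submodule.map₂ (TensorProduct.mk A _ _) (⋀[A]^p (Module.Dual A V))
      (LinearMap.range (SymmetricAlgebra.ι A (Module.Dual A W)) ^ r)

variable {A V W} [Algebra ℝ A]

/-- `𝒳` is a vector field of degree `j` on `Q[1] ⊕ B*[2]`, that is, a graded derivation of degree
`j` of the algebra of functions. -/
structure IsVectorField (j : ℤ) (𝒳 : Fn A V W →ₗ[ℝ] Fn A V W) : Prop where
  degree : ∀ k, ∀ ξ ∈ deg A V W k, 𝒳 ξ ∈ deg A V W (j + k)
  leibniz : ∀ k, ∀ ξ ∈ deg A V W k, ∀ ζ,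
    𝒳 (ξ * ζ) = 𝒳 ξ * ζ + (j * k).negOnePow • (ξ * 𝒳 ζ)

variable (A V W) in
/-- The space of vector fields on `Q[1] ⊕ B*[2]`: finite sums of vector fields of all degrees. -/
def vectorFields : Submodule ℝ (Fn A V W →ₗ[ℝ] Fn A V W) :=
  Submodule.span ℝ {𝒳 | ∃ j, IsVectorField j 𝒳}

/-- The sign operator `ξ ↦ (-1)^{|ξ|} ξ` on functions. -/
def parity : Fn A V W →ₗ[ℝ] Fn A V W :=
  (Algebra.TensorProduct.map (CliffordAlgebra.involute (Q := (0 : QuadraticForm A _)))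
    (AlgHom.id A _)).toLinearMap.restrictScalars ℝ

variable (A V W) in
/-- A split Lie 2-algebroid structure on `Q[1] ⊕ B*[2]`: a homological vector field. -/
structure SplitLieTwoAlgebroid where
  /-- the vector field -/
  vf : Fn A V W →ₗ[ℝ] Fn A V W
  isVectorField : IsVectorField 1 vf
  sq_zero : vf ∘ₗ vf = 0

/-- The graded commutator `[𝒬, 𝒳]` with a vector field `𝒬` of degree 1. If `𝒳` has degree `j`, then
`parity ∘ 𝒳 ∘ parity = (-1)^j 𝒳`, so this is `𝒬 ∘ 𝒳 - (-1)^j 𝒳 ∘ 𝒬`. -/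
def SplitLieTwoAlgebroid.lie (𝒬 : SplitLieTwoAlgebroid A V W) (𝒳 : Fn A V W →ₗ[ℝ] Fn A V W) :
    Fn A V W →ₗ[ℝ] Fn A V W :=
  𝒬.vf ∘ₗ 𝒳 - (parity ∘ₗ 𝒳 ∘ₗ parity) ∘ₗ 𝒬.vf

end Fn

section Der
variable {A : Type*} [CommRing A] [Algebra ℝ A]
  {V W : Type*} [AddCommGroup V] [Module A V] [AddCommGroup W] [Module A W]

/-- The derivation of degree 0 of the functions that is `X` on `A`, `D` on `Γ(Q*)` and `D'` on
`Γ(B)`. -/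
def evenDer (X : Derivation ℝ A A) (D : Module.Dual A V →+ Module.Dual A V)
    (hD : ∀ (f : A) (p : Module.Dual A V), D (f • p) = f • D p + X f • p)
    (D' : Module.Dual A W →+ SymmetricAlgebra A (Module.Dual A W))
    (hD' : ∀ (f : A) (p : Module.Dual A W),
      D' (f • p) = f • D' p + X f • SymmetricAlgebra.ι A _ p) :
    Fn A V W →ₗ[ℝ] Fn A V W :=
  let δ : Fn A V W →+ Fn A V W := TensorProduct.liftAddHom
    { toFun := fun u =>
        { toFun := fun s => extDer X D hD u ⊗ₜ[A] s + u ⊗ₜ[A] symDer X D' hD' s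
          map_zero' := by simp
          map_add' := fun s t => by simp only [TensorProduct.tmul_add, map_add]; abel }
      map_zero' := by ext; simp
      map_add' := fun u v => by
        ext s
        simp only [TensorProduct.add_tmul, map_add, AddMonoidHom.coe_mk, ZeroHom.coe_mk,
          AddMonoidHom.add_apply]
        abel }
    (fun r u s => by
      simp only [AddMonoidHom.coe_mk, ZeroHom.coe_mk, extDer_smul, symDer_smul,
        TensorProduct.add_tmul, TensorProduct.tmul_add, TensorProduct.tmul_smul,
        TensorProduct.smul_tmul']
      abel)
  { δ with
    map_smul' := fun r c => by
      simp only [RingHom.id_apply]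
      induction c using TensorProduct.induction_on with
      | zero => simp
      | tmul u s =>
        have h : ∀ u : ExteriorAlgebra A (Module.Dual A V), r • u = algebraMap ℝ A r • u :=
          fun u => by rw [algebraMap_smul]
        simp only [TensorProduct.smul_tmul', h, δ, extDer_smul, ZeroHom.toFun_eq_coe,
          AddMonoidHom.toZeroHom_coe, TensorProduct.liftAddHom_tmul, AddMonoidHom.coe_mk,
          ZeroHom.coe_mk, Derivation.map_algebraMap, zero_smul, add_zero, smul_add]
      | add a b ha hb =>
        rw [smul_add]
        simp_all }

theorem evenDer_tmul (X : Derivation ℝ A A) (D : Module.Dual A V →+ Module.Dual A V)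
    (hD : ∀ (f : A) (p : Module.Dual A V), D (f • p) = f • D p + X f • p)
    (D' : Module.Dual A W →+ SymmetricAlgebra A (Module.Dual A W))
    (hD' : ∀ (f : A) (p : Module.Dual A W),
      D' (f • p) = f • D' p + X f • SymmetricAlgebra.ι A _ p)
    (u : ExteriorAlgebra A (Module.Dual A V)) (s : SymmetricAlgebra A (Module.Dual A W)) :
    evenDer X D hD D' hD' (u ⊗ₜ[A] s) = extDer X D hD u ⊗ₜ[A] s + u ⊗ₜ[A] symDer X D' hD' s :=
  rfl

theorem evenDer_lin (X : Derivation ℝ A A) (D : Module.Dual A V →+ Module.Dual A V)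
    (hD : ∀ (f : A) (p : Module.Dual A V), D (f • p) = f • D p + X f • p)
    (E : Module.Dual A W →+ SymmetricAlgebra A (Module.Dual A W))
    (hE : ∀ (f : A) (p : Module.Dual A W),
      E (f • p) = f • E p + X f • SymmetricAlgebra.ι A _ p)
    (X' : Derivation ℝ A A) (D' : Module.Dual A V →+ Module.Dual A V)
    (hD' : ∀ (f : A) (p : Module.Dual A V), D' (f • p) = f • D' p + X' f • p)
    (E' : Module.Dual A W →+ SymmetricAlgebra A (Module.Dual A W))
    (hE' : ∀ (f : A) (p : Module.Dual A W),
      E' (f • p) = f • E' p + X' f • SymmetricAlgebra.ι A _ p)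
    (X'' : Derivation ℝ A A) (D'' : Module.Dual A V →+ Module.Dual A V)
    (hD'' : ∀ (f : A) (p : Module.Dual A V), D'' (f • p) = f • D'' p + X'' f • p)
    (E'' : Module.Dual A W →+ SymmetricAlgebra A (Module.Dual A W))
    (hE'' : ∀ (f : A) (p : Module.Dual A W),
      E'' (f • p) = f • E'' p + X'' f • SymmetricAlgebra.ι A _ p) (a b : A)
    (h : ∀ f, X'' f = a * X f + b * X' f) (hd : ∀ p, D'' p = a • D p + b • D' p)
    (he : ∀ p, E'' p = a • E p + b • E' p) :
    evenDer X'' D'' hD'' E'' hE'' = a • evenDer X D hD E hE + b • evenDer X' D' hD' E' hE' := by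
  ext c
  induction c using TensorProduct.induction_on with
  | zero => simp
  | tmul u s =>
    simp only [LinearMap.add_apply, LinearMap.smul_apply, evenDer_tmul,
      extDer_lin X D hD X' X'' D' D'' hD' hD'' a b h hd,
      symDer_lin X E hE X' X'' E' E'' hE' hE'' a b h he,
      TensorProduct.add_tmul, TensorProduct.tmul_add, TensorProduct.tmul_smul,
      TensorProduct.smul_tmul', smul_add]
    abel
  | add x y hx hy => simp only [map_add, hx, hy]

/-- The vector field `q̂` of degree `-1` given by a section `q` of `Q`. -/
def hatV : V →ₗ[A] (Fn A V W →ₗ[ℝ] Fn A V W) where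
  toFun q := ((CliffordAlgebra.contractLeft (Q := (0 : QuadraticForm A (Module.Dual A V)))
    (Module.Dual.eval A V q)).rTensor (SymmetricAlgebra A (Module.Dual A W))).restrictScalars ℝ
  map_add' p q := by ext c; simp [LinearMap.rTensor_add]
  map_smul' f q := by ext c; simp [LinearMap.rTensor_smul]

/-- The map `b ↦ b(β)` on generators of degree 2. -/
def evalGen (β : W) : Module.Dual A W →+ SymmetricAlgebra A (Module.Dual A W) where
  toFun b := algebraMap A _ (b β)
  map_zero' := by simp
  map_add' b c := by simp

theorem evalGen_smul (β : W) (f : A) (b : Module.Dual A W) :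
    evalGen β (f • b) =
      f • evalGen β b + (0 : Derivation ℝ A A) f • SymmetricAlgebra.ι A _ b := by
  simp [evalGen, Algebra.smul_def]

theorem zero_der_smul (f : A) (p : Module.Dual A V) :
    (0 : Module.Dual A V →+ Module.Dual A V) (f • p) =
      f • (0 : Module.Dual A V →+ Module.Dual A V) p + (0 : Derivation ℝ A A) f • p := by
  simp

/-- The vector field `β̂` of degree `-2` given by a section `β` of `B*`. -/
def hatW : W →ₗ[A] (Fn A V W →ₗ[ℝ] Fn A V W) where
  toFun β := evenDer 0 0 zero_der_smul (evalGen β) (evalGen_smul β)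
  map_add' β γ := by
    rw [evenDer_lin 0 0 zero_der_smul (evalGen β) (evalGen_smul β) 0 0 zero_der_smul
      (evalGen γ) (evalGen_smul γ) 0 0 zero_der_smul _ (evalGen_smul (β + γ)) 1 1 (by simp)
      (by simp) (by simp [evalGen]), one_smul, one_smul]
  map_smul' f β := by
    rw [evenDer_lin 0 0 zero_der_smul (evalGen β) (evalGen_smul β) 0 0 zero_der_smul
      (evalGen β) (evalGen_smul β) 0 0 zero_der_smul _ (evalGen_smul (f • β)) f 0 (by simp)
      (by simp) (by simp [evalGen, Algebra.smul_def]), zero_smul, add_zero, RingHom.id_apply]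

variable {T : Type*} [AddCommGroup T] [Module A T]

/-- A linear connection `∇ : 𝔛(M) × Γ(E) → Γ(E)`, where `T = 𝔛(M)`, `V = Γ(E)` and `act` is the
action of vector fields on functions. -/
structure Connection (act : T →ₗ[A] Derivation ℝ A A) (V : Type*) [AddCommGroup V]
    [Module A V] where
  /-- `toFun X v` is `∇_X v` -/
  toFun : T →ₗ[A] (V →+ V)
  leibniz : ∀ X (f : A) v, toFun X (f • v) = f • toFun X v + act X f • v

namespace Connection
variable {act : T →ₗ[A] Derivation ℝ A A}

/-- The dual connection: `(∇*_X φ)(v) = X(φ(v)) - φ(∇_X v)`. -/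
def dual (D : Connection act V) (X : T) : Module.Dual A V →+ Module.Dual A V where
  toFun φ :=
    { toFun := fun v => act X (φ v) - φ (D.toFun X v)
      map_add' := fun v w => by simp only [map_add]; abel
      map_smul' := fun f v => by
        simp only [D.leibniz, map_smul, map_add, smul_eq_mul, Derivation.leibniz, RingHom.id_apply]
        ring }
  map_zero' := by ext; simp
  map_add' φ ψ := by ext; simp; ring

theorem dual_apply (D : Connection act V) (X : T) (φ : Module.Dual A V) (v : V) :
    D.dual X φ v = act X (φ v) - φ (D.toFun X v) := rfl

theorem dual_smul (D : Connection act V) (X : T) (f : A) (φ : Module.Dual A V) :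
    D.dual X (f • φ) = f • D.dual X φ + act X f • φ := by
  ext v
  simp only [dual_apply, LinearMap.add_apply, LinearMap.smul_apply, smul_eq_mul,
    Derivation.leibniz]
  ring

theorem dual_add_left (D : Connection act V) (X Y : T) (φ : Module.Dual A V) :
    D.dual (X + Y) φ = D.dual X φ + D.dual Y φ := by
  ext v
  simp [dual_apply]; ring

theorem dual_smul_left (D : Connection act V) (X : T) (f : A) (φ : Module.Dual A V) :
    D.dual (f • X) φ = f • D.dual X φ := by
  ext v
  simp [dual_apply, mul_sub]

/-- The dual connection, with values in the symmetric algebra. -/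
def dualGen (D : Connection act W) (X : T) :
    Module.Dual A W →+ SymmetricAlgebra A (Module.Dual A W) where
  toFun b := SymmetricAlgebra.ι A _ (D.dual X b)
  map_zero' := by simp
  map_add' b c := by simp

theorem dualGen_apply (D : Connection act W) (X : T) (b : Module.Dual A W) :
    D.dualGen X b = SymmetricAlgebra.ι A _ (D.dual X b) := rfl

theorem dualGen_smul (D : Connection act W) (X : T) (f : A) (b : Module.Dual A W) :
    D.dualGen X (f • b) = f • D.dualGen X b + act X f • SymmetricAlgebra.ι A _ b := by
  simp [dualGen_apply, dual_smul]

/-- The vector field `∇^{B*}_X ⊕ ∇^Q_X` of degree 0: it acts on functions of degree 0 by `X`, and on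
the generators by the dual connections. -/
def horizontal (D : Connection act V) (D' : Connection act W) :
    T →ₗ[A] (Fn A V W →ₗ[ℝ] Fn A V W) where
  toFun X := evenDer (act X) (D.dual X) (D.dual_smul X) (D'.dualGen X) (D'.dualGen_smul X)
  map_add' X Y := by
    rw [evenDer_lin (act X) (D.dual X) (D.dual_smul X) (D'.dualGen X) (D'.dualGen_smul X)
      (act Y) (D.dual Y) (D.dual_smul Y) (D'.dualGen Y) (D'.dualGen_smul Y)
      (act (X + Y)) _ (D.dual_smul (X + Y)) _ (D'.dualGen_smul (X + Y)) 1 1 (by simp)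
      (by simp [dual_add_left]) (by simp [dualGen_apply, dual_add_left]), one_smul, one_smul]
  map_smul' f X := by
    rw [evenDer_lin (act X) (D.dual X) (D.dual_smul X) (D'.dualGen X) (D'.dualGen_smul X)
      (act X) (D.dual X) (D.dual_smul X) (D'.dualGen X) (D'.dualGen_smul X)
      (act (f • X)) _ (D.dual_smul (f • X)) _ (D'.dualGen_smul (f • X)) f 0 (by simp)
      (by simp [dual_smul_left]) (by simp [dualGen_apply, dual_smul_left]), zero_smul, add_zero,
      RingHom.id_apply]

end Connection
end Der

section Rep
variable (A : Type*) [CommRing A] (V W E₀ E₁ E₂ : Type*)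
  [AddCommGroup V] [Module A V] [AddCommGroup W] [Module A W]
  [AddCommGroup E₀] [Module A E₀] [AddCommGroup E₁] [Module A E₁] [AddCommGroup E₂] [Module A E₂]

/-- The left module `C(𝓜) ⊗ Γ(E₀[0] ⊕ E₁[1] ⊕ E₂[2])`. -/
abbrev ThreeTerm : Type _ := Fn A V W ⊗[A] (E₀ × E₁ × E₂)

namespace ThreeTerm

/-- `ξ ⊗ e ↦ ξ ⊗ e` for `e ∈ Γ(E₀)`. -/
def in₀ : Fn A V W ⊗[A] E₀ →ₗ[A] ThreeTerm A V W E₀ E₁ E₂ :=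
  (LinearMap.inl A E₀ (E₁ × E₂)).lTensor _

/-- `ξ ⊗ e ↦ ξ ⊗ e` for `e ∈ Γ(E₁)`. -/
def in₁ : Fn A V W ⊗[A] E₁ →ₗ[A] ThreeTerm A V W E₀ E₁ E₂ :=
  (LinearMap.inr A E₀ (E₁ × E₂) ∘ₗ LinearMap.inl A E₁ E₂).lTensor _

/-- `ξ ⊗ e ↦ ξ ⊗ e` for `e ∈ Γ(E₂)`. -/
def in₂ : Fn A V W ⊗[A] E₂ →ₗ[A] ThreeTerm A V W E₀ E₁ E₂ :=
  (LinearMap.inr A E₀ (E₁ × E₂) ∘ₗ LinearMap.inr A E₁ E₂).lTensor _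

/-- The elements of degree `k`, where sections of `E_i` have degree `-i`. -/
def deg (k : ℤ) : Submodule A (ThreeTerm A V W E₀ E₁ E₂) :=
  (Submodule.map₂ (TensorProduct.mk A _ _) (LieTwoAlgebroid.deg A V W k) ⊤).map
      (in₀ A V W E₀ E₁ E₂) ⊔
  (Submodule.map₂ (TensorProduct.mk A _ _) (LieTwoAlgebroid.deg A V W (k + 1)) ⊤).map
      (in₁ A V W E₀ E₁ E₂) ⊔
  (Submodule.map₂ (TensorProduct.mk A _ _) (LieTwoAlgebroid.deg A V W (k + 2)) ⊤).map
      (in₂ A V W E₀ E₁ E₂)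

end ThreeTerm

variable {A V W E₀ E₁ E₂} [Algebra ℝ A]

/-- `D` makes `C(𝓜) ⊗ Γ(E₀[0] ⊕ E₁[1] ⊕ E₂[2])` a (left, 3-term) representation up to homotopy of
the split Lie 2-algebroid `(𝓜, 𝒬)`. -/
structure IsRepUpToHomotopy (𝒬 : SplitLieTwoAlgebroid A V W)
    (D : ThreeTerm A V W E₀ E₁ E₂ → ThreeTerm A V W E₀ E₁ E₂) : Prop where
  map_add : ∀ η η', D (η + η') = D η + D η'
  map_smul : ∀ (r : ℝ) η, D (r • η) = r • D η
  degree : ∀ k, ∀ η ∈ ThreeTerm.deg A V W E₀ E₁ E₂ k, D η ∈ ThreeTerm.deg A V W E₀ E₁ E₂ (k + 1)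
  leibniz : ∀ k, ∀ ξ ∈ deg A V W k, ∀ η, D (ξ • η) = 𝒬.vf ξ • η + k.negOnePow • (ξ • D η)
  sq_zero : ∀ η, D (D η) = 0

/-- `μ` is an isomorphism of representations up to homotopy from `D` to `D'`: a degree-preserving
`C(𝓜)`-linear bijection, with degree-preserving inverse, that intertwines the differentials. -/
structure IsRepIso (D D' : ThreeTerm A V W E₀ E₁ E₂ → ThreeTerm A V W E₀ E₁ E₂)
    (μ : ThreeTerm A V W E₀ E₁ E₂ ≃ₗ[Fn A V W] ThreeTerm A V W E₀ E₁ E₂) : Prop where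
  degree : ∀ k η, μ η ∈ ThreeTerm.deg A V W E₀ E₁ E₂ k ↔ η ∈ ThreeTerm.deg A V W E₀ E₁ E₂ k
  comm : ∀ η, μ (D η) = D' (μ η)

end Rep

section Adjoint
variable {A : Type*} [CommRing A] [Algebra ℝ A] {T V W : Type*} [AddCommGroup T] [Module A T]
  [AddCommGroup V] [Module A V] [AddCommGroup W] [Module A W] {act : T →ₗ[A] Derivation ℝ A A}

/-- The map `μ_∇ : C(𝓜) ⊗ Γ(TM[0] ⊕ Q[1] ⊕ B*[2]) → 𝔛(𝓜)`, the `C(𝓜)`-linear extension of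
`X ↦ ∇^{B*}_X ⊕ ∇^Q_X`, `q ↦ q̂`, `β ↦ β̂`. -/
def muNabla (D : Connection act V) (D' : Connection act W) :
    ThreeTerm A V W T V W →ₗ[Fn A V W] (Fn A V W →ₗ[ℝ] Fn A V W) :=
  TensorProduct.AlgebraTensorModule.lift
    { toFun := fun ξ => ξ • (D.horizontal D').coprod (hatV.coprod hatW)
      map_add' := fun ξ ζ => add_smul _ _ _
      map_smul' := fun ξ ζ => by
        refine LinearMap.ext fun e => ?_
        exact mul_smul ξ ζ ((D.horizontal D').coprod (hatV.coprod hatW) e) }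

theorem muNabla_tmul (D : Connection act V) (D' : Connection act W) (ξ : Fn A V W) (X : T) (q : V)
    (β : W) : muNabla D D' (ξ ⊗ₜ (X, q, β)) = ξ • (D.horizontal D' X + (hatV q + hatW β)) := rfl

/-- `μ_∇` is a degree-preserving isomorphism onto the vector fields on `Q[1] ⊕ B*[2]`. -/
structure IsIsoOntoVectorFields (D : Connection act V) (D' : Connection act W) : Prop where
  injective : Function.Injective (muNabla D D')
  range : ∀ 𝒳, (∃ η, muNabla D D' η = 𝒳) ↔ 𝒳 ∈ vectorFields A V W
  degree : ∀ k η, η ∈ ThreeTerm.deg A V W T V W k ↔ IsVectorField k (muNabla D D' η)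

/-- The differential `D_{ad_∇} = μ_∇⁻¹ ∘ [𝒬, ·] ∘ μ_∇` of the adjoint representation. -/
def adDiff (𝒬 : SplitLieTwoAlgebroid A V W) (D : Connection act V) (D' : Connection act W)
    (η : ThreeTerm A V W T V W) : ThreeTerm A V W T V W :=
  Function.invFun (muNabla D D') (𝒬.lie (muNabla D D' η))

/-- `μ` is the `C(𝓜)`-linear map `id ⊕ (∇' - ∇)`: it fixes the sections of `Q` and of `B*`, and
sends `X` to `X + s + t`, where `s ∈ Γ(Q*) ⊗ Γ(Q)` is `q ↦ ∇'_X q - ∇_X q` and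
`t ∈ Γ(B) ⊗ Γ(B*)` is `β ↦ ∇'_X β - ∇_X β`. -/
def IsIdPlusDifference (D₁ D₁' : Connection act V) (D₂ D₂' : Connection act W)
    (μ : ThreeTerm A V W T V W →ₗ[Fn A V W] ThreeTerm A V W T V W) : Prop :=
  (∀ β : W, μ (1 ⊗ₜ (0, 0, β)) = 1 ⊗ₜ (0, 0, β)) ∧
  (∀ q : V, μ (1 ⊗ₜ (0, q, 0)) = 1 ⊗ₜ (0, q, 0)) ∧
  ∀ X : T, ∃ (s : Module.Dual A V ⊗[A] V) (t : Module.Dual A W ⊗[A] W),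
    (∀ q, dualTensorHom A V V s q = D₁'.toFun X q - D₁.toFun X q) ∧
    (∀ β, dualTensorHom A W W t β = D₂'.toFun X β - D₂.toFun X β) ∧
    μ (1 ⊗ₜ (X, 0, 0)) = 1 ⊗ₜ (X, 0, 0) +
      ThreeTerm.in₁ A V W T V W ((ιV A V W).rTensor V s) +
      ThreeTerm.in₂ A V W T V W ((ιW A V W).rTensor W t)

end Adjoint

/-! ### Smooth sections -/

open Bundle Manifold ContDiff

section Smooth
variable {m : ℕ} {M : Type*} [TopologicalSpace M] [ChartedSpace (EuclideanSpace ℝ (Fin m)) M]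
  {F : Type*} [NormedAddCommGroup F] [NormedSpace ℝ F]
  {E : M → Type*} [TopologicalSpace (TotalSpace F E)] [∀ x, AddCommGroup (E x)]
  [∀ x, Module ℝ (E x)] [∀ x, TopologicalSpace (E x)] [FiberBundle F E] [VectorBundle ℝ F E]

/-- The algebra `C^∞(M)`. -/
abbrev Smooth (m : ℕ) (M : Type*) [TopologicalSpace M]
    [ChartedSpace (EuclideanSpace ℝ (Fin m)) M] : Type _ := C^∞⟮𝓡 m, M; 𝓘(ℝ, ℝ), ℝ⟯

/-- Smooth sections form a module over smooth functions. -/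
instance : Module (Smooth m M) (Cₛ^∞⟮𝓡 m; F, E⟯) where
  smul f s := ⟨fun x => f x • s x, f.contMDiff.smul_section s.contMDiff⟩
  one_smul s := by ext x; exact one_smul _ _
  mul_smul f g s := by ext x; exact mul_smul _ _ _
  smul_zero f := by ext x; exact smul_zero _
  smul_add f s t := by ext x; exact smul_add _ _ _
  add_smul f g s := by ext x; exact add_smul _ _ _
  zero_smul s := by ext x; exact zero_smul _ _

theorem smul_section_apply (f : Smooth m M) (s : Cₛ^∞⟮𝓡 m; F, E⟯) (x : M) :
    (f • s) x = f x • s x := rfl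

theorem mdiff (f : Smooth m M) (x : M) : MDifferentiableAt (𝓡 m) 𝓘(ℝ, ℝ) f x :=
  f.contMDiff.mdifferentiable (by simp) x

variable [IsManifold (𝓡 m) ∞ M]

/-- Smooth vector fields on `M`. -/
abbrev VF (m : ℕ) (M : Type*) [TopologicalSpace M]
    [ChartedSpace (EuclideanSpace ℝ (Fin m)) M] [IsManifold (𝓡 m) ∞ M] : Type _ :=
  Cₛ^∞⟮𝓡 m; EuclideanSpace ℝ (Fin m), (TangentSpace (𝓡 m) : M → Type _)⟯

theorem contMDiff_act (X : VF m M) (f : Smooth m M) :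
    ContMDiff (𝓡 m) 𝓘(ℝ, ℝ) ∞ fun x => mvfderiv (𝓡 m) f x (X x) := by
  have h := (f.contMDiff.contMDiff_tangentMap (m := ∞) le_rfl).comp X.contMDiff
  exact (contMDiff_snd_tangentBundle_modelSpace ℝ 𝓘(ℝ, ℝ)).comp h

/-- The action `X(f)` of a vector field `X` on a function `f`. -/
def act : VF m M →ₗ[Smooth m M] Derivation ℝ (Smooth m M) (Smooth m M) where
  toFun X := Derivation.mk'
    { toFun := fun f => ⟨fun x => mvfderiv (𝓡 m) f x (X x), contMDiff_act X f⟩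
      map_add' := fun f g => by
        ext x
        change mvfderiv (𝓡 m) (⇑f + ⇑g) x (X x) = _
        rw [mvfderiv_add (mdiff f x) (mdiff g x)]; rfl
      map_smul' := fun r f => by
        ext x
        change mvfderiv (𝓡 m) ((fun _ : M => r) * ⇑f) x (X x) = _
        rw [mvfderiv_mul mdifferentiableAt_const (mdiff f x)]
        simp only [mvfderiv_const, smul_zero, add_zero]
        simp
        rfl }
    (fun f g => by
      ext x
      change mvfderiv (𝓡 m) (⇑f * ⇑g) x (X x) = _
      rw [mvfderiv_mul (mdiff f x) (mdiff g x)]; rfl)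
  map_add' X Y := by ext f x; exact map_add (mvfderiv (𝓡 m) f x) (X x) (Y x)
  map_smul' g X := by ext f x; exact map_smul (mvfderiv (𝓡 m) f x) (g x) (X x)

variable [∀ x, IsTopologicalAddGroup (E x)]
  [∀ x, ContinuousSMul ℝ (E x)]

theorem contMDiff_cov (cov : CovariantDerivative (𝓡 m) F E)
    [h : cov.ContMDiffCovariantDerivative ∞] (X : VF m M) (s : Cₛ^∞⟮𝓡 m; F, E⟯) :
    ContMDiff (𝓡 m) ((𝓡 m).prod 𝓘(ℝ, F)) ∞ fun x => TotalSpace.mk' F x (cov s x (X x)) := by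
  have := h.contMDiff.contMDiff (σ := s) s.contMDiff.contMDiffOn
  exact ContMDiff.clm_bundle_apply (contMDiffOn_univ.1 this) X.contMDiff

/-- A smooth covariant derivative as a map `𝔛(M) × Γ(E) → Γ(E)`. -/
def ofCov (cov : CovariantDerivative (𝓡 m) F E) [cov.ContMDiffCovariantDerivative ∞] :
    Connection (act (m := m) (M := M)) (Cₛ^∞⟮𝓡 m; F, E⟯) where
  toFun :=
    { toFun := fun X =>
        { toFun := fun s => ⟨fun x => cov s x (X x), contMDiff_cov cov X s⟩
          map_zero' := by
            ext x
            change cov 0 x (X x) = 0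
            rw [cov.zero]; rfl
          map_add' := fun s t => by
            ext x
            change cov (⇑s + ⇑t) x (X x) = _
            rw [cov.isCovariantDerivativeOn.add (s.contMDiff.mdifferentiable (by simp) x)
              (t.contMDiff.mdifferentiable (by simp) x)]
            rfl }
      map_add' := fun X Y => by ext s x; exact map_add (cov s x) (X x) (Y x)
      map_smul' := fun f X => by ext s x; exact map_smul (cov s x) (f x) (X x) }
  leibniz X f s := by
    ext x
    change cov (⇑f • ⇑s) x (X x) = _
    rw [cov.isCovariantDerivativeOn.leibniz (s.contMDiff.mdifferentiable (by simp) x)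
      (mdiff f x)]
    rfl

end Smooth
end
end LieTwoAlgebroid

open scoped TensorProduct Manifold ContDiff Bundle
open Bundle LieTwoAlgebroid

/-! The geometry enters through two facts: derivations of `C^∞(M)` are the same as vector fields on
`M` (`act_bijective`), and a module of smooth sections has a finite dual basis, i.e. is finite
projective over `C^∞(M)` (`exists_dualBasis_sections`). Everything else is algebra over `A =
C^∞(M)`.

A graded derivation is determined by its values on the generators `f`, `τ`, `b`, and on these
`muNabla` is triangular: functions of degree 0 see only the `TM`-component, and once it is removed
`Γ(Q*)` sees only the `Q`-component and `Γ(B)` only the `B*`-component. Injectivity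
(`muNabla_injective`) follows because `C(𝓜)` is projective, so that contractions separate the points
of the tensor products. For surjectivity in degree `k` (`exists_muNabla_eq`), the restriction of a
vector field to `A` is a derivation into the finite projective module `deg k`, hence a combination
of vector fields on `M` with coefficients of degree `k`. Subtracting the corresponding horizontal
part leaves an `A`-linear derivation, whose values on dual bases of generators are the remaining
coefficients.

Since `muNabla` is a graded bijection onto the vector fields, which `[𝒬, ·]` preserves, each axiom
for the adjoint representation is the corresponding property of the commutator. The isomorphism
between two adjoint representations is `μ_{∇'}⁻¹ ∘ μ_∇`, which intertwines the differentials by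
construction. Its formula comes from comparing dual connections on generators
(`Connection.dual_eq_add`).

Derivations are vector fields by Hadamard's lemma. Since `M` need not be compact, the dual basis
takes more work: a Hausdorff dimension count bounds the number of spanning sections over a compact
set independently of that set, three colours of compact shells glue these to finitely many global
sections, and inverting their Gramian gives smooth coordinates. -/

namespace LieTwoAlgebroid

open scoped TensorProduct
noncomputable section

/-! ### The grading of the functions -/

/-- An algebra endomorphism that multiplies generators by `c` multiplies `p`-fold products of
generators by `c ^ p`. -/
theorem map_eq_pow_smul {A R P : Type*} [CommRing A] [Ring R] [Algebra A R] [AddCommGroup P]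
    [Module A P] (ι : P →ₗ[A] R) (f : R →ₐ[A] R) (c : A) (h : ∀ x, f (ι x) = c • ι x) (p : ℕ)
    {u : R} (hu : u ∈ LinearMap.range ι ^ p) : f u = c ^ p • u := by
  induction hu using Submodule.pow_induction_on_left' with
  | algebraMap r => simp
  | add x y i _ _ hx hy => rw [map_add, hx, hy, smul_add]
  | mem_mul m hm i x _ hx =>
    obtain ⟨y, rfl⟩ := hm
    rw [map_mul, hx, h, smul_mul_smul_comm, ← pow_succ']

section Grading
variable {A : Type*} [CommRing A] {V W : Type*} [AddCommGroup V] [Module A V] [AddCommGroup W]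
  [Module A W]

theorem ιV_apply (φ : Module.Dual A V) : ιV A V W φ = ExteriorAlgebra.ι A φ ⊗ₜ 1 := rfl

theorem ιW_apply (b : Module.Dual A W) : ιW A V W b = 1 ⊗ₜ SymmetricAlgebra.ι A _ b := rfl

theorem Fn.algebraMap_apply (f : A) :
    algebraMap A (Fn A V W) f = algebraMap A _ f ⊗ₜ 1 := rfl

/-- Functions are generated by those of degree 0, 1 and 2. -/
theorem Fn.induction {motive : Fn A V W → Prop}
    (algebraMap : ∀ f, motive (algebraMap A _ f))
    (ιV : ∀ φ, motive (ιV A V W φ)) (ιW : ∀ b, motive (ιW A V W b))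
    (mul : ∀ ξ ζ, motive ξ → motive ζ → motive (ξ * ζ))
    (add : ∀ ξ ζ, motive ξ → motive ζ → motive (ξ + ζ)) (ξ : Fn A V W) : motive ξ := by
  have hE (u : ExteriorAlgebra A (Module.Dual A V)) : motive (u ⊗ₜ 1) := by
    induction u using ExteriorAlgebra.induction with
    | algebraMap r => exact algebraMap r
    | ι x => exact ιV x
    | mul a b ha hb => simpa using mul _ _ ha hb
    | add a b ha hb => simpa [TensorProduct.add_tmul] using add _ _ ha hb
  have hS (s : SymmetricAlgebra A (Module.Dual A W)) : motive (1 ⊗ₜ s) := by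
    induction s using SymmetricAlgebra.induction with
    | algebraMap r =>
      rw [← Algebra.TensorProduct.algebraMap_apply']
      exact algebraMap r
    | ι x => exact ιW x
    | mul a b ha hb => simpa using mul _ _ ha hb
    | add a b ha hb => simpa [TensorProduct.tmul_add] using add _ _ ha hb
  induction ξ using TensorProduct.induction_on with
  | zero => simpa using algebraMap 0
  | tmul u s => simpa using mul _ _ (hE u) (hS s)
  | add x y hx hy => exact add _ _ hx hy

theorem tmul_mem_deg {p r : ℕ} {k : ℤ} {u : ExteriorAlgebra A (Module.Dual A V)}
    {s : SymmetricAlgebra A (Module.Dual A W)} (hu : u ∈ ⋀[A]^p (Module.Dual A V))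
    (hs : s ∈ LinearMap.range (SymmetricAlgebra.ι A (Module.Dual A W)) ^ r)
    (h : (p : ℤ) + 2 * r = k) : u ⊗ₜ s ∈ deg A V W k :=
  Submodule.mem_iSup_of_mem p <| Submodule.mem_iSup_of_mem r <| Submodule.mem_iSup_of_mem h <|
    Submodule.apply_mem_map₂ _ hu hs

theorem zero_power : ⋀[A]^0 (Module.Dual A V) = 1 := pow_zero _

theorem one_power :
    ⋀[A]^1 (Module.Dual A V) = LinearMap.range (ExteriorAlgebra.ι A) := pow_one _

-- No closure of the motive under scalars is demanded, because a scalar can be absorbed into the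
-- exterior factor of a pure tensor.
@[elab_as_elim]
theorem deg_induction {k : ℤ} {motive : (ξ : Fn A V W) → ξ ∈ deg A V W k → Prop}
    (tmul : ∀ (p r : ℕ) (u : ExteriorAlgebra A (Module.Dual A V))
      (s : SymmetricAlgebra A (Module.Dual A W)) (hu : u ∈ ⋀[A]^p (Module.Dual A V))
      (hs : s ∈ LinearMap.range (SymmetricAlgebra.ι A (Module.Dual A W)) ^ r)
      (h : (p : ℤ) + 2 * r = k), motive (u ⊗ₜ s) (tmul_mem_deg hu hs h))
    (zero : motive 0 (zero_mem _))
    (add : ∀ ξ ζ hξ hζ, motive ξ hξ → motive ζ hζ → motive (ξ + ζ) (add_mem hξ hζ))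
    {ξ : Fn A V W} (hξ : ξ ∈ deg A V W k) : motive ξ hξ := by
  let m (ξ : Fn A V W) : Prop := ∃ h, motive ξ h
  have hadd (ξ ζ) : m ξ → m ζ → m (ξ + ζ) := fun ⟨h, h'⟩ ⟨k, k'⟩ => ⟨_, add _ _ h k h' k'⟩
  suffices m ξ from this.2
  refine Submodule.iSup_induction _ (motive := m) hξ (fun p ξ hξ => ?_) ⟨_, zero⟩ hadd
  refine Submodule.iSup_induction _ (motive := m) hξ (fun r ξ hξ => ?_) ⟨_, zero⟩ hadd
  refine Submodule.iSup_induction _ (motive := m) hξ (fun h ξ hξ => ?_) ⟨_, zero⟩ hadd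
  rw [Submodule.map₂_eq_span_image2] at hξ
  refine Submodule.closure_induction (p := fun x _ => m x) ⟨_, zero⟩
    (fun x y _ _ => hadd x y) ?_ hξ
  rintro a _ ⟨u, hu, s, hs, rfl⟩
  exact ⟨_, tmul p r (a • u) s (Submodule.smul_mem _ _ hu) hs h⟩

theorem algebraMap_mem_deg (f : A) : algebraMap A _ f ∈ deg A V W 0 :=
  tmul_mem_deg (p := 0) (r := 0)
    (by rw [zero_power]; exact Submodule.algebraMap_mem f) (by rw [pow_zero]; exact Submodule.one_le.1 le_rfl) (by simp)

theorem ιV_mem_deg (φ : Module.Dual A V) : ιV A V W φ ∈ deg A V W 1 :=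
  tmul_mem_deg (p := 1) (r := 0)
    (by rw [one_power]; exact LinearMap.mem_range_self _ _) (by rw [pow_zero]; exact Submodule.one_le.1 le_rfl)
    (by simp)

theorem ιW_mem_deg (b : Module.Dual A W) : ιW A V W b ∈ deg A V W 2 :=
  tmul_mem_deg (p := 0) (r := 1)
    (by rw [zero_power]; exact Submodule.one_le.1 le_rfl) (by rw [pow_one]; exact LinearMap.mem_range_self _ _)
    (by simp)

theorem mul_mem_deg {k l : ℤ} {ξ ζ : Fn A V W} (hξ : ξ ∈ deg A V W k) (hζ : ζ ∈ deg A V W l) :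
    ξ * ζ ∈ deg A V W (k + l) := by
  induction hξ using deg_induction with
  | zero => simp
  | add x y _ _ hx hy => rw [add_mul]; exact add_mem hx hy
  | tmul p r u s hu hs h =>
    induction hζ using deg_induction with
    | zero => simp
    | add x y _ _ hx hy => rw [mul_add]; exact add_mem hx hy
    | tmul p' r' u' s' hu' hs' h' =>
      rw [Algebra.TensorProduct.tmul_mul_tmul]
      refine tmul_mem_deg (p := p + p') (r := r + r') ?_ ?_ (by push_cast; omega)
      · exact (pow_add (LinearMap.range (ExteriorAlgebra.ι A (M := Module.Dual A V))) p p').ge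
          (Submodule.mul_mem_mul hu hu')
      · rw [pow_add]; exact Submodule.mul_mem_mul hs hs'

theorem iSup_deg : ⨆ k, deg A V W k = ⊤ := by
  have hle {k} {ξ : Fn A V W} (h : ξ ∈ deg A V W k) : ξ ∈ ⨆ k, deg A V W k :=
    Submodule.mem_iSup_of_mem k h
  refine Submodule.eq_top_iff'.2 fun ξ => ?_
  induction ξ using Fn.induction with
  | algebraMap f => exact hle (algebraMap_mem_deg f)
  | ιV φ => exact hle (ιV_mem_deg φ)
  | ιW b => exact hle (ιW_mem_deg b)
  | add x y hx hy => exact add_mem hx hy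
  | mul x y hx hy =>
    induction hx using Submodule.iSup_induction' with
    | zero => simp
    | add x x' _ _ hx hx' => rw [add_mul]; exact add_mem hx hx'
    | mem i x hx =>
      induction hy using Submodule.iSup_induction' with
      | zero => simp
      | add y y' _ _ hy hy' => rw [mul_add]; exact add_mem hy hy'
      | mem j y hy => exact hle (mul_mem_deg hx hy)

/-- Induction on homogeneous components. -/
theorem Fn.homogeneous_induction {motive : Fn A V W → Prop}
    (mem : ∀ k, ∀ ξ ∈ deg A V W k, motive ξ)
    (add : ∀ ξ ζ, motive ξ → motive ζ → motive (ξ + ζ)) (ξ : Fn A V W) : motive ξ := by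
  have hξ : ξ ∈ ⨆ k, deg A V W k := by rw [iSup_deg]; trivial
  exact Submodule.iSup_induction (deg A V W) (motive := motive) hξ mem
    (mem 0 0 (zero_mem _)) add

/-- The condition `p + 2 r = k` bounds `p` and `r` by `k`, so only finitely many finitely generated
pieces occur; for negative `k` there are none. -/
theorem fg_deg [Module.Finite A (Module.Dual A V)] [Module.Finite A (Module.Dual A W)] (k : ℤ) :
    (deg A V W k).FG := by
  have hle : deg A V W k = ⨆ (p : Fin (k.toNat + 1)) (r : Fin (k.toNat + 1))
      (_ : (p : ℤ) + 2 * r = k), Submodule.map₂ (TensorProduct.mk A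
        (ExteriorAlgebra A (Module.Dual A V)) (SymmetricAlgebra A (Module.Dual A W)))
        (⋀[A]^(p : ℕ) (Module.Dual A V))
        (LinearMap.range (SymmetricAlgebra.ι A (Module.Dual A W)) ^ (r : ℕ)) := by
    refine le_antisymm (iSup_le fun p => iSup_le fun r => iSup_le fun h => ?_)
      (iSup_le fun p => iSup_le fun r => iSup_le fun h => ?_)
    · exact le_iSup_of_le (⟨p, by omega⟩ : Fin (k.toNat + 1)) (le_iSup_of_le ⟨r, by omega⟩
        (le_iSup_of_le (by simpa using h) le_rfl))
    · exact le_iSup_of_le (p : ℕ) (le_iSup_of_le (r : ℕ) (le_iSup_of_le h le_rfl))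
  rw [hle]
  have h1 : (LinearMap.range (ExteriorAlgebra.ι A (M := Module.Dual A V))).FG :=
    LinearMap.range_eq_map (ExteriorAlgebra.ι A (M := Module.Dual A V)) ▸
      Module.Finite.fg_top.map (ExteriorAlgebra.ι A (M := Module.Dual A V))
  have h2 : (LinearMap.range (SymmetricAlgebra.ι A (Module.Dual A W))).FG :=
    LinearMap.range_eq_map (SymmetricAlgebra.ι A (Module.Dual A W)) ▸
      Module.Finite.fg_top.map (SymmetricAlgebra.ι A (Module.Dual A W))
  exact Submodule.fg_iSup _ fun p => Submodule.fg_iSup _ fun r => Submodule.fg_iSup _ fun h =>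
    (h1.pow _).map₂ _ (h2.pow _)

/-! ### Signs -/

variable [Algebra ℝ A]

/-- The sign operator as an algebra endomorphism. -/
def parityHom : Fn A V W →ₐ[A] Fn A V W :=
  Algebra.TensorProduct.map (CliffordAlgebra.involute (Q := (0 : QuadraticForm A _)))
    (AlgHom.id A _)

theorem parity_apply (ξ : Fn A V W) : parity ξ = parityHom ξ := rfl

@[simp] theorem parity_algebraMap (f : A) :
    parity (algebraMap A (Fn A V W) f) = algebraMap A _ f := parityHom.commutes f

@[simp] theorem parity_ιV (φ : Module.Dual A V) : parity (ιV A V W φ) = -ιV A V W φ := by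
  rw [parity_apply, ιV_apply, parityHom, Algebra.TensorProduct.map_tmul, ← TensorProduct.neg_tmul]
  congr 1
  exact CliffordAlgebra.involute_ι (Q := (0 : QuadraticForm A _)) φ

@[simp] theorem parity_ιW (b : Module.Dual A W) : parity (ιW A V W b) = ιW A V W b := by
  rw [parity_apply, ιW_apply, parityHom, Algebra.TensorProduct.map_tmul, map_one]; rfl

@[simp] theorem parity_mul (ξ ζ : Fn A V W) : parity (ξ * ζ) = parity ξ * parity ζ :=
  map_mul parityHom ξ ζ

@[simp] theorem parity_parity (ξ : Fn A V W) : parity (parity ξ) = ξ := by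
  induction ξ using Fn.induction with
  | mul x y hx hy => simp [hx, hy]
  | add x y hx hy => simp [hx, hy]
  | algebraMap f => rw [parity_algebraMap, parity_algebraMap]
  | _ => simp

/-- Only the exterior factor carries a sign: symmetric generators have degree 2, so `(-1)^p` agrees
with `(-1)^(p + 2 r)`. -/
theorem parity_of_mem_deg {k : ℤ} {ξ : Fn A V W} (hξ : ξ ∈ deg A V W k) :
    parity ξ = k.negOnePow • ξ := by
  induction hξ using deg_induction with
  | zero => simp
  | add x y _ _ hx hy => simp [hx, hy]
  | tmul p r u s hu hs h =>
    have := map_eq_pow_smul (ExteriorAlgebra.ι A)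
      (CliffordAlgebra.involute (Q := (0 : QuadraticForm A (Module.Dual A V)))) (-1)
      (fun x => by
        rw [neg_one_smul]
        exact CliffordAlgebra.involute_ι (Q := (0 : QuadraticForm A _)) x) p hu
    rw [parity_apply, parityHom, Algebra.TensorProduct.map_tmul]
    erw [this]
    rw [← TensorProduct.smul_tmul', ← h, Int.negOnePow_add, Int.negOnePow_two_mul, mul_one]
    rcases Nat.even_or_odd p with hp | hp
    · rw [hp.neg_one_pow, Int.negOnePow_even _ (by exact_mod_cast hp)]; simp
    · rw [hp.neg_one_pow, Int.negOnePow_odd _ (by exact_mod_cast hp)]; simp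

/-- The operator `ξ ↦ (-1)^{j|ξ|} ξ`. -/
def sgn (j : ℤ) (ξ : Fn A V W) : Fn A V W := if Even j then ξ else parity ξ

theorem sgn_even {j : ℤ} (h : Even j) (ξ : Fn A V W) : sgn j ξ = ξ := if_pos h

theorem sgn_odd {j : ℤ} (h : ¬ Even j) (ξ : Fn A V W) : sgn j ξ = parity ξ := if_neg h

theorem sgn_of_mem_deg (j : ℤ) {k : ℤ} {ξ : Fn A V W} (hξ : ξ ∈ deg A V W k) :
    sgn j ξ = (j * k).negOnePow • ξ := by
  by_cases h : Even j
  · rw [sgn_even h, Int.negOnePow_even _ (h.mul_right k), one_smul]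
  · rw [sgn_odd h, parity_of_mem_deg hξ]
    congr 1
    rw [Int.not_even_iff_odd] at h
    rcases Int.even_or_odd k with hk | hk
    · rw [Int.negOnePow_even _ hk, Int.negOnePow_even _ (hk.mul_left j)]
    · rw [Int.negOnePow_odd _ hk, Int.negOnePow_odd _ (h.mul hk)]

theorem sgn_add (j : ℤ) (ξ ζ : Fn A V W) : sgn j (ξ + ζ) = sgn j ξ + sgn j ζ := by
  unfold sgn; split_ifs <;> simp

theorem sgn_mul (j : ℤ) (ξ ζ : Fn A V W) : sgn j (ξ * ζ) = sgn j ξ * sgn j ζ := by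
  unfold sgn; split_ifs <;> simp

theorem sgn_algebraMap (j : ℤ) (f : A) :
    sgn j (algebraMap A (Fn A V W) f) = algebraMap A _ f := by
  unfold sgn; split_ifs
  · rfl
  · exact parity_algebraMap f

theorem sgn_ιW (j : ℤ) (b : Module.Dual A W) : sgn j (ιW A V W b) = ιW A V W b := by
  unfold sgn; split_ifs <;> simp

theorem sgn_sgn (i j : ℤ) (ξ : Fn A V W) : sgn i (sgn j ξ) = sgn (i + j) ξ := by
  unfold sgn
  by_cases hi : Even i <;> by_cases hj : Even j <;> simp [hi, hj, Int.even_add]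

/-- Functions are graded commutative. -/
theorem mul_comm_sgn {k : ℤ} {ξ : Fn A V W} (hξ : ξ ∈ deg A V W k) (ζ : Fn A V W) :
    ξ * ζ = sgn k ζ * ξ := by
  -- As `sgn k` is additive and multiplicative, the identity passes to sums and products in `ζ`,
  -- which leaves the generators.
  induction ζ using Fn.induction with
  | algebraMap f => rw [sgn_algebraMap, Algebra.commutes]
  | mul x y hx hy => rw [← mul_assoc, hx, mul_assoc, hy, sgn_mul, mul_assoc]
  | add x y hx hy => rw [mul_add, hx, hy, sgn_add, add_mul]
  | ιW b =>
    rw [sgn_ιW]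
    induction hξ using deg_induction with
    | zero => simp
    | add x y _ _ hx hy => rw [add_mul, hx, hy, mul_add]
    | tmul p r u s hu hs h => rw [ιW_apply]; simp [mul_comm]
  | ιV φ =>
    rw [sgn_of_mem_deg k (ιV_mem_deg φ), mul_one]
    induction hξ using deg_induction with
    | zero => simp
    | add x y _ _ hx hy => rw [add_mul, hx, hy, mul_add]
    | tmul p r u s hu hs h =>
      -- Moving `φ` past `p` anticommuting generators costs `(-1)^p`.
      have key : u * ExteriorAlgebra.ι A φ =
          (p : ℤ).negOnePow • (ExteriorAlgebra.ι A φ * u) := by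
        clear h
        induction hu using Submodule.pow_induction_on_left' with
        | algebraMap r => simp [Algebra.commutes]
        | add x y i _ _ hx hy => rw [add_mul, hx, hy, mul_add, smul_add]
        | mem_mul m hm i x _ hx =>
          obtain ⟨y, rfl⟩ := hm
          rw [mul_assoc, hx, mul_smul_comm, ← mul_assoc,
            eq_neg_of_add_eq_zero_left (ExteriorAlgebra.ι_add_mul_swap y φ), neg_mul, smul_neg,
            mul_assoc, Nat.cast_succ, Int.negOnePow_succ, Units.neg_smul]
      rw [ιV_apply, Algebra.TensorProduct.tmul_mul_tmul, key, ← h, Int.negOnePow_add,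
        Int.negOnePow_two_mul, mul_one, Units.smul_def, Units.smul_def, smul_mul_assoc,
        Algebra.TensorProduct.tmul_mul_tmul, mul_one, one_mul]
      rfl

/-! ### Independence of the homogeneous components -/

/-- The algebra endomorphism that multiplies functions of degree `k` by `2 ^ k`. -/
def dilation : Fn A V W →ₐ[A] Fn A V W :=
  Algebra.TensorProduct.map (ExteriorAlgebra.map ((2 : A) • LinearMap.id))
    (SymmetricAlgebra.lift ((4 : A) • SymmetricAlgebra.ι A _))

theorem dilation_of_mem_deg {k : ℤ} {ξ : Fn A V W} (hξ : ξ ∈ deg A V W k) :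
    dilation ξ = (2 : ℝ) ^ k • ξ := by
  induction hξ using deg_induction with
  | zero => simp
  | add x y _ _ hx hy => simp [hx, hy]
  | tmul p r u s hu hs h =>
    have h1 := map_eq_pow_smul (ExteriorAlgebra.ι A)
      (ExteriorAlgebra.map ((2 : A) • LinearMap.id (M := Module.Dual A V))) 2 (by simp) p hu
    have h2 := map_eq_pow_smul (SymmetricAlgebra.ι A _)
      (SymmetricAlgebra.lift ((4 : A) • SymmetricAlgebra.ι A (Module.Dual A W))) 4 (by simp) r hs
    rw [dilation, Algebra.TensorProduct.map_tmul, h1, h2, TensorProduct.smul_tmul_smul, ← h,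
      zpow_add₀ two_ne_zero, zpow_mul, ← algebraMap_smul A (_ : ℝ) (u ⊗ₜ[A] s)]
    congr 1
    simp only [map_mul, zpow_natCast, map_pow, map_ofNat]
    rw [show (2 : ℝ) ^ (2 : ℤ) = 4 by norm_num, map_ofNat]

/-- The numbers `2 ^ k` are distinct, so the corresponding real eigenspaces of `dilation` are
independent. The pieces `deg k` lie in them and together span everything, so each is the whole
eigenspace. Homogeneity thereby becomes an equation. -/
theorem mem_deg_iff {k : ℤ} {ξ : Fn A V W} :
    ξ ∈ deg A V W k ↔ dilation ξ = (2 : ℝ) ^ k • ξ := by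
  refine ⟨dilation_of_mem_deg, fun h => ?_⟩
  let ψ : Module.End ℝ (Fn A V W) := (dilation (V := V) (W := W)).toLinearMap.restrictScalars ℝ
  have hinj : Function.Injective fun k : ℤ => (2 : ℝ) ^ k :=
    zpow_right_injective₀ two_pos (by norm_num)
  have hind := ψ.eigenspaces_iSupIndep.comp hinj
  have hle (k : ℤ) : (deg A V W k).restrictScalars ℝ ≤ ψ.eigenspace ((2 : ℝ) ^ k) :=
    fun ξ hξ => Module.End.mem_eigenspace_iff.2 (dilation_of_mem_deg hξ)
  obtain ⟨x, hx, y, hy, hxy⟩ : ∃ x ∈ deg A V W k,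
      ∃ y ∈ ⨆ i ≠ k, ψ.eigenspace ((2 : ℝ) ^ i), x + y = ξ := by
    clear h
    induction ξ using Fn.homogeneous_induction with
    | mem i ξ hξ =>
      by_cases hi : i = k
      · subst hi; exact ⟨ξ, hξ, 0, zero_mem _, add_zero _⟩
      · exact ⟨0, zero_mem _, ξ,
          Submodule.mem_iSup_of_mem i (Submodule.mem_iSup_of_mem hi (hle i hξ)), zero_add _⟩
    | add ξ ζ h1 h2 =>
      obtain ⟨x, hx, y, hy, rfl⟩ := h1
      obtain ⟨x', hx', y', hy', rfl⟩ := h2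
      exact ⟨x + x', add_mem hx hx', y + y', add_mem hy hy', by abel⟩
  -- The part `y` of `ξ` in the other eigenspaces is a difference of two eigenvectors for `2 ^ k`,
  -- so independence makes it zero.
  have hyk : y ∈ ψ.eigenspace ((2 : ℝ) ^ k) := by
    rw [← sub_eq_of_eq_add' hxy.symm]
    exact sub_mem (Module.End.mem_eigenspace_iff.2 h) (hle k hx)
  rw [← hxy, Submodule.disjoint_def.1 (hind k) y hyk hy, add_zero]
  exact hx

end Grading

/-! ### Vector fields -/

section VectorField
variable {A : Type*} [CommRing A] {V W : Type*} [AddCommGroup V] [Module A V] [AddCommGroup W]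
  [Module A W]

theorem Fn.neg_mul' (ξ ζ : Fn A V W) : -ξ * ζ = -(ξ * ζ) :=
  (LinearMap.mulRight A ζ).map_neg ξ

theorem Fn.mul_neg' (ξ ζ : Fn A V W) : ξ * -ζ = -(ξ * ζ) :=
  (LinearMap.mulLeft A ξ).map_neg ζ

variable [Algebra ℝ A] {j : ℤ} {𝒳 𝒴 : Fn A V W →ₗ[ℝ] Fn A V W}

theorem sgn_smul_real (j : ℤ) (r : ℝ) (ξ : Fn A V W) : sgn j (r • ξ) = r • sgn j ξ := by
  unfold sgn; split_ifs
  · rfl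
  · exact map_smul parity r ξ

theorem dilation_sgn (j : ℤ) (ξ : Fn A V W) : dilation (sgn j ξ) = sgn j (dilation ξ) := by
  induction ξ using Fn.homogeneous_induction with
  | mem k ξ h =>
    rw [dilation_of_mem_deg h, sgn_smul_real, sgn_of_mem_deg j h, Units.smul_def, map_zsmul,
      dilation_of_mem_deg h, smul_comm]
  | add x y hx hy => rw [sgn_add, map_add, map_add, sgn_add, hx, hy]

/-- With the sign written as an operator both sides are additive in `ξ`, which frees the Leibniz
rule from homogeneity. -/
theorem IsVectorField.mul (h : IsVectorField j 𝒳) (ξ ζ : Fn A V W) :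
    𝒳 (ξ * ζ) = 𝒳 ξ * ζ + sgn j ξ * 𝒳 ζ := by
  induction ξ using Fn.homogeneous_induction with
  | mem k ξ hξ => rw [h.leibniz k ξ hξ, sgn_of_mem_deg j hξ, Units.smul_def, Units.smul_def,
      smul_mul_assoc]
  | add x y hx hy => simp only [add_mul, map_add, hx, hy, sgn_add]; abel

theorem IsVectorField.of_degree_mul (hd : ∀ k, ∀ ξ ∈ deg A V W k, 𝒳 ξ ∈ deg A V W (j + k))
    (hm : ∀ ξ ζ, 𝒳 (ξ * ζ) = 𝒳 ξ * ζ + sgn j ξ * 𝒳 ζ) : IsVectorField j 𝒳 where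
  degree := hd
  leibniz k ξ hξ ζ := by
    rw [hm, sgn_of_mem_deg j hξ, Units.smul_def, Units.smul_def, smul_mul_assoc]

/-- The degree of a derivation can be checked on generators. -/
theorem IsVectorField.of_generators (hA : ∀ f, 𝒳 (algebraMap A _ f) ∈ deg A V W j)
    (hV : ∀ φ, 𝒳 (ιV A V W φ) ∈ deg A V W (j + 1)) (hW : ∀ b, 𝒳 (ιW A V W b) ∈ deg A V W (j + 2))
    (hm : ∀ ξ ζ, 𝒳 (ξ * ζ) = 𝒳 ξ * ζ + sgn j ξ * 𝒳 ζ) : IsVectorField j 𝒳 := by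
  have gen {k : ℤ} {ξ : Fn A V W} (h : ξ ∈ deg A V W k) (h' : 𝒳 ξ ∈ deg A V W (j + k)) :
      dilation (𝒳 ξ) = (2 : ℝ) ^ j • 𝒳 (dilation ξ) := by
    rw [dilation_of_mem_deg h, dilation_of_mem_deg h', map_smul, smul_smul,
      zpow_add₀ two_ne_zero]
  -- Having degree `j` means commuting with `dilation` up to the factor `2 ^ j`, and the Leibniz
  -- rule carries this identity from factors to products.
  have key (ξ) : dilation (𝒳 ξ) = (2 : ℝ) ^ j • 𝒳 (dilation ξ) := by
    induction ξ using Fn.induction with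
    | algebraMap f => exact gen (algebraMap_mem_deg f) (by rw [add_zero]; exact hA f)
    | ιV φ => exact gen (ιV_mem_deg φ) (hV φ)
    | ιW b => exact gen (ιW_mem_deg b) (hW b)
    | add x y hx hy => simp only [map_add, hx, hy, smul_add]
    | mul x y hx hy =>
      rw [hm, map_add, map_mul, map_mul, map_mul, hm, hx, hy, dilation_sgn, smul_add,
        smul_mul_assoc, mul_smul_comm]
  refine .of_degree_mul (fun k ξ hξ => ?_) hm
  rw [mem_deg_iff, key, dilation_of_mem_deg hξ, map_smul, smul_smul, zpow_add₀ two_ne_zero]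

/-- A vector field that vanishes on generators vanishes. -/
theorem IsVectorField.eq_zero (h : IsVectorField j 𝒳) (hA : ∀ f, 𝒳 (algebraMap A _ f) = 0)
    (hV : ∀ φ, 𝒳 (ιV A V W φ) = 0) (hW : ∀ b, 𝒳 (ιW A V W b) = 0) : 𝒳 = 0 := by
  ext ξ
  rw [LinearMap.zero_apply]
  induction ξ using Fn.induction with
  | algebraMap f => exact hA f
  | ιV φ => exact hV φ
  | ιW b => exact hW b
  | add x y hx hy => rw [map_add, hx, hy, add_zero]
  | mul x y hx hy => rw [h.mul, hx, hy, zero_mul, mul_zero, add_zero]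

theorem IsVectorField.zero : IsVectorField j (0 : Fn A V W →ₗ[ℝ] Fn A V W) :=
  .of_degree_mul (by simp) (by simp)

theorem IsVectorField.add (h : IsVectorField j 𝒳) (h' : IsVectorField j 𝒴) :
    IsVectorField j (𝒳 + 𝒴) :=
  .of_degree_mul (fun k ξ hξ => add_mem (h.degree k ξ hξ) (h'.degree k ξ hξ)) fun ξ ζ => by
    simp only [LinearMap.add_apply, h.mul, h'.mul, add_mul, mul_add]; abel

theorem IsVectorField.neg (h : IsVectorField j 𝒳) : IsVectorField j (-𝒳) :=
  .of_degree_mul (fun k ξ hξ => neg_mem (h.degree k ξ hξ)) fun ξ ζ => by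
    simp only [LinearMap.neg_apply, h.mul, Fn.neg_mul', Fn.mul_neg']; abel

theorem IsVectorField.sub (h : IsVectorField j 𝒳) (h' : IsVectorField j 𝒴) :
    IsVectorField j (𝒳 - 𝒴) := sub_eq_add_neg 𝒳 𝒴 ▸ h.add h'.neg

theorem Fn.smul_apply (ξ : Fn A V W) (𝒳 : Fn A V W →ₗ[ℝ] Fn A V W) (ζ : Fn A V W) :
    (ξ • 𝒳) ζ = ξ * 𝒳 ζ := rfl

/-- In the second Leibniz term `ξ` has to move past `sgn j ζ`; graded commutativity contributes `sgn
k`, and the two signs combine to `sgn (k + j)`. -/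
theorem IsVectorField.smul {k : ℤ} {ξ : Fn A V W} (hξ : ξ ∈ deg A V W k)
    (h : IsVectorField j 𝒳) : IsVectorField (k + j) (ξ • 𝒳) :=
  .of_degree_mul
    (fun l ζ hζ => by
      rw [Fn.smul_apply, add_assoc]; exact mul_mem_deg hξ (h.degree l ζ hζ))
    fun ζ χ => by
      simp only [Fn.smul_apply, h.mul, mul_add, ← mul_assoc]
      rw [mul_comm_sgn hξ (sgn j ζ), sgn_sgn]

/-- This identifies the conjugate `parity ∘ 𝒳 ∘ parity` in `lie` with `(-1)^j 𝒳`, so that `lie` is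
the usual graded commutator on vector fields. -/
theorem IsVectorField.parity_apply (h : IsVectorField j 𝒳) (ξ : Fn A V W) :
    parity (𝒳 ξ) = j.negOnePow • 𝒳 (parity ξ) := by
  induction ξ using Fn.homogeneous_induction with
  | mem k ξ hξ =>
    rw [parity_of_mem_deg (h.degree k ξ hξ), parity_of_mem_deg hξ, Int.negOnePow_add, mul_smul,
      Units.smul_def k.negOnePow ξ, map_zsmul]
    rfl
  | add x y hx hy => simp only [map_add, hx, hy, smul_add]

/-! ### The graded commutator with a homological vector field -/

theorem SplitLieTwoAlgebroid.lie_apply (𝒬 : SplitLieTwoAlgebroid A V W)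
    (𝒳 : Fn A V W →ₗ[ℝ] Fn A V W) (ξ : Fn A V W) :
    𝒬.lie 𝒳 ξ = 𝒬.vf (𝒳 ξ) - parity (𝒳 (parity (𝒬.vf ξ))) := rfl

theorem SplitLieTwoAlgebroid.vf_vf (𝒬 : SplitLieTwoAlgebroid A V W) (ξ : Fn A V W) :
    𝒬.vf (𝒬.vf ξ) = 0 := congr($𝒬.sq_zero ξ)

theorem SplitLieTwoAlgebroid.parity_vf (𝒬 : SplitLieTwoAlgebroid A V W) (ξ : Fn A V W) :
    parity (𝒬.vf ξ) = -𝒬.vf (parity ξ) := by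
  rw [𝒬.isVectorField.parity_apply, Int.negOnePow_one, Units.neg_smul, one_smul]

theorem SplitLieTwoAlgebroid.vf_mul (𝒬 : SplitLieTwoAlgebroid A V W) (ξ ζ : Fn A V W) :
    𝒬.vf (ξ * ζ) = 𝒬.vf ξ * ζ + parity ξ * 𝒬.vf ζ := by
  rw [𝒬.isVectorField.mul, sgn_odd (by decide)]

theorem SplitLieTwoAlgebroid.lie_add (𝒬 : SplitLieTwoAlgebroid A V W)
    (𝒳 𝒴 : Fn A V W →ₗ[ℝ] Fn A V W) : 𝒬.lie (𝒳 + 𝒴) = 𝒬.lie 𝒳 + 𝒬.lie 𝒴 := by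
  ext ξ
  simp only [lie_apply, LinearMap.add_apply, map_add]
  abel

theorem SplitLieTwoAlgebroid.lie_smul_real (𝒬 : SplitLieTwoAlgebroid A V W) (r : ℝ)
    (𝒳 : Fn A V W →ₗ[ℝ] Fn A V W) : 𝒬.lie (r • 𝒳) = r • 𝒬.lie 𝒳 := by
  ext ξ
  simp only [lie_apply, LinearMap.smul_apply, map_smul, smul_sub]

/-- Here `𝒳` is an arbitrary linear operator: only `𝒬` differentiates `ξ`, and conjugation by
`parity` produces the sign of the second term. -/
theorem SplitLieTwoAlgebroid.lie_smul (𝒬 : SplitLieTwoAlgebroid A V W) {k : ℤ} {ξ : Fn A V W}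
    (hξ : ξ ∈ deg A V W k) (𝒳 : Fn A V W →ₗ[ℝ] Fn A V W) :
    𝒬.lie (ξ • 𝒳) = 𝒬.vf ξ • 𝒳 + k.negOnePow • (ξ • 𝒬.lie 𝒳) := by
  ext ζ
  have h : parity ξ = k.negOnePow • ξ := parity_of_mem_deg hξ
  simp only [lie_apply, Fn.smul_apply, vf_mul, LinearMap.add_apply, parity_mul, h]
  rw [Units.smul_def, Units.smul_def, LinearMap.smul_apply, Fn.smul_apply, lie_apply,
    smul_mul_assoc, smul_mul_assoc, mul_sub, smul_sub]
  abel

/-- The terms containing `𝒬` twice on one side of `𝒳` vanish by `𝒬² = 0`; the two mixed terms cancel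
because `parity` anticommutes with `𝒬`. -/
theorem SplitLieTwoAlgebroid.lie_lie (𝒬 : SplitLieTwoAlgebroid A V W)
    (𝒳 : Fn A V W →ₗ[ℝ] Fn A V W) : 𝒬.lie (𝒬.lie 𝒳) = 0 := by
  ext ξ
  simp only [lie_apply, map_sub, vf_vf, parity_vf, map_neg, map_zero, LinearMap.zero_apply]
  simp

theorem IsVectorField.lie (h : IsVectorField j 𝒳) (𝒬 : SplitLieTwoAlgebroid A V W) :
    IsVectorField (j + 1) (𝒬.lie 𝒳) := by
  have hl (ξ) : 𝒬.lie 𝒳 ξ = 𝒬.vf (𝒳 ξ) - j.negOnePow • 𝒳 (𝒬.vf ξ) := by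
    rw [𝒬.lie_apply, h.parity_apply, parity_parity]
  refine .of_degree_mul (fun k ξ hξ => ?_) fun ξ ζ => ?_
  · rw [hl, Units.smul_def]
    refine sub_mem ?_ (zsmul_mem ?_ _)
    · have := 𝒬.isVectorField.degree _ _ (h.degree k ξ hξ)
      rwa [show j + 1 + k = 1 + (j + k) by ring]
    · have := h.degree _ _ (𝒬.isVectorField.degree k ξ hξ)
      rwa [show j + 1 + k = j + (1 + k) by ring]
  · have h1 := h.parity_apply ξ
    have h2 := 𝒬.parity_vf ξ
    rw [hl, hl, hl, h.mul, 𝒬.vf_mul, map_add, map_add, 𝒬.vf_mul, 𝒬.vf_mul, h.mul, h.mul, h1]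
    -- All signs depend only on the parity of `j`. In both cases the mixed terms, where `𝒬` and `𝒳`
    -- hit different factors, cancel.
    rcases Int.even_or_odd j with hj | hj
    · rw [Int.negOnePow_even _ hj, sgn_even hj, sgn_even hj, sgn_even hj,
        sgn_odd (by simpa [Int.even_add_one] using hj)]
      simp only [one_smul, mul_sub, sub_mul]
      abel
    · have hj' : ¬ Even j := by simpa using hj
      rw [Int.negOnePow_odd _ hj, sgn_odd hj', sgn_odd hj', sgn_odd hj', parity_parity,
        sgn_even hj.add_one, h2]
      simp only [Units.neg_smul, one_smul, Fn.neg_mul', sub_neg_eq_add, mul_add, add_mul]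
      abel

end VectorField

/-! ### The vector fields `q̂`, `β̂` and `∇_X` -/

section Hat
variable {A : Type*} [CommRing A] {V W T : Type*} [AddCommGroup V] [Module A V]
  [AddCommGroup W] [Module A W] [AddCommGroup T] [Module A T]

/-- For the zero form the Clifford algebra is the exterior algebra, and this antiderivation property
becomes the Leibniz rule of `q̂`. Keeping `v` arbitrary in the induction lets the product case
reassociate. -/
theorem contractLeft_mul {P : Type*} [AddCommGroup P] [Module A P] (d : Module.Dual A P)
    (u v : CliffordAlgebra (0 : QuadraticForm A P)) :
    CliffordAlgebra.contractLeft d (u * v) = CliffordAlgebra.contractLeft d u * v +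
      CliffordAlgebra.involute u * CliffordAlgebra.contractLeft d v := by
  induction u using CliffordAlgebra.induction generalizing v with
  | algebraMap r => simp [CliffordAlgebra.contractLeft_algebraMap_mul]
  | ι x =>
    simp [CliffordAlgebra.contractLeft_ι_mul, CliffordAlgebra.contractLeft_ι, Algebra.smul_def,
      sub_eq_add_neg]
  | add a b ha hb => simp only [add_mul, map_add, ha, hb]; abel
  | mul a b ha hb => simp only [mul_assoc, ha, hb, map_mul, mul_add, add_mul]; abel

variable [Algebra ℝ A]

theorem hatV_tmul (q : V) (u : ExteriorAlgebra A (Module.Dual A V))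
    (s : SymmetricAlgebra A (Module.Dual A W)) :
    hatV q (u ⊗ₜ[A] s) = (CliffordAlgebra.contractLeft (Q := (0 : QuadraticForm A _))
      (Module.Dual.eval A V q) u) ⊗ₜ[A] s := rfl

theorem hatV_algebraMap (q : V) (f : A) : hatV q (algebraMap A (Fn A V W) f) = 0 := by
  rw [Fn.algebraMap_apply, hatV_tmul]
  erw [CliffordAlgebra.contractLeft_algebraMap]
  rw [TensorProduct.zero_tmul]

theorem hatV_ιV (q : V) (φ : Module.Dual A V) :
    hatV q (ιV A V W φ) = algebraMap A _ (φ q) := by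
  rw [ιV_apply, hatV_tmul]
  erw [CliffordAlgebra.contractLeft_ι]
  rfl

theorem hatV_ιW (q : V) (b : Module.Dual A W) : hatV q (ιW A V W b) = 0 := by
  rw [ιW_apply, hatV_tmul]
  erw [CliffordAlgebra.contractLeft_one]
  rw [TensorProduct.zero_tmul]

theorem isVectorField_hatV (q : V) :
    IsVectorField (-1) (hatV q : Fn A V W →ₗ[ℝ] Fn A V W) := by
  refine .of_generators (fun f => ?_) (fun φ => ?_) (fun b => ?_) fun ξ ζ => ?_
  · rw [hatV_algebraMap]; exact zero_mem _
  · rw [hatV_ιV]; exact algebraMap_mem_deg _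
  · rw [hatV_ιW]; exact zero_mem _
  · rw [sgn_odd (by decide)]
    induction ξ using TensorProduct.induction_on with
    | zero => simp
    | add x y hx hy => simp only [add_mul, map_add, hx, hy]; abel
    | tmul u s =>
      induction ζ using TensorProduct.induction_on with
      | zero => simp
      | add x y hx hy => simp only [mul_add, map_add, hx, hy]; abel
      | tmul u' s' =>
        rw [parity_apply, parityHom, Algebra.TensorProduct.map_tmul, hatV_tmul, hatV_tmul,
          Algebra.TensorProduct.tmul_mul_tmul, hatV_tmul, Algebra.TensorProduct.tmul_mul_tmul,
          Algebra.TensorProduct.tmul_mul_tmul]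
        erw [contractLeft_mul]
        rw [TensorProduct.add_tmul]
        rfl

section
variable (X : Derivation ℝ A A) (D : Module.Dual A V →+ Module.Dual A V)
    (hD : ∀ (f : A) (p : Module.Dual A V), D (f • p) = f • D p + X f • p)
    (D' : Module.Dual A W →+ SymmetricAlgebra A (Module.Dual A W))
    (hD' : ∀ (f : A) (p : Module.Dual A W),
      D' (f • p) = f • D' p + X f • SymmetricAlgebra.ι A _ p)

theorem evenDer_mul (ξ ζ : Fn A V W) :
    evenDer X D hD D' hD' (ξ * ζ) = evenDer X D hD D' hD' ξ * ζ + ξ * evenDer X D hD D' hD' ζ := by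
  induction ξ using TensorProduct.induction_on with
  | zero => simp
  | add x y hx hy => simp only [add_mul, map_add, hx, hy]; abel
  | tmul u s =>
    induction ζ using TensorProduct.induction_on with
    | zero => simp
    | add x y hx hy => simp only [mul_add, map_add, hx, hy]; abel
    | tmul u' s' =>
      simp only [Algebra.TensorProduct.tmul_mul_tmul, evenDer_tmul, extDer_mul, symDer_mul,
        TensorProduct.add_tmul, TensorProduct.tmul_add, add_mul, mul_add]
      abel

theorem evenDer_algebraMap (f : A) :
    evenDer X D hD D' hD' (algebraMap A (Fn A V W) f) = algebraMap A _ (X f) := by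
  have h : symDer X D' hD' 1 = 0 := by
    rw [← map_one (algebraMap A _), symDer_algebraMap]; simp
  rw [Fn.algebraMap_apply, evenDer_tmul, extDer_algebraMap, h, TensorProduct.tmul_zero, add_zero]
  rfl

theorem evenDer_ιV (φ : Module.Dual A V) :
    evenDer X D hD D' hD' (ιV A V W φ) = ιV A V W (D φ) := by
  have h : symDer X D' hD' 1 = 0 := by
    rw [← map_one (algebraMap A _), symDer_algebraMap]; simp
  rw [ιV_apply, evenDer_tmul, extDer_ι, h, TensorProduct.tmul_zero, add_zero]
  rfl

theorem evenDer_ιW (b : Module.Dual A W) :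
    evenDer X D hD D' hD' (ιW A V W b) = 1 ⊗ₜ D' b := by
  have h : extDer X D hD 1 = 0 := by
    rw [← map_one (algebraMap A _), extDer_algebraMap]; simp
  rw [ιW_apply, evenDer_tmul, symDer_ι, h, TensorProduct.zero_tmul, zero_add]

end

theorem hatW_algebraMap (β : W) (f : A) : hatW β (algebraMap A (Fn A V W) f) = 0 :=
  (evenDer_algebraMap ..).trans (by simp)

theorem hatW_ιV (β : W) (φ : Module.Dual A V) : hatW β (ιV A V W φ) = 0 :=
  (evenDer_ιV ..).trans (by simp)

theorem hatW_ιW (β : W) (b : Module.Dual A W) :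
    hatW β (ιW A V W b) = algebraMap A _ (b β) :=
  (evenDer_ιW ..).trans (Algebra.TensorProduct.algebraMap_apply' _).symm

theorem isVectorField_hatW (β : W) :
    IsVectorField (-2) (hatW β : Fn A V W →ₗ[ℝ] Fn A V W) := by
  refine .of_generators (fun f => ?_) (fun φ => ?_) (fun b => ?_) fun ξ ζ => ?_
  · rw [hatW_algebraMap]; exact zero_mem _
  · rw [hatW_ιV]; exact zero_mem _
  · rw [hatW_ιW]; exact algebraMap_mem_deg _
  · rw [sgn_even (by decide)]; exact evenDer_mul ..

variable {act : T →ₗ[A] Derivation ℝ A A} (D : Connection act V) (D' : Connection act W)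

theorem horizontal_algebraMap (X : T) (f : A) :
    D.horizontal D' X (algebraMap A (Fn A V W) f) = algebraMap A _ (act X f) :=
  evenDer_algebraMap ..

theorem horizontal_ιV (X : T) (φ : Module.Dual A V) :
    D.horizontal D' X (ιV A V W φ) = ιV A V W (D.dual X φ) :=
  evenDer_ιV ..

theorem horizontal_ιW (X : T) (b : Module.Dual A W) :
    D.horizontal D' X (ιW A V W b) = ιW A V W (D'.dual X b) :=
  evenDer_ιW ..

theorem isVectorField_horizontal (X : T) : IsVectorField 0 (D.horizontal D' X) := by
  refine .of_generators (fun f => ?_) (fun φ => ?_) (fun b => ?_) fun ξ ζ => ?_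
  · rw [horizontal_algebraMap]; exact algebraMap_mem_deg _
  · rw [horizontal_ιV]; exact ιV_mem_deg _
  · rw [horizontal_ιW]; exact ιW_mem_deg _
  · rw [sgn_even (by decide)]; exact evenDer_mul ..

end Hat

/-! ### Finite dual bases -/

/-- A finite dual basis of a module, which exists exactly for finite projective modules. -/
structure DualBasis (A P : Type*) [CommRing A] [AddCommGroup P] [Module A P] where
  /-- the number of elements -/
  n : ℕ
  /-- the elements of the module -/
  vec : Fin n → P
  /-- the coordinate functionals -/
  cov : Fin n → Module.Dual A P
  sum_smul : ∀ v, ∑ i, cov i v • vec i = v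

namespace DualBasis
variable {A P : Type*} [CommRing A] [AddCommGroup P] [Module A P]

/-- The coordinates, as a linear map. -/
def coord (b : DualBasis A P) : P →ₗ[A] (Fin b.n → A) := LinearMap.pi b.cov

/-- The linear combination with given coefficients. -/
def comb (b : DualBasis A P) : (Fin b.n → A) →ₗ[A] P := Fintype.linearCombination A b.vec

theorem comb_coord (b : DualBasis A P) : b.comb ∘ₗ b.coord = LinearMap.id := by
  ext v
  simpa [comb, coord, Fintype.linearCombination_apply] using b.sum_smul v

theorem finite (b : DualBasis A P) : Module.Finite A P :=
  .of_surjective b.comb fun v => ⟨b.coord v, congr($b.comb_coord v)⟩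

theorem eq_zero (b : DualBasis A P) {v : P} (h : ∀ φ : Module.Dual A P, φ v = 0) : v = 0 := by
  rw [← b.sum_smul v]; simp [h]

/-- The dual basis of the dual module. -/
def dual (b : DualBasis A P) : DualBasis A (Module.Dual A P) where
  n := b.n
  vec := b.cov
  cov i := Module.Dual.eval A P (b.vec i)
  sum_smul φ := by
    ext v
    conv_rhs => rw [← b.sum_smul v]
    simp [mul_comm]

/-- `P` is a retract of some `A^n`: the standard basis is projected to `P`, and the coordinates are
restricted along the section. -/
theorem exists_of_projective [Module.Finite A P] [Module.Projective A P] :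
    Nonempty (DualBasis A P) := by
  obtain ⟨n, f, g, -, -, h⟩ := Module.Finite.exists_comp_eq_id_of_projective A P
  refine ⟨⟨n, fun i => f (Pi.single i 1), fun i => LinearMap.proj i ∘ₗ g, fun v => ?_⟩⟩
  have h1 := congr($h v)
  rw [LinearMap.comp_apply, LinearMap.id_apply] at h1
  conv_rhs => rw [← h1, ← Finset.univ_sum_single (g v)]
  rw [map_sum]
  refine Finset.sum_congr rfl fun i _ => ?_
  rw [← map_smul]
  congr 1
  ext j
  simp [Pi.single_apply]

/-- By functoriality `⋀ P` is a retract of `⋀ (A^n)`, which is free. The symmetric algebra is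
treated in the same way below. -/
theorem projective_exteriorAlgebra (b : DualBasis A P) :
    Module.Projective A (ExteriorAlgebra A P) := by
  have : Module.Free A (ExteriorAlgebra A (Fin b.n → A)) :=
    .of_basis (Pi.basisFun A (Fin b.n)).ExteriorAlgebra
  refine .of_split (ExteriorAlgebra.map b.coord).toLinearMap (ExteriorAlgebra.map b.comb).toLinearMap ?_
  rw [← AlgHom.comp_toLinearMap, ExteriorAlgebra.map_comp_map, comb_coord, ExteriorAlgebra.map_id]
  rfl

theorem projective_symmetricAlgebra (b : DualBasis A P) :
    Module.Projective A (SymmetricAlgebra A P) := by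
  let f : SymmetricAlgebra A P →ₐ[A] SymmetricAlgebra A (Fin b.n → A) :=
    SymmetricAlgebra.lift (SymmetricAlgebra.ι A _ ∘ₗ b.coord)
  let g : SymmetricAlgebra A (Fin b.n → A) →ₐ[A] SymmetricAlgebra A P :=
    SymmetricAlgebra.lift (SymmetricAlgebra.ι A _ ∘ₗ b.comb)
  have h : g.comp f = AlgHom.id A _ := by
    ext v
    simpa [f, g] using congr(SymmetricAlgebra.ι A P ($b.comb_coord v))
  refine .of_split f.toLinearMap g.toLinearMap ?_
  rw [← AlgHom.comp_toLinearMap, h]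
  rfl

end DualBasis

/-! ### Contractions and the homogeneous pieces as projective modules -/

/-- Contraction of the second factor with a functional. -/
def pair (C : Type*) {A E : Type*} [CommRing A] [AddCommGroup C] [Module A C] [AddCommGroup E]
    [Module A E] (g : E →ₗ[A] A) : C ⊗[A] E →ₗ[A] C :=
  (TensorProduct.rid A C).toLinearMap ∘ₗ g.lTensor C

section
variable {A C E : Type*} [CommRing A] [AddCommGroup C] [Module A C] [AddCommGroup E]
    [Module A E]

@[simp] theorem pair_tmul (g : E →ₗ[A] A) (ξ : C) (e : E) : pair C g (ξ ⊗ₜ e) = g e • ξ := by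
  simp [pair]

/-- If functionals separate the points of `E`, contractions with them separate the points of
`C ⊗ E` for `C` projective. -/
theorem eq_zero_of_pair [Module.Projective A C] {ι : Type*} (g : ι → E →ₗ[A] A)
    (hg : ∀ e, (∀ i, g i e = 0) → e = 0) {t : C ⊗[A] E} (ht : ∀ i, pair C (g i) t = 0) :
    t = 0 := by
  classical
  -- A splitting `s` makes `C` a summand of the free module `C →₀ A`, so `C ⊗ E` embeds into `C →₀
  -- E`, where vanishing is checked in each coordinate. No projectivity of `E` is needed, so `E` can
  -- be the module of vector fields with the functionals `X ↦ X(f)`.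
  obtain ⟨s, hs⟩ := Module.projective_def'.1 ‹Module.Projective A C›
  let Φ : C ⊗[A] E →ₗ[A] (C →₀ E) :=
    (TensorProduct.finsuppScalarLeft A E C).toLinearMap ∘ₗ s.rTensor E
  have hΦ : Function.Injective Φ := by
    refine (TensorProduct.finsuppScalarLeft A E C).injective.comp ?_
    refine Function.LeftInverse.injective
      (g := (Finsupp.linearCombination A id).rTensor E) fun x => ?_
    rw [← LinearMap.comp_apply, ← LinearMap.rTensor_comp, hs, LinearMap.rTensor_id,
      LinearMap.id_apply]
  refine hΦ ?_
  rw [map_zero]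
  ext x
  refine hg _ fun i => ?_
  have key (t : C ⊗[A] E) : g i (Φ t x) = s (pair C (g i) t) x := by
    induction t using TensorProduct.induction_on with
    | zero => simp
    | add a b ha hb => simp [ha, hb]
    | tmul ξ e => simp [Φ, mul_comm]
  rw [key, ht]
  simp
end

section
variable {A : Type*} [CommRing A] {V W : Type*} [AddCommGroup V] [Module A V]
  [AddCommGroup W] [Module A W]

theorem projective_fn (bV : DualBasis A V) (bW : DualBasis A W) :
    Module.Projective A (Fn A V W) := by
  have := bV.dual.projective_exteriorAlgebra
  have := bW.dual.projective_symmetricAlgebra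
  infer_instance

variable [Algebra ℝ A]

/-- Disjointness is again independence of eigenspaces of `dilation`. The complement serves to make
`deg k` a direct summand of the functions. -/
theorem isCompl_deg (k : ℤ) : IsCompl (deg A V W k) (⨆ i ≠ k, deg A V W i) := by
  constructor
  · rw [Submodule.disjoint_def]
    intro x hx hy
    let ψ : Module.End ℝ (Fn A V W) := (dilation (V := V) (W := W)).toLinearMap.restrictScalars ℝ
    have hind := ψ.eigenspaces_iSupIndep.comp
      (zpow_right_injective₀ (a := (2 : ℝ)) two_pos (by norm_num))
    have hle {i : ℤ} {ξ : Fn A V W} (h : ξ ∈ deg A V W i) : ξ ∈ ψ.eigenspace ((2 : ℝ) ^ i) :=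
      Module.End.mem_eigenspace_iff.2 (dilation_of_mem_deg h)
    refine Submodule.disjoint_def.1 (hind k) x (hle hx) ?_
    refine Submodule.iSup_induction _ (motive := fun x => x ∈ ⨆ i ≠ k, ψ.eigenspace ((2 : ℝ) ^ i))
      hy (fun i x hx => ?_) (zero_mem _) fun x y => add_mem
    refine Submodule.iSup_induction _ (motive := fun x => x ∈ ⨆ i ≠ k, ψ.eigenspace ((2 : ℝ) ^ i))
      hx (fun hi x hx => ?_) (zero_mem _) fun x y => add_mem
    exact Submodule.mem_iSup_of_mem i (Submodule.mem_iSup_of_mem hi (hle hx))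
  · rw [codisjoint_iff, eq_top_iff, ← iSup_deg]
    refine iSup_le fun i => ?_
    by_cases hi : i = k
    · subst hi; exact le_sup_left
    · exact le_sup_of_le_right (le_iSup₂_of_le i hi le_rfl)

/-- As a finitely generated summand of the projective module `Fn A V W`, each homogeneous piece is
finite projective. -/
theorem exists_dualBasis_deg (bV : DualBasis A V) (bW : DualBasis A W) (k : ℤ) :
    Nonempty (DualBasis A (deg A V W k)) := by
  have := projective_fn bV bW
  have := bV.dual.finite
  have := bW.dual.finite
  have : Module.Finite A (deg A V W k) := .of_fg (fg_deg k)
  have : Module.Projective A (deg A V W k) :=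
    .of_split (deg A V W k).subtype (Submodule.projectionOnto _ _ (isCompl_deg k))
      (Submodule.projectionOnto_comp_subtype _)
  exact DualBasis.exists_of_projective

end

section Tensor
variable {A : Type*} [CommRing A] {V W T : Type*} [AddCommGroup V] [Module A V]
  [AddCommGroup W] [Module A W] [AddCommGroup T] [Module A T]

open ThreeTerm in
theorem ThreeTerm.eq_sum (η : ThreeTerm A V W T V W) :
    η = in₀ A V W T V W ((LinearMap.fst A T (V × W)).lTensor _ η) +
      in₁ A V W T V W ((LinearMap.fst A V W ∘ₗ LinearMap.snd A T (V × W)).lTensor _ η) +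
      in₂ A V W T V W ((LinearMap.snd A V W ∘ₗ LinearMap.snd A T (V × W)).lTensor _ η) := by
  induction η using TensorProduct.induction_on with
  | zero => simp
  | add x y hx hy =>
    conv_lhs => rw [hx, hy]
    simp only [map_add]
    abel
  | tmul ξ e =>
    obtain ⟨X, q, β⟩ := e
    simp [in₀, in₁, in₂, ← TensorProduct.tmul_add]

theorem Fn.algebraMap_mul (f : A) (ξ : Fn A V W) : algebraMap A _ f * ξ = f • ξ :=
  (Algebra.smul_def f ξ).symm

theorem mul_algebraMap (ξ : Fn A V W) (f : A) : ξ * algebraMap A _ f = f • ξ := by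
  rw [← Algebra.commutes]; exact Fn.algebraMap_mul f ξ

theorem tensor_deg_induction {E : Type*} [AddCommGroup E] [Module A E] {k : ℤ}
    {motive : Fn A V W ⊗[A] E → Prop}
    (tmul : ∀ ξ ∈ deg A V W k, ∀ e, motive (ξ ⊗ₜ e)) (zero : motive 0)
    (add : ∀ t t', motive t → motive t' → motive (t + t')) {t : Fn A V W ⊗[A] E}
    (ht : t ∈ Submodule.map₂ (TensorProduct.mk A _ _) (deg A V W k) ⊤) : motive t := by
  rw [Submodule.map₂_eq_span_image2] at ht
  refine Submodule.closure_induction (p := fun x _ => motive x) zero (fun x y _ _ => add x y) ?_ ht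
  rintro a _ ⟨ξ, hξ, e, -, rfl⟩
  exact tmul (a • ξ) (Submodule.smul_mem _ _ hξ) e

theorem tmul_mem_map₂ {E : Type*} [AddCommGroup E] [Module A E] {k : ℤ} {ξ : Fn A V W}
    (hξ : ξ ∈ deg A V W k) (e : E) :
    ξ ⊗ₜ e ∈ Submodule.map₂ (TensorProduct.mk A (Fn A V W) E) (deg A V W k) ⊤ :=
  Submodule.apply_mem_map₂ _ hξ trivial

end Tensor

section Adjoint
variable {A : Type*} [CommRing A] [Algebra ℝ A] {V W T : Type*} [AddCommGroup V] [Module A V]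
  [AddCommGroup W] [Module A W] [AddCommGroup T] [Module A T]
  {act : T →ₗ[A] Derivation ℝ A A} (D : Connection act V) (D' : Connection act W)

/-! ### Vector fields of given degree -/

/-- The action on functions, as a linear functional of the vector field. -/
def evalAct (act : T →ₗ[A] Derivation ℝ A A) (f : A) : T →ₗ[A] A where
  toFun X := act X f
  map_add' X Y := by simp
  map_smul' g X := by simp

theorem muNabla_in₀ (ξ : Fn A V W) (X : T) :
    muNabla D D' (ThreeTerm.in₀ A V W T V W (ξ ⊗ₜ X)) = ξ • D.horizontal D' X :=
  (muNabla_tmul D D' ξ X 0 0).trans (by simp only [map_zero, add_zero])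

theorem muNabla_in₁ (ξ : Fn A V W) (q : V) :
    muNabla D D' (ThreeTerm.in₁ A V W T V W (ξ ⊗ₜ q)) = ξ • hatV q :=
  (muNabla_tmul D D' ξ 0 q 0).trans (by simp only [map_zero, add_zero, zero_add])

theorem muNabla_in₂ (ξ : Fn A V W) (β : W) :
    muNabla D D' (ThreeTerm.in₂ A V W T V W (ξ ⊗ₜ β)) = ξ • hatW β :=
  (muNabla_tmul D D' ξ 0 0 β).trans (by simp only [map_zero, zero_add])

/-- This and the next six evaluations put `muNabla` in triangular form: degree 0 generators detect
only the `T`-component, and of the other two components `ιV` detects only the one in `V` and `ιW`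
only the one in `W`, always by contraction. -/
theorem muNabla_in₀_algebraMap (t : Fn A V W ⊗[A] T) (f : A) :
    muNabla D D' (ThreeTerm.in₀ A V W T V W t) (algebraMap A _ f) = pair _ (evalAct act f) t := by
  induction t using TensorProduct.induction_on with
  | zero => simp
  | add x y hx hy => simp only [map_add, LinearMap.add_apply, hx, hy]
  | tmul ξ X =>
    rw [muNabla_in₀, Fn.smul_apply, horizontal_algebraMap, mul_algebraMap, pair_tmul]; rfl

theorem muNabla_in₁_algebraMap (t : Fn A V W ⊗[A] V) (f : A) :
    muNabla D D' (ThreeTerm.in₁ A V W T V W t) (algebraMap A _ f) = 0 := by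
  induction t using TensorProduct.induction_on with
  | zero => simp
  | add x y hx hy => simp only [map_add, LinearMap.add_apply, hx, hy, add_zero]
  | tmul ξ X => rw [muNabla_in₁, Fn.smul_apply, hatV_algebraMap, mul_zero]

theorem muNabla_in₁_ιV (t : Fn A V W ⊗[A] V) (φ : Module.Dual A V) :
    muNabla D D' (ThreeTerm.in₁ A V W T V W t) (ιV A V W φ) = pair _ φ t := by
  induction t using TensorProduct.induction_on with
  | zero => simp
  | add x y hx hy => simp only [map_add, LinearMap.add_apply, hx, hy]
  | tmul ξ X => rw [muNabla_in₁, Fn.smul_apply, hatV_ιV, mul_algebraMap, pair_tmul]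

theorem muNabla_in₁_ιW (t : Fn A V W ⊗[A] V) (b : Module.Dual A W) :
    muNabla D D' (ThreeTerm.in₁ A V W T V W t) (ιW A V W b) = 0 := by
  induction t using TensorProduct.induction_on with
  | zero => simp
  | add x y hx hy => simp only [map_add, LinearMap.add_apply, hx, hy, add_zero]
  | tmul ξ X => rw [muNabla_in₁, Fn.smul_apply, hatV_ιW, mul_zero]

theorem muNabla_in₂_algebraMap (t : Fn A V W ⊗[A] W) (f : A) :
    muNabla D D' (ThreeTerm.in₂ A V W T V W t) (algebraMap A _ f) = 0 := by
  induction t using TensorProduct.induction_on with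
  | zero => simp
  | add x y hx hy => simp only [map_add, LinearMap.add_apply, hx, hy, add_zero]
  | tmul ξ X => rw [muNabla_in₂, Fn.smul_apply, hatW_algebraMap, mul_zero]

theorem muNabla_in₂_ιV (t : Fn A V W ⊗[A] W) (φ : Module.Dual A V) :
    muNabla D D' (ThreeTerm.in₂ A V W T V W t) (ιV A V W φ) = 0 := by
  induction t using TensorProduct.induction_on with
  | zero => simp
  | add x y hx hy => simp only [map_add, LinearMap.add_apply, hx, hy, add_zero]
  | tmul ξ X => rw [muNabla_in₂, Fn.smul_apply, hatW_ιV, mul_zero]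

theorem muNabla_in₂_ιW (t : Fn A V W ⊗[A] W) (b : Module.Dual A W) :
    muNabla D D' (ThreeTerm.in₂ A V W T V W t) (ιW A V W b) = pair _ b t := by
  induction t using TensorProduct.induction_on with
  | zero => simp
  | add x y hx hy => simp only [map_add, LinearMap.add_apply, hx, hy]
  | tmul ξ X => rw [muNabla_in₂, Fn.smul_apply, hatW_ιW, mul_algebraMap, pair_tmul]

/-- `μ_∇` is injective. -/
theorem muNabla_injective (bV : DualBasis A V) (bW : DualBasis A W)
    (hact : Function.Injective act) : Function.Injective (muNabla D D') := by
  have := projective_fn bV bW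
  rw [injective_iff_map_eq_zero]
  intro η hη
  obtain ⟨t₀, t₁, t₂, rfl⟩ : ∃ t₀ t₁ t₂, η = ThreeTerm.in₀ A V W T V W t₀ +
      ThreeTerm.in₁ A V W T V W t₁ + ThreeTerm.in₂ A V W T V W t₂ := ⟨_, _, _, η.eq_sum⟩
  have h (ξ) : muNabla D D' (ThreeTerm.in₀ A V W T V W t₀) ξ +
      muNabla D D' (ThreeTerm.in₁ A V W T V W t₁) ξ +
      muNabla D D' (ThreeTerm.in₂ A V W T V W t₂) ξ = 0 := by
    have := congr($hη ξ)
    rw [map_add, map_add] at this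
    exact this
  obtain rfl : t₀ = 0 := by
    refine eq_zero_of_pair (evalAct act) (fun X hX => ?_) fun f => ?_
    · refine (injective_iff_map_eq_zero act).1 hact X ?_
      ext f
      exact hX f
    · rw [← muNabla_in₀_algebraMap D D', ← h (algebraMap A _ f), muNabla_in₁_algebraMap,
        muNabla_in₂_algebraMap, add_zero, add_zero]
  obtain rfl : t₁ = 0 := by
    refine eq_zero_of_pair (fun φ : Module.Dual A V => φ) (fun q => bV.eq_zero) fun φ => ?_
    rw [← muNabla_in₁_ιV D D', ← h (ιV A V W φ), muNabla_in₂_ιV]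
    simp
  obtain rfl : t₂ = 0 := by
    refine eq_zero_of_pair (fun φ : Module.Dual A W => φ) (fun q => bW.eq_zero) fun φ => ?_
    rw [← muNabla_in₂_ιW D D', ← h (ιW A V W φ)]
    simp
  simp

theorem isVectorField_muNabla {k : ℤ} {η : ThreeTerm A V W T V W}
    (hη : η ∈ ThreeTerm.deg A V W T V W k) : IsVectorField k (muNabla D D' η) := by
  rw [ThreeTerm.deg, Submodule.mem_sup] at hη
  obtain ⟨_, hη, _, ⟨t₂, h₂, rfl⟩, rfl⟩ := hη
  obtain ⟨_, ⟨t₀, h₀, rfl⟩, _, ⟨t₁, h₁, rfl⟩, rfl⟩ := Submodule.mem_sup.1 hη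
  rw [map_add, map_add]
  refine .add (.add ?_ ?_) ?_
  · refine tensor_deg_induction (motive := fun t =>
      IsVectorField k (muNabla D D' (ThreeTerm.in₀ A V W T V W t))) (fun ξ hξ X => ?_)
      (by rw [map_zero, map_zero]; exact .zero)
      (fun t t' h h' => by rw [map_add, map_add]; exact h.add h') h₀
    rw [muNabla_in₀]
    simpa using (isVectorField_horizontal D D' X).smul hξ
  · refine tensor_deg_induction (motive := fun t =>
      IsVectorField k (muNabla D D' (ThreeTerm.in₁ A V W T V W t))) (fun ξ hξ X => ?_)
      (by rw [map_zero, map_zero]; exact .zero)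
      (fun t t' h h' => by rw [map_add, map_add]; exact h.add h') h₁
    rw [muNabla_in₁]
    simpa using (isVectorField_hatV X).smul hξ
  · refine tensor_deg_induction (motive := fun t =>
      IsVectorField k (muNabla D D' (ThreeTerm.in₂ A V W T V W t))) (fun ξ hξ X => ?_)
      (by rw [map_zero, map_zero]; exact .zero)
      (fun t t' h h' => by rw [map_add, map_add]; exact h.add h') h₂
    rw [muNabla_in₂]
    simpa using (isVectorField_hatW X).smul hξ

/-- A vector field that kills `A` is vertical, hence tensorial; its values on `Γ(Q*)` and `Γ(B)` are
then fixed by those on a dual basis. -/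
theorem IsVectorField.map_smul_of_vanishing {j : ℤ} {𝒳 : Fn A V W →ₗ[ℝ] Fn A V W}
    (h : IsVectorField j 𝒳) (hA : ∀ f, 𝒳 (algebraMap A _ f) = 0) (f : A) (ξ : Fn A V W) :
    𝒳 (f • ξ) = f • 𝒳 ξ := by
  rw [← Fn.algebraMap_mul, h.mul, hA, zero_mul, zero_add, sgn_algebraMap, Fn.algebraMap_mul]

/-- The coefficients of the restriction of a vector field to functions of degree 0. -/
def IsVectorField.coeffDer {k : ℤ} {𝒳 : Fn A V W →ₗ[ℝ] Fn A V W} (h : IsVectorField k 𝒳)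
    (ν : deg A V W k →ₗ[A] A) : Derivation ℝ A A :=
  have hk (f : A) : 𝒳 (algebraMap A _ f) ∈ deg A V W k := by
    simpa only [add_zero] using h.degree 0 _ (algebraMap_mem_deg f)
  let δ (f : A) : deg A V W k := ⟨𝒳 (algebraMap A _ f), hk f⟩
  Derivation.mk'
    { toFun := fun f => ν (δ f)
      map_add' := fun f g => by
        rw [← map_add]
        congr 1
        exact Subtype.ext (by simp only [δ, map_add]; rfl)
      map_smul' := fun r f => by
        rw [RingHom.id_apply, ← algebraMap_smul A r (ν _), ← map_smul]
        congr 1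
        refine Subtype.ext ?_
        change 𝒳 (algebraMap A _ (r • f)) = algebraMap ℝ A r • 𝒳 (algebraMap A _ f)
        rw [algebraMap_smul, ← map_smul]
        congr 1
        rw [Fn.algebraMap_apply, Fn.algebraMap_apply, TensorProduct.smul_tmul']
        congr 1
        rw [← algebraMap_smul A r f, smul_eq_mul, map_mul, ← Algebra.smul_def, algebraMap_smul] }
    (fun f g => by
      change ν (δ (f * g)) = f • ν (δ g) + g • ν (δ f)
      rw [← map_smul, ← map_smul, ← map_add]
      congr 1
      refine Subtype.ext ?_
      change 𝒳 (algebraMap A _ (f * g)) = f • 𝒳 (algebraMap A _ g) + g • 𝒳 (algebraMap A _ f)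
      rw [map_mul, h.mul, sgn_algebraMap, mul_algebraMap, Fn.algebraMap_mul, add_comm])

theorem IsVectorField.sum_coeffDer {k : ℤ} {𝒳 : Fn A V W →ₗ[ℝ] Fn A V W}
    (h : IsVectorField k 𝒳) (b : DualBasis A (deg A V W k)) (f : A) :
    ∑ i, h.coeffDer (b.cov i) f • (b.vec i : Fn A V W) = 𝒳 (algebraMap A _ f) := by
  have hk : 𝒳 (algebraMap A _ f) ∈ deg A V W k := by
    simpa only [add_zero] using h.degree 0 _ (algebraMap_mem_deg f)
  have := congr(($(b.sum_smul ⟨_, hk⟩) : Fn A V W))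
  rw [AddSubmonoidClass.coe_finsetSum] at this
  exact this

/-- Every vector field of degree `k` is in the image under `μ_∇` of the elements of degree `k`. -/
theorem exists_muNabla_eq (bV : DualBasis A V) (bW : DualBasis A W)
    (hact : Function.Surjective act) {k : ℤ} {𝒳 : Fn A V W →ₗ[ℝ] Fn A V W}
    (h : IsVectorField k 𝒳) :
    ∃ η ∈ ThreeTerm.deg A V W T V W k, muNabla D D' η = 𝒳 := by
  obtain ⟨b⟩ := exists_dualBasis_deg bV bW k
  -- In a dual basis of `deg k` the coefficients of `𝒳` restricted to `A` are ordinary derivations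
  -- of `A`, hence come from elements of `T`. Thus `t₀` reproduces `𝒳` on `A`.
  choose X hX using fun i => hact (h.coeffDer (b.cov i))
  let t₀ : Fn A V W ⊗[A] T := ∑ i, (b.vec i : Fn A V W) ⊗ₜ X i
  have ht₀ : ThreeTerm.in₀ A V W T V W t₀ ∈ ThreeTerm.deg A V W T V W k :=
    (le_sup_left.trans le_sup_left : _ ≤ ThreeTerm.deg A V W T V W k)
      (Submodule.mem_map_of_mem (sum_mem fun i _ => tmul_mem_map₂ (b.vec i).2 _))
  let 𝒴 := 𝒳 - muNabla D D' (ThreeTerm.in₀ A V W T V W t₀)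
  have hY : IsVectorField k 𝒴 := h.sub (isVectorField_muNabla D D' ht₀)
  have hYA (f) : 𝒴 (algebraMap A _ f) = 0 := by
    simp only [𝒴, LinearMap.sub_apply, muNabla_in₀_algebraMap]
    simp only [t₀, map_sum, pair_tmul]
    rw [← h.sum_coeffDer b f, sub_eq_zero]
    exact Finset.sum_congr rfl fun i _ => congr($((hX i).symm) f • (b.vec i : Fn A V W))
  have hYs := hY.map_smul_of_vanishing hYA
  -- Both `t₁` and `t₂` can be read off from the same `𝒴`, since `q̂` vanishes on `Γ(B)` and `β̂` on
  -- `Γ(Q*)`. The coefficients have degrees `k + 1` and `k + 2`, offsetting the degrees `-1` and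
  -- `-2` of the sections.
  let t₁ : Fn A V W ⊗[A] V := ∑ i, 𝒴 (ιV A V W (bV.cov i)) ⊗ₜ bV.vec i
  have ht₁ : ThreeTerm.in₁ A V W T V W t₁ ∈ ThreeTerm.deg A V W T V W k :=
    (le_sup_right.trans le_sup_left : _ ≤ ThreeTerm.deg A V W T V W k)
      (Submodule.mem_map_of_mem
        (sum_mem fun i _ => tmul_mem_map₂ (hY.degree 1 _ (ιV_mem_deg _)) _))
  let t₂ : Fn A V W ⊗[A] W := ∑ i, 𝒴 (ιW A V W (bW.cov i)) ⊗ₜ bW.vec i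
  have ht₂ : ThreeTerm.in₂ A V W T V W t₂ ∈ ThreeTerm.deg A V W T V W k :=
    (le_sup_right : _ ≤ ThreeTerm.deg A V W T V W k)
      (Submodule.mem_map_of_mem
        (sum_mem fun i _ => tmul_mem_map₂ (hY.degree 2 _ (ιW_mem_deg _)) _))
  refine ⟨_, add_mem (add_mem ht₀ ht₁) ht₂, ?_⟩
  refine (sub_eq_zero.1 ?_).symm
  refine (h.sub (isVectorField_muNabla D D' (add_mem (add_mem ht₀ ht₁) ht₂))).eq_zero
    (fun f => ?_) (fun φ => ?_) fun φ => ?_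
  · have := hYA f
    simp only [𝒴, map_add, LinearMap.sub_apply, LinearMap.add_apply, muNabla_in₁_algebraMap,
      muNabla_in₂_algebraMap, add_zero] at this ⊢
    exact this
  · have h1 : 𝒴 (ιV A V W φ) = pair _ φ t₁ := by
      conv_lhs => rw [← bV.dual.sum_smul φ, map_sum, map_sum]
      simp only [t₁, map_sum, pair_tmul, map_smul, hYs]
      rfl
    rw [← muNabla_in₁_ιV D D', ← sub_eq_zero] at h1
    simp only [𝒴, map_add, LinearMap.sub_apply, LinearMap.add_apply, muNabla_in₂_ιV, add_zero]
      at h1 ⊢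
    rw [← h1]; abel
  · have h1 : 𝒴 (ιW A V W φ) = pair _ φ t₂ := by
      conv_lhs => rw [← bW.dual.sum_smul φ, map_sum, map_sum]
      simp only [t₂, map_sum, pair_tmul, map_smul, hYs]
      rfl
    rw [← muNabla_in₂_ιW D D', ← sub_eq_zero] at h1
    simp only [𝒴, map_add, LinearMap.sub_apply, LinearMap.add_apply, muNabla_in₁_ιW, add_zero]
      at h1 ⊢
    rw [← h1]; abel

end Adjoint

/-! ### Endomorphisms as tensors -/

section Tensor
variable {A : Type*} [CommRing A] {V W T : Type*} [AddCommGroup V] [Module A V]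
  [AddCommGroup W] [Module A W] [AddCommGroup T] [Module A T]

/-- This provides the elements of `Γ(Q*) ⊗ Γ(Q)` and `Γ(B) ⊗ Γ(B*)` that represent `∇'_X - ∇_X`. -/
theorem DualBasis.dualTensorHom_surjective {P : Type*} [AddCommGroup P] [Module A P]
    (b : DualBasis A P) : Function.Surjective (dualTensorHom A P P) := fun f =>
  ⟨∑ i, b.cov i ⊗ₜ f (b.vec i), by
    ext v
    conv_rhs => rw [← b.sum_smul v]
    simp⟩

/-- Contracting the vector leg turns the endomorphism into its transpose, the form in which
differences of dual connections appear. -/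
theorem pair_ιV (s : Module.Dual A V ⊗[A] V) (φ : Module.Dual A V) :
    pair _ φ ((ιV A V W).rTensor V s) = ιV A V W (φ ∘ₗ dualTensorHom A V V s) := by
  induction s using TensorProduct.induction_on with
  | zero => simp
  | add x y hx hy => simp only [map_add, hx, hy, LinearMap.comp_add]
  | tmul ψ v =>
    rw [LinearMap.rTensor_tmul, pair_tmul, ← map_smul]
    congr 1
    ext; simp [mul_comm]

theorem pair_ιW (s : Module.Dual A W ⊗[A] W) (φ : Module.Dual A W) :
    pair _ φ ((ιW A V W).rTensor W s) = ιW A V W (φ ∘ₗ dualTensorHom A W W s) := by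
  induction s using TensorProduct.induction_on with
  | zero => simp
  | add x y hx hy => simp only [map_add, hx, hy, LinearMap.comp_add]
  | tmul ψ v =>
    rw [LinearMap.rTensor_tmul, pair_tmul, ← map_smul]
    congr 1
    ext; simp [mul_comm]

theorem in₁_mem_deg_zero (s : Module.Dual A V ⊗[A] V) :
    ThreeTerm.in₁ A V W T V W ((ιV A V W).rTensor V s) ∈ ThreeTerm.deg A V W T V W 0 := by
  refine (le_sup_right.trans le_sup_left : _ ≤ ThreeTerm.deg A V W T V W 0)
    (Submodule.mem_map_of_mem ?_)
  induction s using TensorProduct.induction_on with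
  | zero => rw [map_zero]; exact zero_mem _
  | add x y hx hy => rw [map_add]; exact add_mem hx hy
  | tmul ψ v => exact tmul_mem_map₂ (ιV_mem_deg ψ) v

theorem in₂_mem_deg_zero (s : Module.Dual A W ⊗[A] W) :
    ThreeTerm.in₂ A V W T V W ((ιW A V W).rTensor W s) ∈ ThreeTerm.deg A V W T V W 0 := by
  refine (le_sup_right : _ ≤ ThreeTerm.deg A V W T V W 0) (Submodule.mem_map_of_mem ?_)
  induction s using TensorProduct.induction_on with
  | zero => rw [map_zero]; exact zero_mem _
  | add x y hx hy => rw [map_add]; exact add_mem hx hy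
  | tmul ψ v => exact tmul_mem_map₂ (ιW_mem_deg ψ) v

end Tensor

/-! ### Transport of the graded commutator and change of connections -/

section Main
variable {A : Type*} [CommRing A] [Algebra ℝ A] {V W T : Type*} [AddCommGroup V] [Module A V]
  [AddCommGroup W] [Module A W] [AddCommGroup T] [Module A T]
  {act : T →ₗ[A] Derivation ℝ A A}

/-- Real scalars act through constant functions, so `C(𝓜)`-linearity of `muNabla` yields real
linearity. -/
theorem algebraMap_smul_threeTerm (r : ℝ) (η : ThreeTerm A V W T V W) :
    (r • (1 : Fn A V W)) • η = r • η := by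
  induction η using TensorProduct.induction_on with
  | zero => simp
  | add x y hx hy => rw [smul_add, hx, hy, smul_add]
  | tmul ξ e =>
    rw [TensorProduct.smul_tmul', TensorProduct.smul_tmul', smul_eq_mul]
    congr 1
    exact (LinearMap.mulRight ℝ ξ).map_smul r 1 |>.trans (by simp)

theorem muNabla_smul_real (D : Connection act V) (D' : Connection act W) (r : ℝ)
    (η : ThreeTerm A V W T V W) : muNabla D D' (r • η) = r • muNabla D D' η := by
  rw [← algebraMap_smul_threeTerm, map_smul]
  ext ξ
  exact (LinearMap.mulRight ℝ (muNabla D D' η ξ)).map_smul r 1 |>.trans (by simp)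

theorem muNabla_mem_vectorFields (D : Connection act V) (D' : Connection act W)
    (η : ThreeTerm A V W T V W) : muNabla D D' η ∈ vectorFields A V W := by
  induction η using TensorProduct.induction_on with
  | zero => simp
  | add x y hx hy => rw [map_add]; exact add_mem hx hy
  | tmul ξ e =>
    obtain ⟨X, q, β⟩ := e
    rw [muNabla_tmul]
    induction ξ using Fn.homogeneous_induction with
    | mem k ξ hξ =>
      rw [smul_add, smul_add]
      exact add_mem (Submodule.subset_span ⟨_, (isVectorField_horizontal D D' X).smul hξ⟩)
        (add_mem (Submodule.subset_span ⟨_, (isVectorField_hatV q).smul hξ⟩)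
          (Submodule.subset_span ⟨_, (isVectorField_hatW β).smul hξ⟩))
    | add x y hx hy => rw [add_smul]; exact add_mem hx hy

theorem isIsoOntoVectorFields (bV : DualBasis A V) (bW : DualBasis A W)
    (hact : Function.Bijective act) (D : Connection act V) (D' : Connection act W) :
    IsIsoOntoVectorFields D D' where
  injective := muNabla_injective D D' bV bW hact.1
  range 𝒳 := by
    refine ⟨fun ⟨η, h⟩ => h ▸ muNabla_mem_vectorFields D D' η, fun h => ?_⟩
    induction h using Submodule.span_induction with
    | mem 𝒳 h =>
      obtain ⟨j, h⟩ := h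
      obtain ⟨η, -, rfl⟩ := exists_muNabla_eq D D' bV bW hact.2 h
      exact ⟨η, rfl⟩
    | zero => exact ⟨0, map_zero _⟩
    | add 𝒳 𝒴 _ _ h h' =>
      obtain ⟨η, rfl⟩ := h
      obtain ⟨η', rfl⟩ := h'
      exact ⟨η + η', map_add _ _ _⟩
    | smul r 𝒳 _ h =>
      obtain ⟨η, rfl⟩ := h
      exact ⟨r • η, muNabla_smul_real D D' r η⟩
  degree k η := by
    refine ⟨isVectorField_muNabla D D', fun h => ?_⟩
    -- Some preimage has degree `k`, and by injectivity it is `η`.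
    obtain ⟨η', h', h''⟩ := exists_muNabla_eq D D' bV bW hact.2 h
    rwa [← muNabla_injective D D' bV bW hact.1 h'']

theorem SplitLieTwoAlgebroid.lie_mem_vectorFields (𝒬 : SplitLieTwoAlgebroid A V W)
    {𝒳 : Fn A V W →ₗ[ℝ] Fn A V W} (h : 𝒳 ∈ vectorFields A V W) :
    𝒬.lie 𝒳 ∈ vectorFields A V W := by
  induction h using Submodule.span_induction with
  | mem 𝒳 h =>
    obtain ⟨j, h⟩ := h
    exact Submodule.subset_span ⟨_, h.lie 𝒬⟩
  | zero =>
    have : 𝒬.lie 0 = 0 := by ext; simp [lie_apply]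
    rw [this]; exact zero_mem _
  | add 𝒳 𝒴 _ _ h h' => rw [lie_add]; exact add_mem h h'
  | smul r 𝒳 _ h => rw [lie_smul_real]; exact Submodule.smul_mem _ _ h

variable {D D₁ : Connection act V} {D' D₁' : Connection act W}

/-- The value of `Function.invFun` is a true preimage only on the range, so this needs the vector
fields to be stable under `[𝒬, ·]`. Together with injectivity it characterizes `adDiff`. -/
theorem IsIsoOntoVectorFields.muNabla_adDiff (h : IsIsoOntoVectorFields D D')
    (𝒬 : SplitLieTwoAlgebroid A V W) (η : ThreeTerm A V W T V W) :
    muNabla D D' (adDiff 𝒬 D D' η) = 𝒬.lie (muNabla D D' η) :=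
  Function.invFun_eq ((h.range _).2 (𝒬.lie_mem_vectorFields (muNabla_mem_vectorFields D D' η)))

/-- The adjoint representation is a representation up to homotopy. -/
theorem IsIsoOntoVectorFields.isRepUpToHomotopy (h : IsIsoOntoVectorFields D D')
    (𝒬 : SplitLieTwoAlgebroid A V W) : IsRepUpToHomotopy 𝒬 (adDiff 𝒬 D D') where
  map_add η η' := h.injective <| by
    rw [map_add, h.muNabla_adDiff, h.muNabla_adDiff, h.muNabla_adDiff, map_add, 𝒬.lie_add]
  map_smul r η := h.injective <| by
    rw [muNabla_smul_real, h.muNabla_adDiff, h.muNabla_adDiff, muNabla_smul_real, 𝒬.lie_smul_real]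
  degree k η hη := by
    rw [h.degree, h.muNabla_adDiff]
    exact ((h.degree k η).1 hη).lie 𝒬
  leibniz k ξ hξ η := h.injective <| by
    rw [map_add, map_smul, Units.smul_def, map_zsmul, map_smul, h.muNabla_adDiff,
      h.muNabla_adDiff, map_smul, 𝒬.lie_smul hξ]
    rfl
  sq_zero η := h.injective <| by
    rw [h.muNabla_adDiff, h.muNabla_adDiff, 𝒬.lie_lie, map_zero]

/-- The change of trivialization `μ_{∇₁}⁻¹ ∘ μ_∇`. -/
def IsIsoOntoVectorFields.change (h : IsIsoOntoVectorFields D D')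
    (h₁ : IsIsoOntoVectorFields D₁ D₁') : ThreeTerm A V W T V W ≃ₗ[Fn A V W] ThreeTerm A V W T V W :=
  LinearEquiv.ofInjective _ h.injective ≪≫ₗ
    LinearEquiv.ofEq _ _ (SetLike.ext fun 𝒳 => (h.range 𝒳).trans (h₁.range 𝒳).symm) ≪≫ₗ
      (LinearEquiv.ofInjective _ h₁.injective).symm

theorem IsIsoOntoVectorFields.muNabla_change (h : IsIsoOntoVectorFields D D')
    (h₁ : IsIsoOntoVectorFields D₁ D₁') (η : ThreeTerm A V W T V W) :
    muNabla D₁ D₁' (h.change h₁ η) = muNabla D D' η := by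
  have := congr(($((LinearEquiv.ofInjective _ h₁.injective).apply_symm_apply
    (LinearEquiv.ofEq _ _ (SetLike.ext fun 𝒳 => (h.range 𝒳).trans (h₁.range 𝒳).symm)
      (LinearEquiv.ofInjective _ h.injective η))) : Fn A V W →ₗ[ℝ] Fn A V W))
  exact this

/-- Both differentials are the one operator `[𝒬, ·]` seen through two trivializations, and both
gradings are the one of the vector fields. -/
theorem IsIsoOntoVectorFields.isRepIso_change (h : IsIsoOntoVectorFields D D')
    (h₁ : IsIsoOntoVectorFields D₁ D₁') (𝒬 : SplitLieTwoAlgebroid A V W) :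
    IsRepIso (adDiff 𝒬 D D') (adDiff 𝒬 D₁ D₁') (h.change h₁) where
  degree k η := by rw [h₁.degree, h.muNabla_change h₁, h.degree]
  comm η := h₁.injective <| by
    rw [h.muNabla_change h₁, h.muNabla_adDiff, h₁.muNabla_adDiff, h.muNabla_change h₁]

/-- The difference of two connections. -/
def Connection.diff (D D₁ : Connection act V) (X : T) : V →ₗ[A] V where
  toFun v := D₁.toFun X v - D.toFun X v
  map_add' v w := by simp only [map_add]; abel
  map_smul' f v := by simp only [D.leibniz, D₁.leibniz, RingHom.id_apply, smul_sub]; abel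

/-- Dualizing reverses the sign of the difference, which is why `∇' - ∇` enters the map from `∇` to
`∇'` with a plus sign. -/
theorem Connection.dual_eq_add (D D₁ : Connection act V) (X : T) (φ : Module.Dual A V) :
    D.dual X φ = D₁.dual X φ + φ ∘ₗ D.diff D₁ X := by
  ext v
  simp [Connection.dual_apply, Connection.diff]

theorem IsIsoOntoVectorFields.isIdPlusDifference_change (h : IsIsoOntoVectorFields D D')
    (h₁ : IsIsoOntoVectorFields D₁ D₁') (bV : DualBasis A V) (bW : DualBasis A W) :
    IsIdPlusDifference D D₁ D' D₁' (h.change h₁).toLinearMap := by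
  refine ⟨fun β => h₁.injective ?_, fun q => h₁.injective ?_, fun X => ?_⟩
  -- The fields `β̂` and `q̂` do not involve the connections, so `μ` fixes the sections of `B*` and
  -- of `Q`.
  · refine (h.muNabla_change h₁ _).trans ?_
    simp only [muNabla_tmul, map_zero]
  · refine (h.muNabla_change h₁ _).trans ?_
    simp only [muNabla_tmul, map_zero]
  obtain ⟨s, hs⟩ := bV.dualTensorHom_surjective (D.diff D₁ X)
  obtain ⟨t, ht⟩ := bW.dualTensorHom_surjective (D'.diff D₁' X)
  refine ⟨s, t, fun q => congr($hs q), fun β => congr($ht β), h₁.injective ?_⟩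
  refine (h.muNabla_change h₁ _).trans ?_
  rw [map_add, map_add]
  have e (D : Connection act V) (D' : Connection act W) :
      muNabla D D' (1 ⊗ₜ (X, 0, 0)) = D.horizontal D' X := by
    rw [muNabla_tmul]; simp
  rw [e, e, ← sub_eq_zero]
  -- Both sides are vector fields of degree 0, so it suffices to compare them on generators.
  refine ((isVectorField_horizontal D D' X).sub
    (((isVectorField_horizontal D₁ D₁' X).add (isVectorField_muNabla D₁ D₁' (in₁_mem_deg_zero s))).add
      (isVectorField_muNabla D₁ D₁' (in₂_mem_deg_zero t)))).eq_zero
      (fun f => ?_) (fun φ => ?_) fun φ => ?_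
  · simp only [LinearMap.sub_apply, LinearMap.add_apply, muNabla_in₁_algebraMap,
      muNabla_in₂_algebraMap, horizontal_algebraMap, add_zero, sub_self]
  · simp only [LinearMap.sub_apply, LinearMap.add_apply, muNabla_in₁_ιV,
      muNabla_in₂_ιV, horizontal_ιV, add_zero, pair_ιV, hs, D.dual_eq_add D₁ X φ, map_add, sub_self]
  · simp only [LinearMap.sub_apply, LinearMap.add_apply, muNabla_in₁_ιW,
      muNabla_in₂_ιW, horizontal_ιW, add_zero, pair_ιW, ht, D'.dual_eq_add D₁' X φ, map_add, sub_self]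

end Main

/-! ### Derivations of smooth functions -/

section Hadamard
open ContDiff MeasureTheory
variable {P G : Type*} [NormedAddCommGroup P] [NormedSpace ℝ P] [NormedAddCommGroup G]
  [NormedSpace ℝ G]

/-- Parametric integrals of smooth functions are smooth. -/
theorem contDiff_integral_param {Φ : P × ℝ → G} (hΦ : ContDiff ℝ ∞ Φ) :
    ContDiff ℝ ∞ fun y => ∫ t in (0 : ℝ)..1, Φ (y, t) := by
  -- The integral is the convolution at 0 of the indicator of `(0, 1]` with `s ↦ ρ(s) Φ(y, -s)`. The
  -- bump makes the latter compactly supported and equals 1 on `[-1, 1]`, where it must not change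
  -- the integrand.
  let ρ : ContDiffBump (0 : ℝ) := ⟨1, 2, one_pos, one_lt_two⟩
  let f : ℝ → ℝ := (Set.Ioc 0 1).indicator 1
  let g : P → ℝ → G := fun y s => ρ s • Φ (y, -s)
  have h := contDiffOn_convolution_right_with_param_comp (μ := volume) (n := ⊤)
    (ContinuousLinearMap.lsmul ℝ ℝ : ℝ →L[ℝ] G →L[ℝ] G) (s := (Set.univ : Set P))
    (v := fun _ => (0 : ℝ)) contDiffOn_const (f := f) (g := g) (k := Metric.closedBall 0 2)
    isOpen_univ (isCompact_closedBall 0 2) ?_ ?_ ?_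
  · rw [contDiffOn_univ] at h
    convert h using 2 with y
    rw [convolution_def, intervalIntegral.integral_of_le zero_le_one,
      ← integral_indicator measurableSet_Ioc]
    refine integral_congr_ae (.of_forall fun t => ?_)
    by_cases ht : t ∈ Set.Ioc (0 : ℝ) 1
    · have : ρ (-t) = 1 := ρ.one_of_mem_closedBall (by
        simpa [ρ, abs_le] using ⟨by linarith [ht.1], ht.2⟩)
      simp [f, g, ht, this]
    · simp [f, ht]
  · intro y s _ hs
    have : ρ s = 0 := ρ.zero_of_le_dist (by
      rw [Metric.mem_closedBall, not_le] at hs; exact hs.le)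
    simp [g, this]
  · refine (IntegrableOn.integrable_indicator ?_ measurableSet_Ioc).locallyIntegrable
    exact integrableOn_const (by simp) (by simp)
  · refine ContDiff.contDiffOn ?_
    exact (ρ.contDiff.comp contDiff_snd).smul
      (hΦ.comp (contDiff_fst.prodMk contDiff_snd.neg))

/-- Hadamard's lemma. -/
theorem exists_hadamard {f : P → ℝ} (hf : ContDiff ℝ ∞ f) (a : P) :
    ∃ h : P → (P →L[ℝ] ℝ), ContDiff ℝ ∞ h ∧ ∀ y, f y = f a + h y (y - a) := by
  have hf' : ContDiff ℝ ∞ (fderiv ℝ f) := hf.fderiv_right (by simp)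
  have hcurve : ContDiff ℝ ∞ fun p : P × ℝ => a + p.2 • (p.1 - a) :=
    contDiff_const.add (contDiff_snd.smul (contDiff_fst.sub contDiff_const))
  refine ⟨fun y => ∫ t in (0 : ℝ)..1, fderiv ℝ f (a + t • (y - a)),
    contDiff_integral_param (hf'.comp hcurve), fun y => ?_⟩
  have hc : Continuous fun t : ℝ => fderiv ℝ f (a + t • (y - a)) :=
    hf'.continuous.comp (by fun_prop)
  change f y = f a + (∫ t in (0 : ℝ)..1, fderiv ℝ f (a + t • (y - a))) (y - a)
  rw [ContinuousLinearMap.intervalIntegral_apply (hc.intervalIntegrable 0 1)]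
  have hd (t : ℝ) : HasDerivAt (fun t : ℝ => f (a + t • (y - a)))
      (fderiv ℝ f (a + t • (y - a)) (y - a)) t := by
    have h1 : HasDerivAt (fun t : ℝ => a + t • (y - a)) (y - a) t := by
      simpa using ((hasDerivAt_id t).smul_const (y - a)).const_add a
    exact ((hf.differentiable (by simp)) _).hasFDerivAt.comp_hasDerivAt t h1
  rw [intervalIntegral.integral_eq_sub_of_hasDerivAt (fun t _ => hd t)
    ((hc.clm_apply continuous_const).intervalIntegrable 0 1)]
  simp

end Hadamard

/-! ### Local coordinates and point derivations -/

section Local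
open Bundle Manifold ContDiff Topology Filter
variable {m : ℕ} {M : Type*} [TopologicalSpace M] [ChartedSpace (EuclideanSpace ℝ (Fin m)) M]
  [IsManifold (𝓡 m) ∞ M]

/-- A smooth function is a smooth function of the coordinates near a given point. -/
theorem exists_eventuallyEq_comp_extChartAt (f : Smooth m M) {p₀ p : M}
    (hp : p ∈ (extChartAt (𝓡 m) p₀).source) :
    ∃ F : EuclideanSpace ℝ (Fin m) → ℝ, ContDiff ℝ ∞ F ∧
      ∀ᶠ x in 𝓝 p, f x = F (extChartAt (𝓡 m) p₀ x) := by
  set φ := extChartAt (𝓡 m) p₀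
  obtain ⟨ε, hε, hball⟩ := Metric.isOpen_iff.1 (isOpen_extChartAt_target p₀) _ (φ.map_source hp)
  -- The outer radius stays below `ε`, so the closed support lies in the chart target and the values
  -- of `φ.symm` outside the target are multiplied by 0.
  let ρ : ContDiffBump (φ p) := ⟨ε / 3, ε / 2, by positivity, by linarith⟩
  have hρ : tsupport ρ ⊆ φ.target := by
    rw [ρ.tsupport_eq]
    exact (Metric.closedBall_subset_ball (half_lt_self hε)).trans hball
  have hs : ContDiffOn ℝ ∞ (f ∘ φ.symm) φ.target := by
    rw [← contMDiffOn_iff_contDiffOn]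
    exact f.contMDiff.comp_contMDiffOn (contMDiffOn_extChartAt_symm p₀)
  refine ⟨fun y => ρ y • f (φ.symm y), ?_, ?_⟩
  · rw [contDiff_iff_contDiffAt]
    intro y
    by_cases hy : y ∈ tsupport ρ
    · exact ρ.contDiff.contDiffAt.smul
        (hs.contDiffAt ((isOpen_extChartAt_target p₀).mem_nhds (hρ hy)))
    · refine (contDiffAt_const (c := (0 : ℝ))).congr_of_eventuallyEq ?_
      filter_upwards [notMem_tsupport_iff_eventuallyEq.1 hy] with z hz
      rw [hz]; simp
  · filter_upwards [(isOpen_extChartAt_source p₀).mem_nhds hp,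
      (continuousAt_extChartAt' hp).eventually ρ.eventuallyEq_one] with x hx hx'
    rw [hx', φ.left_inv hx]; simp

variable [T2Space M]

/-- Smooth functions of the coordinates extend to smooth functions, near a given point. -/
theorem exists_smooth_eventuallyEq {F : EuclideanSpace ℝ (Fin m) → ℝ} (hF : ContDiff ℝ ∞ F)
    {p₀ p : M} (hp : p ∈ (extChartAt (𝓡 m) p₀).source) :
    ∃ f : Smooth m M, ∀ᶠ x in 𝓝 p, f x = F (extChartAt (𝓡 m) p₀ x) := by
  obtain ⟨χ, -, hχ⟩ := (SmoothBumpFunction.nhds_basis_tsupport (I := 𝓡 m) p).mem_iff.1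
    ((isOpen_extChartAt_source p₀).mem_nhds hp)
  refine ⟨⟨fun x => χ x • F (extChartAt (𝓡 m) p₀ x), ?_⟩, ?_⟩
  · refine contMDiff_of_tsupport fun x hx => ?_
    have hx' := hχ (tsupport_smul_subset_left _ _ hx)
    refine χ.contMDiff.contMDiffAt.smul (hF.contMDiff.contMDiffAt.comp x ?_)
    exact contMDiffAt_extChartAt' (by simpa using hx')
  · filter_upwards [χ.eventuallyEq_one] with x hx
    change χ x • F (extChartAt (𝓡 m) p₀ x) = _
    rw [hx]; simp

/-- A smooth function that is 1 near `p` and vanishes outside of a neighborhood of `p`. -/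
theorem exists_smooth_bump {p : M} {s : Set M} (hs : s ∈ 𝓝 p) :
    ∃ f : Smooth m M, (∀ᶠ x in 𝓝 p, f x = 1) ∧ tsupport f ⊆ s := by
  obtain ⟨χ, -, hχ⟩ := (SmoothBumpFunction.nhds_basis_tsupport (I := 𝓡 m) p).mem_iff.1 hs
  exact ⟨⟨χ, χ.contMDiff⟩, χ.eventuallyEq_one, hχ⟩

section PointDerivation
variable {p : M} (ℓ : Smooth m M →ₗ[ℝ] ℝ) (hℓ : ∀ f g, ℓ (f * g) = f p * ℓ g + g p * ℓ f)
include hℓ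

/-- A bump `χ` supported where `f = g`, with `χ p = 1`, gives `χ (f - g) = 0`; the Leibniz rule at
`p` turns this into `ℓ (f - g) = 0`. -/
theorem pointDer_congr {f g : Smooth m M} (h : ∀ᶠ x in 𝓝 p, f x = g x) : ℓ f = ℓ g := by
  obtain ⟨χ, h1, hχ⟩ := exists_smooth_bump (m := m) h
  have hz : χ * (f - g) = 0 := by
    ext x
    by_cases hx : x ∈ tsupport χ
    · have := hχ hx
      simp only [Set.mem_ofPred_eq] at this
      simp [this]
    · simp [image_eq_zero_of_notMem_tsupport hx]
  have := hℓ χ (f - g)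
  rw [hz, map_zero, h1.self_of_nhds] at this
  have hfg : (f - g) p = 0 := sub_eq_zero.2 h.self_of_nhds
  rw [hfg, map_sub] at this
  linarith

/-- A point derivation that vanishes on coordinate functions vanishes. -/
theorem pointDer_eq_zero {p₀ : M} (hp : p ∈ (extChartAt (𝓡 m) p₀).source) (c : Fin m → Smooth m M)
    (hc : ∀ i, ∀ᶠ x in 𝓝 p, c i x = extChartAt (𝓡 m) p₀ x i) (h0 : ∀ i, ℓ (c i) = 0) : ℓ = 0 := by
  ext f
  rw [LinearMap.zero_apply]
  have h1 : ℓ 1 = 0 := by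
    have := hℓ 1 1
    simp at this
    exact this
  have hconst (r : ℝ) : ℓ (r • 1) = 0 := by rw [map_smul, h1, smul_zero]
  obtain ⟨F, hF, hfF⟩ := exists_eventuallyEq_comp_extChartAt f hp
  set φ := extChartAt (𝓡 m) p₀
  obtain ⟨h, hh, hFh⟩ := exists_hadamard hF (φ p)
  choose g hg using fun i => exists_smooth_eventuallyEq
    (hh.clm_apply (contDiff_const (c := EuclideanSpace.single i (1 : ℝ)))) hp
  -- Hadamard's lemma in coordinates: the Leibniz rule applied to `g i * (c i - c i p)` leaves only
  -- `g i p * ℓ (c i)`, since the second factor vanishes at `p`.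
  have key : ∀ᶠ x in 𝓝 p, f x =
      (F (φ p) • (1 : Smooth m M) + ∑ i, g i * (c i - c i p • 1)) x := by
    filter_upwards [hfF, eventually_all.2 hc, eventually_all.2 hg] with x h1 h2 h3
    have hcp (i) : c i p = φ p i := (hc i).self_of_nhds
    have hsum : φ x - φ p = ∑ i, (φ x i - φ p i) • EuclideanSpace.single i (1 : ℝ) := by
      ext j
      simp [Pi.single_apply]
    rw [h1, hFh, hsum, map_sum]
    simp only [ContMDiffMap.coe_add, Pi.add_apply, ContMDiffMap.coe_smul, Pi.smul_apply,
      ContMDiffMap.coe_one, Pi.one_apply, smul_eq_mul, mul_one]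
    congr 1
    have := congr($(map_sum (ContMDiffMap.coeFnRingHom (I := 𝓡 m) (N := M) (n := ∞) (R := ℝ) (I' := 𝓘(ℝ, ℝ)))
      (fun i => g i * (c i - c i p • 1)) Finset.univ) x)
    rw [ContMDiffMap.coeFnRingHom_apply] at this
    rw [this, Finset.sum_apply]
    refine Finset.sum_congr rfl fun i _ => ?_
    rw [map_smul, smul_eq_mul, mul_comm, ← h3]
    change _ = g i x * (c i x - c i p * 1)
    rw [h2, hcp, mul_one]
  rw [pointDer_congr ℓ hℓ key, map_add, hconst, map_sum, zero_add]
  refine Finset.sum_eq_zero fun i _ => ?_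
  rw [hℓ, map_sub, h0, hconst]
  have : (c i - c i p • (1 : Smooth m M)) p = 0 := by
    change c i p - c i p * 1 = 0
    ring
  rw [this]; ring

end PointDerivation
end Local

section ActBijective
open Bundle Manifold ContDiff Topology Filter
variable {m : ℕ} {M : Type*} [TopologicalSpace M] [ChartedSpace (EuclideanSpace ℝ (Fin m)) M]

/-- A tangent vector as a point derivation. -/
def tangentDer {p : M} (v : TangentSpace (𝓡 m) p) : Smooth m M →ₗ[ℝ] ℝ where
  toFun f := mvfderiv (𝓡 m) f p v
  map_add' f g := by
    change mvfderiv (𝓡 m) (⇑f + ⇑g) p v = _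
    rw [mvfderiv_add (mdiff f p) (mdiff g p)]; rfl
  map_smul' r f := by
    change mvfderiv (𝓡 m) ((fun _ : M => r) * ⇑f) p v = _
    rw [mvfderiv_mul mdifferentiableAt_const (mdiff f p)]
    simp only [mvfderiv_const, smul_zero, add_zero]
    rfl

theorem tangentDer_mul {p : M} (v : TangentSpace (𝓡 m) p) (f g : Smooth m M) :
    tangentDer v (f * g) = f p * tangentDer v g + g p * tangentDer v f := by
  change mvfderiv (𝓡 m) (⇑f * ⇑g) p v = _
  rw [mvfderiv_mul (mdiff f p) (mdiff g p)]; rfl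

variable [IsManifold (𝓡 m) ∞ M]

theorem act_apply (X : VF m M) (f : Smooth m M) (p : M) :
    act X f p = mvfderiv (𝓡 m) f p (X p) := rfl

/-- The tangent trivialization at `p₀` acts on the fibre at `p` as the derivative of the chart, and
the chain rule with the `i`-th projection gives the claim. Allowing `p ≠ p₀` is what the smoothness
argument for `act_surjective` needs. -/
theorem mvfderiv_coord {p₀ p : M} (hp : p ∈ (chartAt (EuclideanSpace ℝ (Fin m)) p₀).source)
    {c : Smooth m M} {i : Fin m} (hc : ∀ᶠ x in 𝓝 p, c x = extChartAt (𝓡 m) p₀ x i)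
    (v : TangentSpace (𝓡 m) p) :
    mvfderiv (𝓡 m) c p v = (trivializationAt (EuclideanSpace ℝ (Fin m))
      (TangentSpace (𝓡 m)) p₀).continuousLinearMapAt ℝ p v i := by
  rw [TangentBundle.continuousLinearMapAt_trivializationAt hp]
  let pr : EuclideanSpace ℝ (Fin m) →L[ℝ] ℝ := EuclideanSpace.proj i
  have h1 : HasMFDerivAt (𝓡 m) 𝓘(ℝ, ℝ) c p
      (pr.comp (mfderiv (𝓡 m) 𝓘(ℝ, EuclideanSpace ℝ (Fin m)) (extChartAt (𝓡 m) p₀) p)) := by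
    refine HasMFDerivAt.congr_of_eventuallyEq ?_ hc
    exact (pr.hasMFDerivAt (x := extChartAt (𝓡 m) p₀ p)).comp p
      (mdifferentiableAt_extChartAt hp).hasMFDerivAt
  rw [mvfderiv, h1.mfderiv]
  rfl

variable [T2Space M]

theorem exists_coord (p₀ : M) : ∃ c : Fin m → Smooth m M,
    ∀ i, ∀ᶠ x in 𝓝 p₀, c i x = extChartAt (𝓡 m) p₀ x i := by
  choose c hc using fun i => exists_smooth_eventuallyEq
    (F := fun y : EuclideanSpace ℝ (Fin m) => y i)
    (EuclideanSpace.proj (𝕜 := ℝ) i).contDiff (mem_extChartAt_source (I := 𝓡 m) p₀)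
  exact ⟨c, hc⟩

theorem act_injective : Function.Injective (act (m := m) (M := M)) := by
  rw [injective_iff_map_eq_zero]
  intro X hX
  ext p
  obtain ⟨c, hc⟩ := exists_coord (m := m) p
  have hp := mem_chart_source (EuclideanSpace ℝ (Fin m)) p
  let e := trivializationAt (EuclideanSpace ℝ (Fin m)) (TangentSpace (𝓡 m)) p
  have h0 : e.continuousLinearMapAt ℝ p (X p) = 0 := by
    ext i
    rw [← mvfderiv_coord hp (hc i), ← act_apply, hX]
    rfl
  have := e.symmL_continuousLinearMapAt (R := ℝ) (b := p) hp (X p)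
  rw [h0, map_zero] at this
  exact this.symm

/-- Both sides are point derivations at `p`, so agreement on coordinate functions is enough. -/
theorem eval_der_eq {D : Derivation ℝ (Smooth m M) (Smooth m M)} {p₀ p : M}
    (hp : p ∈ (chartAt (EuclideanSpace ℝ (Fin m)) p₀).source) {c : Fin m → Smooth m M}
    (hc : ∀ i, ∀ᶠ x in 𝓝 p, c i x = extChartAt (𝓡 m) p₀ x i) {v : TangentSpace (𝓡 m) p}
    (hv : ∀ i, (trivializationAt (EuclideanSpace ℝ (Fin m))
      (TangentSpace (𝓡 m)) p₀).continuousLinearMapAt ℝ p v i = D (c i) p) (f : Smooth m M) :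
    D f p = mvfderiv (𝓡 m) f p v := by
  let ℓ : Smooth m M →ₗ[ℝ] ℝ :=
    { toFun := fun f => D f p
      map_add' := fun f g => by rw [map_add]; rfl
      map_smul' := fun r f => by rw [D.map_smul]; rfl }
  have h := pointDer_eq_zero (ℓ - tangentDer v) (p := p) (fun f g => ?_)
    (by rwa [extChartAt_source]) c hc (fun i => ?_)
  · exact sub_eq_zero.1 congr($h f)
  · have h1 : ℓ (f * g) = f p * ℓ g + g p * ℓ f := by
      change D (f * g) p = _
      rw [D.leibniz]; rfl
    rw [LinearMap.sub_apply, h1, tangentDer_mul, LinearMap.sub_apply, LinearMap.sub_apply]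
    ring
  · change D (c i) p - mvfderiv (𝓡 m) (c i) p v = 0
    rw [mvfderiv_coord hp (hc i), hv, sub_self]

theorem act_surjective : Function.Surjective (act (m := m) (M := M)) := by
  intro D
  have hex (p : M) : ∃ v : TangentSpace (𝓡 m) p, ∀ f, D f p = mvfderiv (𝓡 m) f p v := by
    obtain ⟨c, hc⟩ := exists_coord (m := m) p
    have hp := mem_chart_source (EuclideanSpace ℝ (Fin m)) p
    let e := trivializationAt (EuclideanSpace ℝ (Fin m)) (TangentSpace (𝓡 m)) p
    refine ⟨e.symmL ℝ p (WithLp.toLp 2 fun i => D (c i) p), eval_der_eq hp hc fun i => ?_⟩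
    rw [e.continuousLinearMapAt_symmL hp]
  choose X hX using hex
  have hsm : ContMDiff (𝓡 m) ((𝓡 m).prod 𝓘(ℝ, EuclideanSpace ℝ (Fin m))) ∞
      fun p => TotalSpace.mk' (EuclideanSpace ℝ (Fin m)) (E := TangentSpace (𝓡 m)) p (X p) := by
    intro p₀
    rw [Bundle.contMDiffAt_section]
    obtain ⟨c, hc⟩ := exists_coord (m := m) p₀
    have hp₀ := mem_chart_source (EuclideanSpace ℝ (Fin m)) p₀
    have h1 : ContMDiffAt (𝓡 m) 𝓘(ℝ, EuclideanSpace ℝ (Fin m)) ∞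
        (fun p => WithLp.toLp 2 fun i => D (c i) p) p₀ := by
      refine (PiLp.continuousLinearEquiv 2 ℝ fun _ : Fin m => ℝ).symm.contDiff.contMDiff.contMDiffAt.comp
        (g := WithLp.toLp 2) (f := fun p i => D (c i) p) p₀ ?_
      exact contMDiffAt_pi_space.2 fun i => (D (c i)).contMDiff.contMDiffAt
    -- The functions `c i` chosen at `p₀` remain coordinates near every point close to `p₀`, so the
    -- local components of `X` there are the smooth functions `D (c i)`.
    refine h1.congr_of_eventuallyEq ?_
    filter_upwards [(chartAt (EuclideanSpace ℝ (Fin m)) p₀).open_source.mem_nhds hp₀,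
      eventually_all.2 fun i => eventually_eventually_nhds.2 (hc i)] with p hp hcp
    ext i
    let e := trivializationAt (EuclideanSpace ℝ (Fin m)) (TangentSpace (𝓡 m)) p₀
    have h2 : e.continuousLinearMapAt ℝ p (X p) = (e ⟨p, X p⟩).2 :=
      e.continuousLinearMapAt_apply_of_mem ℝ hp _
    rw [← h2, ← mvfderiv_coord hp (hcp i), ← hX]
  exact ⟨⟨X, hsm⟩, by ext f p; exact (hX p f).symm⟩

theorem act_bijective : Function.Bijective (act (m := m) (M := M)) :=
  ⟨act_injective, act_surjective⟩

end ActBijective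

/-! ### Spanning families of sections -/

/-- If a set of functionals has few values on finite families of vectors, then a finite family that
is not killed by any of the functionals can be chosen small. -/
theorem exists_fin_forall_exists_ne_zero {V : Type*} [AddCommGroup V] [Module ℝ V]
    {Z : Set (Module.Dual ℝ V)} (hZ : ∀ z ∈ Z, ∀ c : ℝ, c ≠ 0 → c • z ∈ Z) {d : ℕ}
    (hd : ∀ (n : ℕ) (s : Fin n → V), dimH ((fun z : Module.Dual ℝ V => fun i => z (s i)) '' Z) ≤ d)
    {n : ℕ} (s : Fin n → V) (hs : ∀ z ∈ Z, ∃ i, z (s i) ≠ 0) :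
    ∃ t : Fin d → V, ∀ z ∈ Z, ∃ i, z (t i) ≠ 0 := by
  induction n with
  | zero => exact ⟨0, fun z hz => (hs z hz).choose.elim0⟩
  | succ n ih =>
    by_cases hn : n + 1 ≤ d
    · refine ⟨fun i => if h : (i : ℕ) < n + 1 then s ⟨i, h⟩ else 0, fun z hz => ?_⟩
      obtain ⟨i, hi⟩ := hs z hz
      refine ⟨i.castLE hn, ?_⟩
      have : ((i.castLE hn : Fin d) : ℕ) < n + 1 := i.2
      simp only [dif_pos this]
      exact hi
    -- With more than `d` vectors the image has dimension less than `n + 1`, so some `v` with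
    -- nonzero last coordinate avoids it. Projecting along `v` drops one vector: a functional killed
    -- by the projection has values proportional to `v`, which is impossible because `Z` is stable
    -- under nonzero scaling and no `z ∈ Z` kills all of `s`.
    · have hdense : Dense ((fun z : Module.Dual ℝ V => fun i => z (s i)) '' Z)ᶜ := by
        refine dense_compl_of_dimH_lt_finrank ((hd _ s).trans_lt ?_)
        rw [Module.finrank_fin_fun]
        exact_mod_cast Nat.lt_of_not_ge hn
      have hopen : IsOpen {v : Fin (n + 1) → ℝ | v (Fin.last n) ≠ 0} :=
        isOpen_ne_fun (continuous_apply _) continuous_const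
      obtain ⟨v, hv0, hv⟩ := hdense.inter_open_nonempty _ hopen ⟨1, by simp⟩
      rw [Set.mem_ofPred_eq] at hv0
      refine ih (fun i => s i.castSucc - (v i.castSucc / v (Fin.last n)) • s (Fin.last n))
        fun z hz => ?_
      by_contra! h
      have h1 (i : Fin (n + 1)) : z (s i) = (z (s (Fin.last n)) / v (Fin.last n)) * v i := by
        refine Fin.lastCases ?_ (fun i => ?_) i
        · field_simp
        · have := h i
          rw [map_sub, map_smul, smul_eq_mul, sub_eq_zero] at this
          rw [this]; ring
      by_cases h0 : z (s (Fin.last n)) = 0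
      · obtain ⟨i, hi⟩ := hs z hz
        rw [h1, h0] at hi
        simp at hi
      · refine hv ⟨(v (Fin.last n) / z (s (Fin.last n))) • z, hZ z hz _ (div_ne_zero hv0 h0), ?_⟩
        ext i
        change (v (Fin.last n) / z (s (Fin.last n))) * z (s i) = v i
        rw [h1 i]
        field_simp

section
open Bundle Manifold ContDiff Topology Filter
variable {m : ℕ} {M : Type*} [TopologicalSpace M] [ChartedSpace (EuclideanSpace ℝ (Fin m)) M]
  {F : Type*} [NormedAddCommGroup F] [NormedSpace ℝ F]
  {E : M → Type*} [TopologicalSpace (TotalSpace F E)]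
  [∀ x, AddCommGroup (E x)] [∀ x, Module ℝ (E x)] [∀ x, TopologicalSpace (E x)]
  [FiberBundle F E] [VectorBundle ℝ F E] [ContMDiffVectorBundle ∞ F E (𝓡 m)]

theorem finrank_strongDual [FiniteDimensional ℝ F] : Module.finrank ℝ (F →L[ℝ] ℝ) = Module.finrank ℝ F := by
  rw [← (LinearMap.toContinuousLinearMap (𝕜 := ℝ) (E := F) (F' := ℝ)).finrank_eq]
  exact Subspace.dual_finrank_eq

/-- The local coordinates of a section. -/
theorem contMDiffOn_trivialization_section (s : Cₛ^∞⟮𝓡 m; F, E⟯) (p : M) :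
    ContMDiffOn (𝓡 m) 𝓘(ℝ, F) ∞ (fun x => (trivializationAt F E p ⟨x, s x⟩).2)
      (trivializationAt F E p).baseSet :=
  (Trivialization.contMDiffOn_section_baseSet_iff _).1 s.contMDiff.contMDiffOn

variable [IsManifold (𝓡 m) ∞ M] [FiniteDimensional ℝ F]

/-- The values of finitely many sections on covectors. -/
theorem dimH_dual_sections_le [SecondCountableTopology M] {n : ℕ}
    (s : Fin n → Cₛ^∞⟮𝓡 m; F, E⟯) :
    dimH {y : Fin n → ℝ | ∃ (x : M) (φ : Module.Dual ℝ (E x)), y = fun i => φ (s i x)} ≤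
      (m + Module.finrank ℝ F : ℕ) := by
  let U (p : M) : Set M := (extChartAt (𝓡 m) p).source ∩ (trivializationAt F E p).baseSet
  have hUo (p : M) : IsOpen (U p) :=
    (isOpen_extChartAt_source p).inter (trivializationAt F E p).open_baseSet
  have hU (p : M) : U p ∈ 𝓝 p := (hUo p).mem_nhds
    ⟨mem_extChartAt_source p, mem_baseSet_trivializationAt F E p⟩
  obtain ⟨T, hT, hTU⟩ := TopologicalSpace.countable_cover_nhds hU
  -- In charts the set is a countable union of images of open subsets of `ℝ^m × F*` under smooth
  -- maps; these are locally Lipschitz and do not raise Hausdorff dimension.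
  let g (p : M) (z : EuclideanSpace ℝ (Fin m) × (F →L[ℝ] ℝ)) (i : Fin n) : ℝ :=
    z.2 (trivializationAt F E p ⟨(extChartAt (𝓡 m) p).symm z.1, s i ((extChartAt (𝓡 m) p).symm z.1)⟩).2
  let W (p : M) : Set (EuclideanSpace ℝ (Fin m)) :=
    (extChartAt (𝓡 m) p).target ∩ (extChartAt (𝓡 m) p).symm ⁻¹' (trivializationAt F E p).baseSet
  have hW (p : M) : IsOpen (W p) := (continuousOn_extChartAt_symm p).isOpen_inter_preimage
    (isOpen_extChartAt_target p) (trivializationAt F E p).open_baseSet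
  have hg (p : M) : ContDiffOn ℝ ∞ (g p) (W p ×ˢ Set.univ) := by
    refine contDiffOn_pi.2 fun i => ?_
    refine contDiffOn_snd.clm_apply ?_
    have h1 : ContDiffOn ℝ ∞ (fun y => (trivializationAt F E p
        ⟨(extChartAt (𝓡 m) p).symm y, s i ((extChartAt (𝓡 m) p).symm y)⟩).2) (W p) := by
      rw [← contMDiffOn_iff_contDiffOn]
      exact (contMDiffOn_trivialization_section (s i) p).comp
        ((contMDiffOn_extChartAt_symm p).mono Set.inter_subset_left) Set.inter_subset_right
    exact h1.comp contDiffOn_fst fun z hz => hz.1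
  have hdim (p : M) : dimH (g p '' (W p ×ˢ Set.univ)) ≤ (m + Module.finrank ℝ F : ℕ) := by
    refine (dimH_image_le_of_locally_lipschitzOn fun z hz => ?_).trans ?_
    · obtain ⟨K, t, ht, hK⟩ := (((hg p).contDiffAt
        (((hW p).prod isOpen_univ).mem_nhds hz)).of_le (m := 1) (by simp)).exists_lipschitzOnWith
      exact ⟨K, t, mem_nhdsWithin_of_mem_nhds ht, hK⟩
    · refine (dimH_mono (Set.subset_univ _)).trans ?_
      rw [Real.dimH_univ_eq_finrank, Module.finrank_prod, finrank_strongDual,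
        finrank_euclideanSpace_fin]
  refine (dimH_mono (t := ⋃ p ∈ T, g p '' (W p ×ˢ Set.univ)) ?_).trans ?_
  · rintro _ ⟨x, φ, rfl⟩
    have hx : x ∈ ⋃ p ∈ T, U p := hTU ▸ Set.mem_univ x
    simp only [Set.mem_iUnion] at hx
    obtain ⟨p, hp, hx1, hx2⟩ := hx
    let e := (trivializationAt F E p).linearEquivAt ℝ x hx2
    refine Set.mem_biUnion hp ⟨(extChartAt (𝓡 m) p x,
      LinearMap.toContinuousLinearMap (φ ∘ₗ e.symm.toLinearMap)), ⟨⟨?_, ?_⟩, trivial⟩, ?_⟩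
    · exact (extChartAt (𝓡 m) p).map_source hx1
    · rw [Set.mem_preimage, (extChartAt (𝓡 m) p).left_inv hx1]; exact hx2
    · ext i
      change φ (e.symm _) = _
      rw [(extChartAt (𝓡 m) p).left_inv hx1]
      congr 1
      exact e.symm_apply_apply (s i x)
  · rw [dimH_bUnion hT]
    exact iSup₂_le fun p _ => hdim p

end

section
open Bundle Manifold ContDiff Topology Filter
variable {m : ℕ} {M : Type*} [TopologicalSpace M] [ChartedSpace (EuclideanSpace ℝ (Fin m)) M]
  [IsManifold (𝓡 m) ∞ M] [T2Space M]
  {F : Type*} [NormedAddCommGroup F] [NormedSpace ℝ F] [FiniteDimensional ℝ F]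
  {E : M → Type*} [TopologicalSpace (TotalSpace F E)]
  [∀ x, AddCommGroup (E x)] [∀ x, Module ℝ (E x)] [∀ x, TopologicalSpace (E x)]
  [FiberBundle F E] [VectorBundle ℝ F E] [ContMDiffVectorBundle ∞ F E (𝓡 m)]

variable (F E) in
/-- Finitely many sections span the fibers over a compact set. -/
theorem exists_finset_sections_of_isCompact {K : Set M} (hK : IsCompact K) :
    ∃ S : Finset (Cₛ^∞⟮𝓡 m; F, E⟯), ∀ x ∈ K, ∀ φ : Module.Dual ℝ (E x), φ ≠ 0 →
      ∃ s ∈ S, φ (s x) ≠ 0 := by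
  classical
  refine hK.induction_on ?_ ?_ ?_ ?_
  · exact ⟨∅, fun x hx => hx.elim⟩
  · exact fun _ _ h ih => ih.imp fun S hS x hx => hS x (h hx)
  · rintro _ _ ⟨S, hS⟩ ⟨T, hT⟩
    refine ⟨S ∪ T, fun x hx φ hφ => ?_⟩
    rcases hx with hx | hx
    · obtain ⟨s, hs, h⟩ := hS x hx φ hφ
      exact ⟨s, Finset.mem_union_left _ hs, h⟩
    · obtain ⟨s, hs, h⟩ := hT x hx φ hφ
      exact ⟨s, Finset.mem_union_right _ hs, h⟩
  · intro p hp
    let e := trivializationAt F E p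
    let b := Module.finBasis ℝ F
    have he := e.open_baseSet.mem_nhds (mem_baseSet_trivializationAt F E p)
    obtain ⟨f, hf1, hf⟩ := exists_smooth_bump (m := m) he
    -- A local frame, cut off to global sections; it is unchanged where the bump equals 1.
    let s (i : Fin (Module.finrank ℝ F)) : Cₛ^∞⟮𝓡 m; F, E⟯ :=
      ⟨⇑f • e.localFrame b i, ContMDiffOn.smul_section_of_tsupport f.contMDiff.contMDiffOn
        e.open_baseSet hf (e.contMDiffOn_localFrame_baseSet ∞ b i)⟩
    refine ⟨_, mem_nhdsWithin_of_mem_nhds (inter_mem hf1 he), Finset.univ.image s,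
      fun x hx φ hφ => ?_⟩
    by_contra! h
    refine hφ ((e.basisAt b hx.2).ext fun i => ?_)
    have h1 := h (s i) (Finset.mem_image_of_mem _ (Finset.mem_univ i))
    have hfx : f x = 1 := hx.1
    have h2 : s i x = f x • e.localFrame b i x := rfl
    rw [h2, hfx, one_smul, e.localFrame_apply_of_mem_baseSet b hx.2] at h1
    exact h1

variable (F E) in
/-- Over a compact set, the fibers are spanned by a number of sections that does not depend on
the compact set. -/
theorem exists_fin_sections_of_isCompact [SecondCountableTopology M] {K : Set M}
    (hK : IsCompact K) :
    ∃ t : Fin (m + Module.finrank ℝ F) → Cₛ^∞⟮𝓡 m; F, E⟯, ∀ x ∈ K, ∀ φ : Module.Dual ℝ (E x),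
      φ ≠ 0 → ∃ i, φ (t i x) ≠ 0 := by
  obtain ⟨S, hS⟩ := exists_finset_sections_of_isCompact (m := m) F E hK
  let ev (x : M) (φ : Module.Dual ℝ (E x)) : Module.Dual ℝ (Cₛ^∞⟮𝓡 m; F, E⟯) :=
    { toFun := fun s => φ (s x)
      map_add' := fun s t => φ.map_add (s x) (t x)
      map_smul' := fun c s => φ.map_smul c (s x) }
  -- Nonzero covectors over `K`, viewed as functionals on sections. The bound `m + rank` is the
  -- dimension of the total space of the dual bundle.
  let Z : Set (Module.Dual ℝ (Cₛ^∞⟮𝓡 m; F, E⟯)) :=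
    {z | ∃ x ∈ K, ∃ φ : Module.Dual ℝ (E x), φ ≠ 0 ∧ z = ev x φ}
  have hZ : ∀ z ∈ Z, ∀ c : ℝ, c ≠ 0 → c • z ∈ Z := by
    rintro _ ⟨x, hx, φ, hφ, rfl⟩ c hc
    exact ⟨x, hx, c • φ, smul_ne_zero hc hφ, rfl⟩
  have hd (n : ℕ) (s : Fin n → Cₛ^∞⟮𝓡 m; F, E⟯) :
      dimH ((fun z : Module.Dual ℝ (Cₛ^∞⟮𝓡 m; F, E⟯) => fun i => z (s i)) '' Z) ≤
        (m + Module.finrank ℝ F : ℕ) := by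
    refine (dimH_mono ?_).trans (dimH_dual_sections_le s)
    rintro _ ⟨_, ⟨x, -, φ, -, rfl⟩, rfl⟩
    exact ⟨x, φ, rfl⟩
  obtain ⟨t, ht⟩ := exists_fin_forall_exists_ne_zero hZ hd
    (fun i => (S.equivFin.symm i : Cₛ^∞⟮𝓡 m; F, E⟯)) (by
      rintro _ ⟨x, hx, φ, hφ, rfl⟩
      obtain ⟨s, hs, h⟩ := hS x hx φ hφ
      refine ⟨S.equivFin ⟨s, hs⟩, ?_⟩
      rw [Equiv.symm_apply_apply]
      exact h)
  exact ⟨t, fun x hx φ hφ => ht _ ⟨x, hx, φ, hφ, rfl⟩⟩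

variable (F E) in
/-- Finitely many sections span all fibers. -/
theorem exists_fin_sections_span [SecondCountableTopology M] :
    ∃ (n : ℕ) (t : Fin n → Cₛ^∞⟮𝓡 m; F, E⟯), ∀ x, ∀ φ : Module.Dual ℝ (E x),
      φ ≠ 0 → ∃ i, φ (t i x) ≠ 0 := by
  have : LocallyCompactSpace M := Manifold.locallyCompact_of_finiteDimensional (𝓡 m)
  -- The shift gives `K 0 = ∅`, so the truncated index `n - 1` below removes nothing when `n = 0`.
  -- The shells `C n` cover `M`, and each `U n` is a neighbourhood of `C n`.
  let K := (CompactExhaustion.choice M).shiftr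
  let C (n : ℕ) : Set M := K (n + 1) \ interior (K n)
  let U (n : ℕ) : Set M := interior (K (n + 2)) \ K (n - 1)
  have hCc (n : ℕ) : IsClosed (C n) := (K.isCompact _).isClosed.sdiff isOpen_interior
  have hUo (n : ℕ) : IsOpen (U n) := isOpen_interior.sdiff (K.isCompact _).isClosed
  have hCU (n : ℕ) : C n ⊆ U n := by
    refine fun x hx => ⟨K.subset_interior_succ _ hx.1, fun h => hx.2 ?_⟩
    cases n with
    | zero => exact h.elim
    | succ n => exact K.subset_interior_succ _ h
  have hUU {n k : ℕ} (h : n + 3 ≤ k) {x : M} (hn : x ∈ U n) : x ∉ U k :=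
    fun hk => hk.2 (K.subset (by omega) (interior_subset hn.1))
  have hfin : LocallyFinite U := by
    intro x
    obtain ⟨n, hn⟩ := K.exists_mem_nhds x
    refine ⟨_, hn, (Set.finite_lt_nat (n + 1)).subset ?_⟩
    rintro k ⟨y, hyk, hy⟩
    by_contra h
    rw [Set.mem_ofPred_eq, not_lt] at h
    exact hyk.2 (K.subset (by omega) hy)
  have hcut (n : ℕ) : ∃ f : Smooth m M, (∀ x ∈ C n, f x = 1) ∧ ∀ x, x ∉ U n → f x = 0 := by
    obtain ⟨f, h0, h1, -⟩ := exists_contMDiffMap_zero_one_of_isClosed (𝓡 m) (n := ⊤)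
      (hUo n).isClosed_compl (hCc n)
      (Set.disjoint_left.2 fun x hx hx' => hx (hCU n hx'))
    exact ⟨f, fun x hx => h1 hx, fun x hx => h0 hx⟩
  choose f hf1 hf0 using hcut
  choose s hs using fun n => exists_fin_sections_of_isCompact (m := m) F E (K.isCompact (n + 1))
  -- Distinct `U n` with equal index modulo 3 are disjoint. Since every shell uses the same number
  -- of sections, those of one colour can be added up without interference, and `3 (m + rank)`
  -- sections suffice.
  let τ (r : Fin 3) (j : Fin (m + Module.finrank ℝ F)) (n : ℕ) : Cₛ^∞⟮𝓡 m; F, E⟯ :=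
    if n % 3 = r then f n • s n j else 0
  have hτ0 {r j n x} (h : x ∉ U n) : τ r j n x = 0 := by
    by_cases hr : n % 3 = r
    · have : τ r j n x = f n x • s n j x := by simp only [τ, if_pos hr]; rfl
      rw [this, hf0 n x h, zero_smul]
    · simp only [τ, if_neg hr]; rfl
  let t (r : Fin 3) (j : Fin (m + Module.finrank ℝ F)) : Cₛ^∞⟮𝓡 m; F, E⟯ :=
    ⟨fun x => ∑ᶠ n, τ r j n x, ContMDiff.finsum_section_of_locallyFinite
      (hfin.subset fun n x hx => by_contra fun h => hx (hτ0 h)) fun n => (τ r j n).contMDiff⟩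
  refine ⟨_, fun i => t (finProdFinEquiv.symm i).1 (finProdFinEquiv.symm i).2, fun x φ hφ => ?_⟩
  let n := (CompactExhaustion.choice M).find x
  have hx : x ∈ C n := by
    have := (CompactExhaustion.choice M).mem_sdiff_shiftr_find x
    exact ⟨this.1, fun h => this.2 (interior_subset h)⟩
  obtain ⟨j, hj⟩ := hs n x hx.1 φ hφ
  let r : Fin 3 := ⟨n % 3, Nat.mod_lt _ (by norm_num)⟩
  refine ⟨finProdFinEquiv (r, j), ?_⟩
  simp only [Equiv.symm_apply_apply]
  have h1 : t r j x = τ r j n x := by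
    refine finsum_eq_single _ n fun k hk => ?_
    by_cases hr : k % 3 = n % 3
    · refine hτ0 fun hxk => ?_
      rcases lt_or_gt_of_ne hk with h | h
      · exact hUU (by omega) hxk (hCU n hx)
      · exact hUU (by omega) (hCU n hx) hxk
    · simp only [τ, r, if_neg hr]; rfl
  have h2 : τ r j n x = f n x • s n j x := by simp only [τ, r, if_true]; rfl
  rw [h1, h2, hf1 n x hx, one_smul]
  exact hj

end

/-! ### Modules of sections are finite projective -/

section Gramian
variable {W : Type*} [AddCommGroup W] [Module ℝ W] {n : ℕ}

/-- The symmetric bivector `∑ i, w i ⊗ w i` as a map from the dual space. -/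
def gramian (w : Fin n → W) : Module.Dual ℝ W →ₗ[ℝ] W :=
  ∑ i, (Module.Dual.eval ℝ W (w i)).smulRight (w i)

theorem gramian_apply (w : Fin n → W) (φ : Module.Dual ℝ W) :
    gramian w φ = ∑ i, φ (w i) • w i := by
  simp [gramian]

/-- Evaluating `φ` on `gramian w φ` gives `∑ φ(w i)²`, which is positive for `φ ≠ 0`; bijectivity
then follows from equality of dimensions. -/
theorem gramian_bijective [FiniteDimensional ℝ W] {w : Fin n → W}
    (hw : ∀ φ : Module.Dual ℝ W, φ ≠ 0 → ∃ i, φ (w i) ≠ 0) : Function.Bijective (gramian w) := by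
  have hinj : Function.Injective (gramian w) := by
    refine (injective_iff_map_eq_zero _).2 fun φ hφ => ?_
    by_contra h0
    obtain ⟨i, hi⟩ := hw φ h0
    have h1 : ∑ j, φ (w j) * φ (w j) = 0 := by
      simpa [gramian_apply] using congr(φ $hφ)
    rw [Finset.sum_eq_zero_iff_of_nonneg fun j _ => mul_self_nonneg _] at h1
    exact hi (mul_self_eq_zero.1 (h1 i (Finset.mem_univ i)))
  exact ⟨hinj, (LinearMap.injective_iff_surjective_of_finrank_eq_finrank
    Subspace.dual_finrank_eq).1 hinj⟩

end Gramian

section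
open Bundle Manifold ContDiff Topology Filter

section
variable {F : Type*} [NormedAddCommGroup F] [NormedSpace ℝ F] {n : ℕ}

/-- The continuous version of `gramian`. -/
def gramianL (w : Fin n → F) : (F →L[ℝ] ℝ) →L[ℝ] F :=
  ∑ i, (ContinuousLinearMap.apply ℝ ℝ (w i)).smulRight (w i)

theorem gramianL_apply (w : Fin n → F) (φ : F →L[ℝ] ℝ) :
    gramianL w φ = ∑ i, φ (w i) • w i := by
  simp [gramianL]

theorem contDiff_gramianL : ContDiff ℝ ∞ (gramianL : (Fin n → F) → _) := by
  have h : ContDiff ℝ ∞ fun v : F => (ContinuousLinearMap.apply ℝ ℝ v : (F →L[ℝ] ℝ) →L[ℝ] ℝ) := by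
    fun_prop
  exact ContDiff.sum fun i _ =>
    (h.comp (contDiff_apply ℝ F i)).smulRight (contDiff_apply ℝ F i)

theorem exists_equiv_eq_gramianL [FiniteDimensional ℝ F] {w : Fin n → F}
    (hw : ∀ φ : Module.Dual ℝ F, φ ≠ 0 → ∃ i, φ (w i) ≠ 0) :
    ∃ e : (F →L[ℝ] ℝ) ≃L[ℝ] F, (e : (F →L[ℝ] ℝ) →L[ℝ] F) = gramianL w := by
  refine ⟨((LinearMap.toContinuousLinearMap (𝕜 := ℝ) (E := F) (F' := ℝ)).symm.trans
    (LinearEquiv.ofBijective _ (gramian_bijective hw))).toContinuousLinearEquiv, ?_⟩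
  ext φ
  rw [gramianL_apply]
  exact gramian_apply w _

end

variable {m : ℕ} {M : Type*} [TopologicalSpace M] [ChartedSpace (EuclideanSpace ℝ (Fin m)) M]
  {F : Type*} [NormedAddCommGroup F] [NormedSpace ℝ F] [FiniteDimensional ℝ F]
  {E : M → Type*} [TopologicalSpace (TotalSpace F E)]
  [∀ x, AddCommGroup (E x)] [∀ x, Module ℝ (E x)] [∀ x, TopologicalSpace (E x)]
  [FiberBundle F E] [VectorBundle ℝ F E]

include F in
theorem finiteDimensional_fiber (x : M) : FiniteDimensional ℝ (E x) :=
  ((trivializationAt F E x).linearEquivAt ℝ x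
    (mem_baseSet_trivializationAt F E x)).symm.finiteDimensional

variable [ContMDiffVectorBundle ∞ F E (𝓡 m)]

/-- The covectors representing a section in terms of a spanning family are smooth. -/
theorem contMDiff_gramian_preimage {n : ℕ} {t : Fin n → Cₛ^∞⟮𝓡 m; F, E⟯}
    (ht : ∀ x, ∀ φ : Module.Dual ℝ (E x), φ ≠ 0 → ∃ i, φ (t i x) ≠ 0)
    (s u : Cₛ^∞⟮𝓡 m; F, E⟯) (ξ : ∀ x, Module.Dual ℝ (E x))
    (hξ : ∀ x, gramian (fun i => t i x) (ξ x) = s x) :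
    ContMDiff (𝓡 m) 𝓘(ℝ, ℝ) ∞ fun x => ξ x (u x) := by
  intro p
  let e := trivializationAt F E p
  have hp : p ∈ e.baseSet := mem_baseSet_trivializationAt F E p
  let loc (s : Cₛ^∞⟮𝓡 m; F, E⟯) (x : M) : F := (e ⟨x, s x⟩).2
  have hloc (s : Cₛ^∞⟮𝓡 m; F, E⟯) : ContMDiffAt (𝓡 m) 𝓘(ℝ, F) ∞ (loc s) p :=
    (contMDiffOn_trivialization_section s p).contMDiffAt (e.open_baseSet.mem_nhds hp)
  have hspan {x : M} (hx : x ∈ e.baseSet) (φ : Module.Dual ℝ F) (hφ : φ ≠ 0) :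
      ∃ i, φ (loc (t i) x) ≠ 0 := by
    let L := e.linearEquivAt ℝ x hx
    refine ht x (φ ∘ₗ L.toLinearMap) fun h => hφ ?_
    ext v
    simpa using congr($h (L.symm v))
  let G (x : M) := gramianL fun i => loc (t i) x
  have hG : ContMDiffAt (𝓡 m) 𝓘(ℝ, (F →L[ℝ] ℝ) →L[ℝ] F) ∞ G p :=
    contDiff_gramianL.contMDiff.contMDiffAt.comp (f := fun x i => loc (t i) x) p
      (contMDiffAt_pi_space.2 fun i => hloc (t i))
  obtain ⟨e₀, he₀⟩ := exists_equiv_eq_gramianL (hspan hp)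
  -- In the trivialization the covector `ξ x` is `(G x)⁻¹` applied to `s x`, and operator inversion
  -- is smooth at invertible operators.
  have hinv : ContMDiffAt (𝓡 m) 𝓘(ℝ, F →L[ℝ] F →L[ℝ] ℝ) ∞ (fun x => (G x).inverse) p := by
    refine ContMDiffAt.comp (g := ContinuousLinearMap.inverse) p ?_ hG
    change ContMDiffAt _ _ _ _ (gramianL fun i => loc (t i) p)
    rw [← he₀]
    exact (contDiffAt_map_inverse e₀).contMDiffAt
  refine ((hinv.clm_apply (hloc s)).clm_apply (hloc u)).congr_of_eventuallyEq ?_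
  filter_upwards [e.open_baseSet.mem_nhds hp] with x hx
  let L := e.linearEquivAt ℝ x hx
  obtain ⟨e₁, he₁⟩ := exists_equiv_eq_gramianL (hspan hx)
  have hψ : ξ x = ((G x).inverse (loc s x)).toLinearMap ∘ₗ L.toLinearMap := by
    have := finiteDimensional_fiber (F := F) (E := E) x
    refine (gramian_bijective (ht x)).1 ?_
    rw [hξ, gramian_apply]
    refine L.injective ?_
    rw [map_sum]
    simp only [map_smul]
    have h1 : G x ((G x).inverse (loc s x)) = loc s x := by
      change gramianL _ ((gramianL fun i => loc (t i) x).inverse (loc s x)) = _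
      rw [← he₁, ContinuousLinearMap.inverse_equiv]
      exact e₁.apply_symm_apply _
    have h2 := gramianL_apply (fun i => loc (t i) x) ((G x).inverse (loc s x))
    exact h1.symm.trans h2
  rw [hψ]
  rfl

/-- The dual basis given by a finite family of sections that spans the fibers. -/
def dualBasisSections {n : ℕ} {t : Fin n → Cₛ^∞⟮𝓡 m; F, E⟯}
    (ht : ∀ x, ∀ φ : Module.Dual ℝ (E x), φ ≠ 0 → ∃ i, φ (t i x) ≠ 0) :
    DualBasis (Smooth m M) (Cₛ^∞⟮𝓡 m; F, E⟯) :=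
  have hfd := finiteDimensional_fiber (F := F) (E := E)
  -- Inverting the Gramian gives `s = ∑ (H s)(t i) • t i`, so `s ↦ (H s)(t i)` are the coordinate
  -- functionals.
  let H (x : M) : E x ≃ₗ[ℝ] Module.Dual ℝ (E x) :=
    (LinearEquiv.ofBijective _ (gramian_bijective (ht x))).symm
  have hH (x : M) (v : E x) : gramian (fun i => t i x) (H x v) = v :=
    (LinearEquiv.ofBijective _ (gramian_bijective (ht x))).apply_symm_apply v
  { n := n
    vec := t
    cov := fun i =>
      { toFun := fun s => ⟨fun x => H x (s x) (t i x),
          contMDiff_gramian_preimage ht s (t i) _ fun x => hH x (s x)⟩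
        map_add' := fun s u => by
          ext x
          exact congr($((H x).map_add (s x) (u x)) (t i x))
        map_smul' := fun f s => by
          ext x
          exact congr($((H x).map_smul (f x) (s x)) (t i x)) }
    sum_smul := fun s => by
      ext x
      refine (congrFun (map_sum (ContMDiffSection.coeAddHom (𝓡 m) F ∞ E) _ _) x).trans ?_
      rw [Finset.sum_apply]
      exact (gramian_apply _ _).symm.trans (hH x (s x)) }

theorem exists_dualBasis_sections [T2Space M] [SecondCountableTopology M] [IsManifold (𝓡 m) ∞ M]
    (F : Type*) [NormedAddCommGroup F] [NormedSpace ℝ F]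
    [FiniteDimensional ℝ F] (E : M → Type*) [TopologicalSpace (TotalSpace F E)]
    [∀ x, AddCommGroup (E x)] [∀ x, Module ℝ (E x)] [∀ x, TopologicalSpace (E x)]
    [FiberBundle F E] [VectorBundle ℝ F E] [ContMDiffVectorBundle ∞ F E (𝓡 m)] :
    Nonempty (DualBasis (Smooth m M) (Cₛ^∞⟮𝓡 m; F, E⟯)) := by
  obtain ⟨n, t, ht⟩ := exists_fin_sections_span F E (m := m)
  exact ⟨dualBasisSections ht⟩

end

end
end LieTwoAlgebroid

theorem mainTheorem6 {m : ℕ} {M : Type*} [TopologicalSpace M] [T2Space M]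
    [SecondCountableTopology M] [ChartedSpace (EuclideanSpace ℝ (Fin m)) M]
    [IsManifold (𝓡 m) ∞ M]
    -- the vector bundle `Q`, with typical fibre `FQ`
    {FQ : Type*} [NormedAddCommGroup FQ] [NormedSpace ℝ FQ] [FiniteDimensional ℝ FQ]
    {Q : M → Type*} [TopologicalSpace (TotalSpace FQ Q)] [∀ x, AddCommGroup (Q x)]
    [∀ x, Module ℝ (Q x)] [∀ x, TopologicalSpace (Q x)] [∀ x, IsTopologicalAddGroup (Q x)]
    [∀ x, ContinuousSMul ℝ (Q x)] [FiberBundle FQ Q] [VectorBundle ℝ FQ Q]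
    [ContMDiffVectorBundle ∞ FQ Q (𝓡 m)]
    -- the vector bundle `B*`, with typical fibre `FB`
    {FB : Type*} [NormedAddCommGroup FB] [NormedSpace ℝ FB] [FiniteDimensional ℝ FB]
    {Bs : M → Type*} [TopologicalSpace (TotalSpace FB Bs)] [∀ x, AddCommGroup (Bs x)]
    [∀ x, Module ℝ (Bs x)] [∀ x, TopologicalSpace (Bs x)] [∀ x, IsTopologicalAddGroup (Bs x)]
    [∀ x, ContinuousSMul ℝ (Bs x)] [FiberBundle FB Bs] [VectorBundle ℝ FB Bs]
    [ContMDiffVectorBundle ∞ FB Bs (𝓡 m)]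
    -- the structure of a split Lie 2-algebroid on `Q[1] ⊕ B*[2]`
    (𝒬 : SplitLieTwoAlgebroid (Smooth m M) (Cₛ^∞⟮𝓡 m; FQ, Q⟯) (Cₛ^∞⟮𝓡 m; FB, Bs⟯))
    -- the two choices `∇₁`, `∇₂` of `TM`-connections on `Q` and on `B*`
    (nQ₁ nQ₂ : CovariantDerivative (𝓡 m) FQ Q)
    [nQ₁.ContMDiffCovariantDerivative ∞] [nQ₂.ContMDiffCovariantDerivative ∞]
    (nB₁ nB₂ : CovariantDerivative (𝓡 m) FB Bs)
    [nB₁.ContMDiffCovariantDerivative ∞] [nB₂.ContMDiffCovariantDerivative ∞] :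
    -- the two maps `μ_∇` are isomorphisms onto the vector fields
    IsIsoOntoVectorFields (ofCov nQ₁) (ofCov nB₁) ∧
    IsIsoOntoVectorFields (ofCov nQ₂) (ofCov nB₂) ∧
    -- the adjoint representations are representations up to homotopy
    IsRepUpToHomotopy 𝒬 (adDiff 𝒬 (ofCov nQ₁) (ofCov nB₁)) ∧
    IsRepUpToHomotopy 𝒬 (adDiff 𝒬 (ofCov nQ₂) (ofCov nB₂)) ∧
    -- and `id ⊕ (∇₂ - ∇₁)` is an isomorphism between them
    ∃ μ : ThreeTerm (Smooth m M) (Cₛ^∞⟮𝓡 m; FQ, Q⟯) (Cₛ^∞⟮𝓡 m; FB, Bs⟯)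
          (VF m M) (Cₛ^∞⟮𝓡 m; FQ, Q⟯) (Cₛ^∞⟮𝓡 m; FB, Bs⟯)
        ≃ₗ[Fn (Smooth m M) (Cₛ^∞⟮𝓡 m; FQ, Q⟯) (Cₛ^∞⟮𝓡 m; FB, Bs⟯)]
        ThreeTerm (Smooth m M) (Cₛ^∞⟮𝓡 m; FQ, Q⟯) (Cₛ^∞⟮𝓡 m; FB, Bs⟯)
          (VF m M) (Cₛ^∞⟮𝓡 m; FQ, Q⟯) (Cₛ^∞⟮𝓡 m; FB, Bs⟯),
      IsIdPlusDifference (ofCov nQ₁) (ofCov nQ₂) (ofCov nB₁) (ofCov nB₂) μ.toLinearMap ∧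
      IsRepIso (adDiff 𝒬 (ofCov nQ₁) (ofCov nB₁)) (adDiff 𝒬 (ofCov nQ₂) (ofCov nB₂)) μ := by
  -- The manifold and the bundles enter the algebra only through these two dual bases and the
  -- bijectivity of `act`.
  have bV := (exists_dualBasis_sections (m := m) (M := M) FQ Q).some
  have bW := (exists_dualBasis_sections (m := m) (M := M) FB Bs).some
  have hact := act_bijective (m := m) (M := M)
  have h₁ := isIsoOntoVectorFields bV bW hact (ofCov nQ₁) (ofCov nB₁)
  have h₂ := isIsoOntoVectorFields bV bW hact (ofCov nQ₂) (ofCov nB₂)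
  exact ⟨h₁, h₂, h₁.isRepUpToHomotopy 𝒬, h₂.isRepUpToHomotopy 𝒬, h₁.change h₂,
    h₁.isIdPlusDifference_change h₂ bV bW, h₁.isRepIso_change h₂ 𝒬⟩
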